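/- Let $\alpha>0$ and $0<p<\infty$. Let $\mathcal F_\alpha^2$ be the Fock space of all entire functions $f$ with $\|f\|^2=\frac{\alpha}{\pi}\int_{\mathbb C}|f(z)|^2e^{-\alpha|z|^2}\,dm(z)<\infty$, where $m$ is Lebesgue area measure, and let $\mathcal S_p$ be the Schatten class of $\mathcal F_\alpha^2$: the compact operators whose singular values $(s_n)$ satisfy $\|T\|_{\mathcal S_p}=(\sum_n s_n^p)^{1/p}<\infty$. For entire functions $g,\psi$ put $$I_{(g,\psi)}f(z)=\int_0^z f'(\psi(w))g(w)\,dw,\qquad C_{(g,\psi)}f(z)=\int_0^{\psi(z)}f'(w)g(w)\,dw .$$ Let $k_w(z)=e^{\alpha z\overline w-\alpha|w|^2/2}$, $Q_h(z)=|h(z)|e^{-\frac{\alpha}{2}|z|^2}(1+|z|)^{-1}$, and $$B_{(|g|,\psi)}(w)=\int_{\mathbb C}\bigl|(|w|+1)k_w(\psi(z))Q_g(z)\bigr|^2dm(z),\qquad B_{(|g(\psi)|,\psi)}(w)=\int_{\mathbb C}\bigl|(|w|+1)k_w(\psi(z))\psi'(z)Q_{g\circ\psi}(z)\bigr|^2dm(z).$$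 There is a constant $K$, depending only on $\alpha$ and $p$, such that the following hold for all entire $g,\psi$. (i) $I_{(g,\psi)}:\mathcal F_\alpha^2\to\mathcal F_\alpha^2$ belongs to $\mathcal S_p$ if and only if $B_{(|g|,\psi)}\in L^{p/2}(\mathbb C,dm)$. In this case $$K^{-1}\Bigl(\int_{\mathbb C}B_{(|g|,\psi)}^{p/2}\,dm\Bigr)^{1/p}\le\|I_{(g,\psi)}\|_{\mathcal S_p}\le K\Bigl(\int_{\mathbb C}B_{(|g|,\psi)}^{p/2}\,dm\Bigr)^{1/p}.$$ (ii) $C_{(g,\psi)}:\mathcal F_\alpha^2\to\mathcal F_\alpha^2$ belongs to $\mathcal S_p$ if and only if $B_{(|g(\psi)|,\psi)}\in L^{p/2}(\mathbb C,dm)$. In this case $$\Bigl(\int_{\mathbb C}B_{(|g(\psi)|,\psi)}^{p/2}\,dm\Bigr)^{1/p}\le K\|C_{(g,\psi)}\|_{\mathcal S_p};$$ if $\psi(0)=0$, then also $$\|C_{(g,\psi)}\|_{\mathcal S_p}\le K\Bigl(\int_{\mathbb C}B_{(|g(\psi)|,\psi)}^{p/2}\,dm\Bigr)^{1/p};$$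 and for every non-constant entire $\psi$ this last inequality holds for all entire $g$ with $C_{(g,\psi)}\in\mathcal S_p$ when $K$ is replaced by a constant depending only on $\alpha$, $p$ and $\psi$. -/

import Mathlib

open MeasureTheory ComplexConjugate
open scoped ENNReal NNReal

noncomputable section

/-! ### The Fock space -/

theorem fock_integrable_mul {α : ℝ} {f h : ℂ → ℂ} (hf : Continuous f) (hh : Continuous h)
    (hfi : Integrable (fun z : ℂ => ‖f z‖ ^ 2 * Real.exp (-α * ‖z‖ ^ 2)))
    (hhi : Integrable (fun z : ℂ => ‖h z‖ ^ 2 * Real.exp (-α * ‖z‖ ^ 2))) :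
    Integrable (fun z : ℂ => conj (f z) * h z * (Real.exp (-α * ‖z‖ ^ 2) : ℂ)) := by
  refine (hfi.add hhi).mono' ?_ ?_
  · refine Continuous.aestronglyMeasurable ?_
    have := Complex.continuous_conj.comp hf
    simp only [Function.comp_def] at this
    fun_prop
  · refine Filter.Eventually.of_forall fun z => ?_
    have he : 0 < Real.exp (-α * ‖z‖ ^ 2) := Real.exp_pos _
    have h1 : ‖f z‖ * ‖h z‖ ≤ ‖f z‖ ^ 2 + ‖h z‖ ^ 2 := by
      nlinarith [sq_nonneg (‖f z‖ - ‖h z‖), sq_nonneg ‖f z‖, sq_nonneg ‖h z‖]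
    have h2 : ‖conj (f z) * h z * (Real.exp (-α * ‖z‖ ^ 2) : ℂ)‖
        = ‖f z‖ * ‖h z‖ * Real.exp (-α * ‖z‖ ^ 2) := by
      rw [norm_mul, norm_mul, RCLike.norm_conj, Complex.norm_real, Real.norm_of_nonneg he.le]
    rw [h2]
    simp only [Pi.add_apply]
    nlinarith [mul_le_mul_of_nonneg_right h1 he.le]

/-- The entire functions `f` with `∫ |f(z)|² e^{-α|z|²} dm(z) < ∞`. -/
def fockSubmodule (α : ℝ) : Submodule ℂ (ℂ → ℂ) where
  carrier := {f | Differentiable ℂ f ∧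
    Integrable (fun z : ℂ => ‖f z‖ ^ 2 * Real.exp (-α * ‖z‖ ^ 2))}
  zero_mem' := by
    refine ⟨differentiable_const (0 : ℂ), ?_⟩
    simp
  add_mem' := by
    rintro f h ⟨hf, hfi⟩ ⟨hh, hhi⟩
    refine ⟨hf.add hh, ((hfi.add hhi).const_mul 2).mono' ?_ ?_⟩
    · have h1 : Continuous (fun z : ℂ => Real.exp (-α * ‖z‖ ^ 2)) := by fun_prop
      exact (((hf.continuous.add hh.continuous).norm.pow 2).mul h1).aestronglyMeasurable
    · refine Filter.Eventually.of_forall fun z => ?_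
      have he : 0 < Real.exp (-α * ‖z‖ ^ 2) := Real.exp_pos _
      rw [Real.norm_of_nonneg (by positivity)]
      simp only [Pi.add_apply]
      have h1 : ‖f z + h z‖ ^ 2 ≤ 2 * (‖f z‖ ^ 2 + ‖h z‖ ^ 2) := by
        have := norm_add_le (f z) (h z)
        nlinarith [sq_nonneg (‖f z‖ - ‖h z‖), norm_nonneg (f z + h z)]
      nlinarith [mul_le_mul_of_nonneg_right h1 he.le]
  smul_mem' := by
    rintro c f ⟨hf, hfi⟩
    refine ⟨hf.const_smul c, ?_⟩
    have := hfi.const_mul (‖c‖ ^ 2)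
    simpa [mul_pow, mul_assoc] using this

/-- The Fock space `F_α²`. It is a type synonym, so that it does not carry the topology of
pointwise convergence. -/
def FockSpace (α : ℝ) : Type := ↥(fockSubmodule α)

namespace FockSpace

variable {α : ℝ}

instance : AddCommGroup (FockSpace α) := inferInstanceAs (AddCommGroup ↥(fockSubmodule α))

instance : Module ℂ (FockSpace α) := inferInstanceAs (Module ℂ ↥(fockSubmodule α))

instance : FunLike (FockSpace α) ℂ ℂ where
  coe f := f.1
  coe_injective _ _ h := Subtype.ext h

@[simp] theorem add_apply (f h : FockSpace α) (z : ℂ) : (f + h) z = f z + h z := rfl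

@[simp] theorem smul_apply (c : ℂ) (f : FockSpace α) (z : ℂ) : (c • f) z = c * f z := rfl

theorem differentiable (f : FockSpace α) : Differentiable ℂ f := f.2.1

theorem integrable (f : FockSpace α) :
    Integrable (fun z : ℂ => ‖f z‖ ^ 2 * Real.exp (-α * ‖z‖ ^ 2)) := f.2.2

theorem integrable_mul (f h : FockSpace α) :
    Integrable (fun z : ℂ => conj (f z) * h z * (Real.exp (-α * ‖z‖ ^ 2) : ℂ)) :=
  fock_integrable_mul f.differentiable.continuous h.differentiable.continuous
    f.integrable h.integrable

/-- The inner product `(α/π) ∫ conj(f) h e^{-α|z|²} dm` (conjugate-linear in the first variable, as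
in Mathlib); its norm is `‖f‖² = (α/π) ∫ |f|² e^{-α|z|²} dm`. -/
instance instCore [hα : Fact (0 < α)] : InnerProductSpace.Core ℂ (FockSpace α) where
  inner f h := (α / Real.pi : ℝ) *
    ∫ z : ℂ, conj (f z) * h z * (Real.exp (-α * ‖z‖ ^ 2) : ℂ)
  conj_inner_symm f h := by
    rw [map_mul, Complex.conj_ofReal, ← integral_conj]
    have h1 : ∀ z : ℂ, conj (conj (h z) * f z * (Real.exp (-α * ‖z‖ ^ 2) : ℂ))
        = conj (f z) * h z * (Real.exp (-α * ‖z‖ ^ 2) : ℂ) := by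
      intro z
      simp only [map_mul, Complex.conj_conj, Complex.conj_ofReal]
      ring
    simp only [h1]
  re_inner_nonneg f := by
    have : ∀ z : ℂ, conj (f z) * f z * (Real.exp (-α * ‖z‖ ^ 2) : ℂ)
        = ((‖f z‖ ^ 2 * Real.exp (-α * ‖z‖ ^ 2) : ℝ) : ℂ) := by
      intro z
      rw [Complex.conj_mul']
      push_cast
      ring
    simp only [this]
    rw [integral_complex_ofReal, ← Complex.ofReal_mul]
    have h0 : 0 < α := hα.out
    have : 0 ≤ α / Real.pi * ∫ z : ℂ, ‖f z‖ ^ 2 * Real.exp (-α * ‖z‖ ^ 2) :=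
      mul_nonneg (by positivity) (integral_nonneg fun z => by positivity)
    simpa only [Complex.ofReal_re, RCLike.re_eq_complex_re] using this
  add_left f g h := by
    have h1 : ∀ z : ℂ, conj ((f + g) z) * h z * (Real.exp (-α * ‖z‖ ^ 2) : ℂ)
        = conj (f z) * h z * (Real.exp (-α * ‖z‖ ^ 2) : ℂ)
          + conj (g z) * h z * (Real.exp (-α * ‖z‖ ^ 2) : ℂ) := by
      intro z
      simp only [add_apply, map_add]
      ring
    simp only [h1]
    rw [integral_add (integrable_mul f h) (integrable_mul g h), mul_add]
  smul_left f h c := by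
    have h1 : ∀ z : ℂ, conj ((c • f) z) * h z * (Real.exp (-α * ‖z‖ ^ 2) : ℂ)
        = conj c * (conj (f z) * h z * (Real.exp (-α * ‖z‖ ^ 2) : ℂ)) := by
      intro z
      simp only [smul_apply, map_mul]
      ring
    simp only [h1]
    rw [integral_const_mul, mul_left_comm]
  definite f hf := by
    have : ∀ z : ℂ, conj (f z) * f z * (Real.exp (-α * ‖z‖ ^ 2) : ℂ)
        = ((‖f z‖ ^ 2 * Real.exp (-α * ‖z‖ ^ 2) : ℝ) : ℂ) := by
      intro z
      rw [Complex.conj_mul']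
      push_cast
      ring
    simp only [this] at hf
    rw [integral_complex_ofReal, ← Complex.ofReal_mul, Complex.ofReal_eq_zero] at hf
    have h0 : 0 < α := hα.out
    have h1 : α / Real.pi ≠ 0 := by positivity
    have h2 := (mul_eq_zero.1 hf).resolve_left h1
    rw [integral_eq_zero_iff_of_nonneg (fun z => by positivity) f.integrable] at h2
    have hc : Continuous (fun z : ℂ => ‖f z‖ ^ 2 * Real.exp (-α * ‖z‖ ^ 2)) := by
      have := f.differentiable.continuous
      fun_prop
    have h3 := (hc.ae_eq_iff_eq volume continuous_zero).1 h2
    refine DFunLike.ext _ _ fun z => ?_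
    have h4 := congrFun h3 z
    simp only [Pi.zero_apply, mul_eq_zero, (Real.exp_pos _).ne', or_false] at h4
    have h5 : f z = 0 := by simpa using h4
    rw [h5]
    rfl

instance [Fact (0 < α)] : NormedAddCommGroup (FockSpace α) :=
  InnerProductSpace.Core.toNormedAddCommGroup (𝕜 := ℂ)

instance [Fact (0 < α)] : InnerProductSpace ℂ (FockSpace α) :=
  InnerProductSpace.ofCore (instCore (α := α)).toCore

end FockSpace

/-! ### Schatten classes -/

/-- `T f = ∑ₙ sₙ ⟨f, eₙ⟩ uₙ` for all `f`, with orthonormal sequences `(eₙ)`, `(uₙ)` and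
numbers `sₙ ≥ 0`: a Schmidt decomposition of `T`. If `sₙ → 0`, then `T` is compact and the nonzero
`sₙ` are its nonzero singular values, counted with multiplicity. -/
structure IsSchmidtDecomposition {H : Type*} [NormedAddCommGroup H] [InnerProductSpace ℂ H]
    (T : H →L[ℂ] H) (e u : ℕ → H) (s : ℕ → ℝ) : Prop where
  orthonormal_left : Orthonormal ℂ e
  orthonormal_right : Orthonormal ℂ u
  nonneg : ∀ n, 0 ≤ s n
  hasSum : ∀ f : H, HasSum (fun n => ((s n : ℂ) * inner ℂ (e n) f) • u n) (T f)

/-- For an operator `T` on an infinite-dimensional Hilbert space: `T` is in the Schatten class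
`S_p` and `‖T‖_{S_p} = r`, that is, `r = (∑ₙ sₙᵖ)^{1/p}` for the singular values `sₙ` of `T`. -/
def HasSchattenNorm {H : Type*} [NormedAddCommGroup H] [InnerProductSpace ℂ H]
    (p : ℝ) (T : H →L[ℂ] H) (r : ℝ) : Prop :=
  ∃ (e u : ℕ → H) (s : ℕ → ℝ), IsSchmidtDecomposition T e u s ∧
    Summable (fun n => s n ^ p) ∧ r = (∑' n, s n ^ p) ^ (1 / p)

/-- `T` belongs to the Schatten class `S_p`. -/
def MemSchatten {H : Type*} [NormedAddCommGroup H] [InnerProductSpace ℂ H]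
    (p : ℝ) (T : H →L[ℂ] H) : Prop :=
  ∃ r : ℝ, HasSchattenNorm p T r

/-! ### The operators -/

/-- The integral `∫₀ᶻ h(w) dw`, taken along the segment from `0` to `z`. -/
def segmentIntegral (h : ℂ → ℂ) (z : ℂ) : ℂ := ∫ t in (0 : ℝ)..1, h (t * z) * z

/-- `I_{(g,ψ)} f(z) = ∫₀ᶻ f'(ψ(w)) g(w) dw`. -/
def opI (g ψ f : ℂ → ℂ) (z : ℂ) : ℂ := segmentIntegral (fun w => deriv f (ψ w) * g w) z

/-- `C_{(g,ψ)} f(z) = ∫₀^{ψ(z)} f'(w) g(w) dw`. -/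
def opC (g ψ f : ℂ → ℂ) (z : ℂ) : ℂ := segmentIntegral (fun w => deriv f w * g w) (ψ z)

/-- The bounded operator `T` on `F_α²` is given by the formula `A`. -/
def IsGivenBy {α : ℝ} [Fact (0 < α)] (T : FockSpace α →L[ℂ] FockSpace α)
    (A : (ℂ → ℂ) → ℂ → ℂ) : Prop :=
  ∀ (f : FockSpace α) (z : ℂ), T f z = A f z

/-! ### The Berezin type transforms -/

/-- The normalized kernel function `k_w(z) = e^{α z conj(w) - α|w|²/2}`. -/
def normKernel (α : ℝ) (w z : ℂ) : ℂ :=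
  Complex.exp (α * (z * conj w) - α * (‖w‖ ^ 2 : ℝ) / 2)

/-- `Q_g(z) = |g(z)| e^{-α|z|²/2} (1+|z|)⁻¹`. -/
def weightQ (α : ℝ) (g : ℂ → ℂ) (z : ℂ) : ℝ :=
  ‖g z‖ * Real.exp (-(α / 2) * ‖z‖ ^ 2) * (1 + ‖z‖)⁻¹

/-- `B_{(|g|,ψ)}(w) = ∫ |(|w|+1) k_w(ψ(z)) Q_g(z)|² dm(z)`, possibly infinite. -/
def berezinI (α : ℝ) (g ψ : ℂ → ℂ) (w : ℂ) : ℝ≥0∞ :=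
  ∫⁻ z : ℂ, ‖((‖w‖ + 1 : ℝ) : ℂ) * normKernel α w (ψ z) * (weightQ α g z : ℂ)‖ₑ ^ 2

/-- `B_{(|g(ψ)|,ψ)}(w) = ∫ |(|w|+1) k_w(ψ(z)) ψ'(z) Q_{g(ψ)}(z)|² dm(z)`, possibly infinite. -/
def berezinC (α : ℝ) (g ψ : ℂ → ℂ) (w : ℂ) : ℝ≥0∞ :=
  ∫⁻ z : ℂ, ‖((‖w‖ + 1 : ℝ) : ℂ) * normKernel α w (ψ z) * deriv ψ z *
    (weightQ α (g ∘ ψ) z : ℂ)‖ₑ ^ 2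

/-- `(∫ B(w)^{p/2} dm(w))^{1/p}`, possibly infinite. -/
def berezinNorm (p : ℝ) (B : ℂ → ℝ≥0∞) : ℝ≥0∞ :=
  (∫⁻ w : ℂ, B w ^ (p / 2)) ^ (1 / p)

end

/-!
Both operators satisfy `(T f)' = f'(ψ) G`, with `G = g` for `I_{(g,ψ)}` and `G = (g ∘ ψ) ψ'` for
`C_{(g,ψ)}`. By the Littlewood–Paley description of the Fock norm
(`exists_lintegral_weightQ_deriv_le`, `exists_lintegral_fockDensity_le`) the norm `‖T f‖²` is
comparable to `|T f(0)|² + ∫ |f'|² dμ`, where `μ` is the image under `ψ` of the measure `Q_G² dm`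
(`symbolMeasure`). So `T*T` is comparable to the form `∫ |f'|² dμ` (`derivForm`), provided that the
value `T f(0)` is controlled by it, and everything reduces to a statement on a measure `μ` and its
Berezin transform `B(w) = (|w|+1)² ∫ |k_w|² dμ` (`berezinOf`).

The estimate of the Schatten norm from above, `FockSpace.exists_tsum_rpow_le_berezinOf`: by the mean
value property, `∫ |f'|² dμ ≤ C ∫ B |f|² e^{-α|z|²} dm`. Insert the singular vectors `eₙ` of `T`. If
`p ≥ 2`, then Jensen's inequality for the probability measures `(α/π) |eₙ|² e^{-α|z|²} dm` and
the Bessel bound `∑ |eₙ|² e^{-α|z|²} ≤ 1` give the result. If `p < 2`, the concavity of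
`x ↦ x^{p/2}` is used instead: by the reproducing formula, `∑ₙ sₙ^p ≤ C ∫ ∑ₙ sₙ^p |⟨k_w, eₙ⟩|² dm(w)`, and the inner sum
is at most `‖T k_w‖^p ≤ C B(w)^{p/2}`. A bounded `B` that vanishes at infinity makes the operator
bounded and compact, so that a singular value decomposition exists.

The estimate from below, `FockSpace.exists_lintegral_berezinOf_le_tsum_rpow`: the plane is cut into
unit cells. On each cell all kernel functions are dominated by the one at its centre, with
exponential decay in the distance. Hence `∫ B^{p/2} dm` is comparable to `∑ m_l^{p/2}`, where `m_l`
is the integral of `|k_c'|²` over the cell with centre `c` (`cellMass`). In a sparse family of cells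
with `m_l > t²`, the kernel functions of the centres span a space on which `∫ |f'|² dμ` is at least
a multiple of `t² ‖f‖²`. So at least as many singular values exceed a multiple of `t` as the family
has members, and integration over `t` yields `∑ m_l^{p/2} ≤ C ∑ sₙ^p`; finitely many sparse families
exhaust the lattice. This works for all `p > 0`.

It remains to control the value at the origin. It vanishes for `I_{(g,ψ)}`, and for `C_{(g,ψ)}` if
`ψ(0) = 0`. For non-constant `ψ` it is controlled by the derivative, with a constant depending on
`ψ` (`exists_ofReal_norm_sq_le_of_nonconstant`). For constant `ψ` the operator `C_{(g,ψ)}` has rank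
at most one and `B = 0`.
-/

/-! ### Primitives and mean values of entire functions -/

theorem exists_entire_primitive {h : ℂ → ℂ} (hh : Differentiable ℂ h) :
    ∃ P : ℂ → ℂ, P 0 = 0 ∧ ∀ z, HasDerivAt P (h z) z := by
  obtain ⟨P, hP0, hP⟩ := hh.isExactOn_univ.with_val_at 0 0
  exact ⟨P, hP0, fun z => hP z trivial⟩

theorem segmentIntegral_eq {h P : ℂ → ℂ} (hh : Continuous h) (hP0 : P 0 = 0)
    (hP : ∀ z, HasDerivAt P (h z) z) (z : ℂ) : segmentIntegral h z = P z := by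
  have h1 : ∀ t : ℝ, HasDerivAt (fun t : ℝ => P (t * z)) (h (t * z) * z) t := by
    intro t
    have h2 : HasDerivAt (fun s : ℂ => P (s * z)) (h (t * z) * z) (t : ℂ) := by
      have := (hP ((t : ℂ) * z)).comp (t : ℂ) ((hasDerivAt_id (t : ℂ)).mul_const z)
      simpa [Function.comp_def] using this
    exact h2.comp_ofReal
  have h3 := intervalIntegral.integral_eq_sub_of_hasDerivAt (a := 0) (b := 1)
    (fun t _ => h1 t) (Continuous.intervalIntegrable (by fun_prop) _ _)
  rw [segmentIntegral, h3]
  simp [hP0]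

theorem hasDerivAt_segmentIntegral {h : ℂ → ℂ} (hh : Differentiable ℂ h) (z : ℂ) :
    HasDerivAt (segmentIntegral h) (h z) z := by
  obtain ⟨P, hP0, hP⟩ := exists_entire_primitive hh
  have : segmentIntegral h = P := funext (segmentIntegral_eq hh.continuous hP0 hP)
  rw [this]
  exact hP z

theorem integral_circle_eq {f : ℂ → ℂ} (hf : Differentiable ℂ f) (r : ℝ) :
    ∫ θ in Set.Ioo (-Real.pi) Real.pi, f (Complex.polarCoord.symm (r, θ))
      = (2 * Real.pi : ℝ) * f 0 := by
  have h1 := DiffContOnCl.circleAverage (f := f) (c := 0) (R := r) hf.diffContOnCl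
  rw [Real.circleAverage_eq_integral_add (-Real.pi), intervalIntegral.integral_comp_add_right
    (fun θ => f (circleMap 0 r θ)), intervalIntegral.integral_of_le (by linarith [Real.pi_pos]),
    integral_Ioc_eq_integral_Ioo] at h1
  have h2 : (2 * Real.pi + -Real.pi : ℝ) = Real.pi := by ring
  rw [zero_add, h2] at h1
  have h3 : ∀ θ : ℝ, circleMap 0 r θ = Complex.polarCoord.symm (r, θ) := by
    intro θ
    simp [circleMap, Complex.exp_mul_I]
  simp only [h3] at h1
  rw [← h1, Complex.real_smul, ← mul_assoc, ← Complex.ofReal_mul,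
    mul_inv_cancel₀ (by positivity), Complex.ofReal_one, one_mul]

/-- Mean value property for a radial weight, by integration over the circles around the origin. -/
theorem integral_radial_mul {f : ℂ → ℂ} (hf : Differentiable ℂ f) {ρ : ℝ → ℝ}
    (hρ : Measurable ρ) (hi : Integrable (fun z : ℂ => (ρ ‖z‖ : ℂ) * f z)) :
    ∫ z : ℂ, (ρ ‖z‖ : ℂ) * f z
      = (∫ r in Set.Ioi (0 : ℝ), r * ρ r : ℝ) * ((2 * Real.pi : ℝ) * f 0) := by
  set G : ℂ → ℂ := fun z => (ρ ‖z‖ : ℂ) * f z with hG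
  have htar : polarCoord.target = Set.Ioi (0 : ℝ) ×ˢ Set.Ioo (-Real.pi) Real.pi := rfl
  have hmG : Measurable G :=
    (Complex.measurable_ofReal.comp (hρ.comp measurable_norm)).mul hf.continuous.measurable
  have hms : Measurable (fun q : ℝ × ℝ => Complex.polarCoord.symm q) := by
    simp only [Complex.polarCoord_symm_apply]
    fun_prop
  have hint : IntegrableOn (fun q : ℝ × ℝ => q.1 • G (Complex.polarCoord.symm q))
      (Set.Ioi (0 : ℝ) ×ˢ Set.Ioo (-Real.pi) Real.pi) := by
    refine ⟨(measurable_fst.smul (hmG.comp hms)).aestronglyMeasurable, ?_⟩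
    have h1 := Complex.lintegral_comp_polarCoord_symm (fun z => ‖G z‖ₑ)
    have h2 : ∫⁻ q in polarCoord.target, ‖q.1 • G (Complex.polarCoord.symm q)‖ₑ
        = ∫⁻ z, ‖G z‖ₑ := by
      rw [← h1]
      refine setLIntegral_congr_fun (measurableSet_Ioi.prod measurableSet_Ioo) fun q hq => ?_
      simp only [enorm_smul, smul_eq_mul]
      rw [Real.enorm_of_nonneg (le_of_lt hq.1)]
    rw [HasFiniteIntegral, ← htar, h2]
    exact hi.2
  rw [← Complex.integral_comp_polarCoord_symm G, htar, Measure.volume_eq_prod,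
    setIntegral_prod _ hint, ← integral_complex_ofReal, ← integral_mul_const]
  refine setIntegral_congr_fun measurableSet_Ioi fun r hr => ?_
  have hr' : (0 : ℝ) < r := hr
  have h3 : ∀ θ : ℝ, r • G (Complex.polarCoord.symm (r, θ))
      = ((r * ρ r : ℝ) : ℂ) * f (Complex.polarCoord.symm (r, θ)) := by
    intro θ
    have : ‖Complex.polarCoord.symm (r, θ)‖ = r := by
      rw [Complex.norm_polarCoord_symm, abs_of_pos hr']
    rw [hG]
    simp only [this, Complex.real_smul, Complex.ofReal_mul, mul_assoc]
  simp only [h3]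
  rw [integral_const_mul, integral_circle_eq hf]

theorem integral_gauss_complex {b : ℝ} (hb : 0 < b) :
    ∫ z : ℂ, Real.exp (-b * ‖z‖ ^ 2) = Real.pi / b := by
  have := GaussianFourier.integral_rexp_neg_mul_sq_norm (V := ℂ) hb
  simpa using this

theorem integrable_gauss_complex {b : ℝ} (hb : 0 < b) :
    Integrable (fun z : ℂ => Real.exp (-b * ‖z‖ ^ 2)) := by
  by_contra h
  have h1 := integral_gauss_complex hb
  rw [integral_undef h] at h1
  have : 0 < Real.pi / b := by positivity
  linarith

/-- Mean value property with a Gaussian weight. -/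
theorem integral_gauss_mul {f : ℂ → ℂ} (hf : Differentiable ℂ f) {b : ℝ} (hb : 0 < b)
    (hi : Integrable (fun z : ℂ => (Real.exp (-b * ‖z‖ ^ 2) : ℂ) * f z)) :
    ∫ z : ℂ, (Real.exp (-b * ‖z‖ ^ 2) : ℂ) * f z = (Real.pi / b : ℝ) * f 0 := by
  have hm : Measurable (fun r : ℝ => Real.exp (-b * r ^ 2)) := by fun_prop
  have h1 := integral_radial_mul hf hm hi
  have h2 := integral_radial_mul (f := fun _ => 1) (differentiable_const _) hm
    (by simp only [mul_one]; exact (integrable_gauss_complex hb).ofReal (𝕜 := ℂ))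
  simp only [mul_one] at h2
  rw [integral_complex_ofReal, integral_gauss_complex hb] at h2
  rw [h1, h2]
  ring

/-- Mean value property over a disc. -/
theorem setIntegral_ball_zero {f : ℂ → ℂ} (hf : Differentiable ℂ f) (r : ℝ) :
    ∫ z in Metric.ball (0 : ℂ) r, f z = (volume.real (Metric.ball (0 : ℂ) r) : ℂ) * f 0 := by
  have hm : Measurable (Set.indicator (Set.Iio r) (fun _ : ℝ => (1 : ℝ))) :=
    measurable_const.indicator measurableSet_Iio
  have key : ∀ g : ℂ → ℂ, (fun z => ((Set.indicator (Set.Iio r) (fun _ : ℝ => (1 : ℝ)) ‖z‖ : ℝ) : ℂ)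
      * g z) = Set.indicator (Metric.ball (0 : ℂ) r) g := by
    intro g
    ext z
    by_cases hz : ‖z‖ < r
    · simp [Set.indicator, hz]
    · simp [Set.indicator, hz]
  have hint : ∀ g : ℂ → ℂ, Continuous g → Integrable (Set.indicator (Metric.ball (0 : ℂ) r) g) := by
    intro g hg
    rw [integrable_indicator_iff measurableSet_ball]
    exact (hg.continuousOn.integrableOn_compact (isCompact_closedBall (0 : ℂ) r)).mono_set
      Metric.ball_subset_closedBall
  have h1 := integral_radial_mul hf hm (by rw [key]; exact hint f hf.continuous)
  have h2 := integral_radial_mul (f := fun _ => 1) (differentiable_const _) hm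
    (by rw [key]; exact hint _ continuous_const)
  rw [key, integral_indicator measurableSet_ball] at h1 h2
  rw [h1]
  simp only [setIntegral_const, mul_one] at h2
  rw [mul_left_comm, ← mul_assoc, mul_comm ((2 * Real.pi : ℝ) : ℂ), ← h2]
  simp

/-- Sub-mean value property of `|f|²` over a disc. -/
theorem norm_sq_le_lintegral_ball {f : ℂ → ℂ} (hf : Differentiable ℂ f) {r : ℝ} (hr : 0 < r) :
    ENNReal.ofReal (‖f 0‖ ^ 2) ≤ (volume (Metric.ball (0 : ℂ) r))⁻¹ *
      ∫⁻ z in Metric.ball (0 : ℂ) r, ENNReal.ofReal (‖f z‖ ^ 2) := by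
  have hV0 : volume (Metric.ball (0 : ℂ) r) ≠ 0 := (Metric.measure_ball_pos volume 0 hr).ne'
  have hVt : volume (Metric.ball (0 : ℂ) r) ≠ ∞ := measure_ball_lt_top.ne
  have h1 := setIntegral_ball_zero (hf.pow 2) r
  have h2 : ‖(volume.real (Metric.ball (0 : ℂ) r) : ℂ) * (f ^ 2) 0‖ₑ
      = volume (Metric.ball (0 : ℂ) r) * ENNReal.ofReal (‖f 0‖ ^ 2) := by
    rw [enorm_mul, ← ofReal_norm, ← ofReal_norm, Complex.norm_real,
      Real.norm_of_nonneg measureReal_nonneg, measureReal_def, ENNReal.ofReal_toReal hVt]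
    simp
  rw [← ENNReal.mul_le_iff_le_inv hV0 hVt, ← h2, ← h1]
  refine (enorm_integral_le_lintegral_enorm _).trans (le_of_eq ?_)
  refine lintegral_congr fun z => ?_
  rw [← ofReal_norm]
  simp

/-! ### Local estimates in the Fock space -/

/-- The density `|f(z)|² e^{-α|z|²}`, whose integral is `(π/α) ‖f‖²` for `f` in the Fock space. -/
noncomputable def fockDensity (α : ℝ) (f : ℂ → ℂ) (z : ℂ) : ℝ :=
  ‖f z‖ ^ 2 * Real.exp (-α * ‖z‖ ^ 2)

theorem fockDensity_nonneg (α : ℝ) (f : ℂ → ℂ) (z : ℂ) : 0 ≤ fockDensity α f z := by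
  unfold fockDensity; positivity

theorem continuous_fockDensity {α : ℝ} {f : ℂ → ℂ} (hf : Continuous f) :
    Continuous (fockDensity α f) := by
  unfold fockDensity; fun_prop

theorem measurable_fockDensity {α : ℝ} {f : ℂ → ℂ} (hf : Continuous f) :
    Measurable (fun z => ENNReal.ofReal (fockDensity α f z)) :=
  (continuous_fockDensity hf).measurable.ennreal_ofReal

/-- The Weyl translate `f(ζ + w) e^{-α conj(ζ) w - α|ζ|²/2}`. -/
noncomputable def weyl (α : ℝ) (ζ : ℂ) (f : ℂ → ℂ) (w : ℂ) : ℂ :=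
  f (ζ + w) * Complex.exp (-α * conj ζ * w - α * (‖ζ‖ ^ 2 : ℝ) / 2)

theorem norm_sq_add (ζ w : ℂ) : ‖ζ + w‖ ^ 2 = ‖ζ‖ ^ 2 + ‖w‖ ^ 2 + 2 * (conj ζ * w).re := by
  simp only [Complex.sq_norm, Complex.normSq_apply, Complex.add_re, Complex.add_im, Complex.mul_re,
    Complex.conj_re, Complex.conj_im]
  ring

theorem norm_sq_sub (ζ w : ℂ) : ‖ζ - w‖ ^ 2 = ‖ζ‖ ^ 2 + ‖w‖ ^ 2 - 2 * (ζ * conj w).re := by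
  simp only [Complex.sq_norm, Complex.normSq_apply, Complex.sub_re, Complex.sub_im, Complex.mul_re,
    Complex.conj_re, Complex.conj_im]
  ring

theorem fockDensity_weyl (α : ℝ) (ζ : ℂ) (f : ℂ → ℂ) (w : ℂ) :
    fockDensity α (weyl α ζ f) w = fockDensity α f (ζ + w) := by
  unfold fockDensity weyl
  rw [norm_mul, Complex.norm_exp, mul_pow, ← Real.exp_nat_mul, mul_assoc, ← Real.exp_add,
    norm_sq_add]
  congr 2
  have : (-(α : ℂ) * conj ζ * w - α * (‖ζ‖ ^ 2 : ℝ) / 2).re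
      = -α * (conj ζ * w).re - α * ‖ζ‖ ^ 2 / 2 := by
    rw [mul_assoc, ← Complex.ofReal_neg, Complex.sub_re, Complex.re_ofReal_mul,
      ← Complex.ofReal_mul]
    have : ((α * ‖ζ‖ ^ 2 : ℝ) : ℂ) / 2 = ((α * ‖ζ‖ ^ 2 / 2 : ℝ) : ℂ) := by push_cast; ring
    rw [this, Complex.ofReal_re]
  rw [this]
  push_cast
  ring

theorem differentiable_weyl (α : ℝ) (ζ : ℂ) {f : ℂ → ℂ} (hf : Differentiable ℂ f) :
    Differentiable ℂ (weyl α ζ f) := by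
  unfold weyl
  have : Differentiable ℂ fun w => f (ζ + w) := hf.comp (differentiable_id.const_add ζ)
  fun_prop

theorem lintegral_ball_translate (ζ : ℂ) (r : ℝ) {g : ℂ → ℝ≥0∞} (hg : Measurable g) :
    ∫⁻ w in Metric.ball 0 r, g (ζ + w) = ∫⁻ w in Metric.ball ζ r, g w := by
  have h := (measurePreserving_add_left volume ζ).setLIntegral_comp_preimage
    (measurableSet_ball (x := ζ) (ε := r)) hg
  rw [← h]
  congr 2
  ext w
  simp

/-- Point evaluations are controlled by the mass of `f` near the point. -/
theorem exists_fockDensity_le {α : ℝ} (hα : 0 < α) {r : ℝ} (hr : 0 < r) :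
    ∃ C : ℝ≥0, ∀ f : ℂ → ℂ, Differentiable ℂ f → ∀ ζ : ℂ,
      ENNReal.ofReal (fockDensity α f ζ) ≤
        C * ∫⁻ w in Metric.ball ζ r, ENNReal.ofReal (fockDensity α f w) := by
  have hV0 : volume (Metric.ball (0 : ℂ) r) ≠ 0 := (Metric.measure_ball_pos volume 0 hr).ne'
  refine ⟨(volume (Metric.ball (0 : ℂ) r))⁻¹.toNNReal * (Real.exp (α * r ^ 2)).toNNReal,
    fun f hf ζ => ?_⟩
  rw [ENNReal.coe_mul, ENNReal.coe_toNNReal (ENNReal.inv_ne_top.2 hV0)]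
  change _ ≤ _ * ENNReal.ofReal _ * _
  have h1 := norm_sq_le_lintegral_ball (differentiable_weyl α ζ hf) hr
  have h2 : ‖weyl α ζ f 0‖ ^ 2 = fockDensity α f ζ := by
    have := fockDensity_weyl α ζ f 0
    simpa [fockDensity] using this
  rw [h2] at h1
  refine h1.trans ?_
  rw [mul_assoc]
  gcongr
  rw [← lintegral_ball_translate ζ r (measurable_fockDensity hf.continuous),
    ← lintegral_const_mul' _ _ ENNReal.ofReal_ne_top]
  refine setLIntegral_mono_ae' measurableSet_ball (Filter.Eventually.of_forall fun w hw => ?_)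
  rw [← fockDensity_weyl, ← ENNReal.ofReal_mul (by positivity)]
  refine ENNReal.ofReal_le_ofReal ?_
  unfold fockDensity
  have hw' : ‖w‖ < r := by simpa using hw
  have h3 : 1 ≤ Real.exp (α * r ^ 2) * Real.exp (-α * ‖w‖ ^ 2) := by
    rw [← Real.exp_add, Real.one_le_exp_iff]
    have : ‖w‖ ^ 2 ≤ r ^ 2 := by gcongr
    nlinarith
  nlinarith [mul_le_mul_of_nonneg_left h3 (sq_nonneg ‖weyl α ζ f w‖)]

/-- The derivative at a point is controlled by the mass of `f` near the point. The Weyl translate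
`F` of `f` satisfies `F'(0) = (f'(ζ) - α conj(ζ) f(ζ)) e^{-α|ζ|²/2}`. -/
theorem exists_fockDensity_deriv_le {α : ℝ} (hα : 0 < α) :
    ∃ C : ℝ≥0, ∀ f : ℂ → ℂ, Differentiable ℂ f → ∀ ζ : ℂ,
      ENNReal.ofReal (fockDensity α (deriv f) ζ) ≤
        C * ENNReal.ofReal ((1 + ‖ζ‖) ^ 2) *
          ∫⁻ w in Metric.ball ζ 1, ENNReal.ofReal (fockDensity α f w) := by
  obtain ⟨C, hC⟩ := exists_fockDensity_le hα (r := 1 / 2) (by norm_num)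
  refine ⟨2 * (4 * (Real.exp α).toNNReal + (α ^ 2).toNNReal) * C, fun f hf ζ => ?_⟩
  set I := ∫⁻ w in Metric.ball ζ 1, ENNReal.ofReal (fockDensity α f w) with hI
  have hIt : I ≠ ∞ := by
    have h : IntegrableOn (fockDensity α f) (Metric.ball ζ 1) :=
      ((continuous_fockDensity hf.continuous).continuousOn.integrableOn_compact
        (isCompact_closedBall ζ 1)).mono_set Metric.ball_subset_closedBall
    have h' := h.2
    rw [hasFiniteIntegral_iff_ofReal (Filter.Eventually.of_forall (fockDensity_nonneg α f))] at h'
    exact h'.ne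
  set D : ℝ := (C * I).toReal with hD
  have hCI : (C : ℝ≥0∞) * I ≠ ∞ := ENNReal.mul_ne_top ENNReal.coe_ne_top hIt
  have hD0 : 0 ≤ D := ENNReal.toReal_nonneg
  -- near `0`, the density of the Weyl translate is at most `D`
  have h1 : ∀ w : ℂ, ‖w‖ ≤ 1 / 2 → fockDensity α f (ζ + w) ≤ D := by
    intro w hw
    rw [hD, ← ENNReal.ofReal_le_iff_le_toReal hCI]
    refine (hC f hf (ζ + w)).trans ?_
    gcongr
    refine lintegral_mono_set (Metric.ball_subset_ball' ?_)
    simp only [dist_self_add_left]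
    linarith
  have h2 : ∀ w ∈ Metric.sphere (0 : ℂ) (1 / 2), ‖weyl α ζ f w‖ ≤ Real.sqrt (Real.exp α * D) := by
    intro w hw
    have hw' : ‖w‖ = 1 / 2 := by simpa using hw
    refine Real.le_sqrt_of_sq_le ?_
    have h3 := h1 w hw'.le
    rw [← fockDensity_weyl, fockDensity] at h3
    have h4 : ‖weyl α ζ f w‖ ^ 2
        = Real.exp (α * ‖w‖ ^ 2) * (‖weyl α ζ f w‖ ^ 2 * Real.exp (-α * ‖w‖ ^ 2)) := by
      rw [mul_left_comm, ← Real.exp_add]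
      simp
    rw [h4]
    gcongr
    rw [hw']
    nlinarith
  have h3 := Complex.norm_deriv_le_of_forall_mem_sphere_norm_le (by norm_num)
    (differentiable_weyl α ζ hf).diffContOnCl h2
  have h4 : deriv (weyl α ζ f) 0
      = (deriv f ζ - α * conj ζ * f ζ) * Complex.exp (-(α * (‖ζ‖ ^ 2 : ℝ) / 2)) := by
    have h5 : HasDerivAt (fun w => f (ζ + w)) (deriv f ζ) 0 := by
      have := (hf (ζ + 0)).hasDerivAt.comp (0 : ℂ) ((hasDerivAt_id (0 : ℂ)).const_add ζ)
      simpa [Function.comp_def] using this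
    have h6 : HasDerivAt (fun w : ℂ => Complex.exp (-α * conj ζ * w - α * (‖ζ‖ ^ 2 : ℝ) / 2))
        (Complex.exp (-α * conj ζ * 0 - α * (‖ζ‖ ^ 2 : ℝ) / 2) * (-α * conj ζ)) 0 := by
      refine HasDerivAt.cexp ?_
      simpa using ((hasDerivAt_id (0 : ℂ)).const_mul (-α * conj ζ)).sub_const
        (α * (‖ζ‖ ^ 2 : ℝ) / 2 : ℂ)
    have h7 := (h5.mul h6).deriv
    have h8 : weyl α ζ f = (fun w => f (ζ + w)) *
      (fun w : ℂ => Complex.exp (-α * conj ζ * w - α * (‖ζ‖ ^ 2 : ℝ) / 2)) := rfl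
    rw [h8, h7]
    simp only [mul_zero, zero_sub, add_zero]
    ring
  have h5 : ‖Complex.exp (-(α * (‖ζ‖ ^ 2 : ℝ) / 2))‖ ^ 2 = Real.exp (-α * ‖ζ‖ ^ 2) := by
    have : (-(α * (‖ζ‖ ^ 2 : ℝ) / 2) : ℂ) = ((-(α * ‖ζ‖ ^ 2 / 2) : ℝ) : ℂ) := by push_cast; ring
    rw [this, Complex.norm_exp_ofReal, ← Real.exp_nat_mul]
    congr 1
    push_cast
    ring
  rw [h4, norm_mul] at h3
  have h6 : ‖deriv f ζ‖ ^ 2 ≤ 2 * ‖deriv f ζ - α * conj ζ * f ζ‖ ^ 2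
      + 2 * (α ^ 2 * ‖ζ‖ ^ 2 * ‖f ζ‖ ^ 2) := by
    have h7 : ‖deriv f ζ‖ ≤ ‖deriv f ζ - α * conj ζ * f ζ‖ + α * ‖ζ‖ * ‖f ζ‖ := by
      have := norm_add_le (deriv f ζ - α * conj ζ * f ζ) (α * conj ζ * f ζ)
      simpa [abs_of_pos hα] using this
    have h8 : 0 ≤ ‖deriv f ζ‖ := norm_nonneg _
    nlinarith [sq_nonneg (‖deriv f ζ - α * conj ζ * f ζ‖ - α * ‖ζ‖ * ‖f ζ‖),
      pow_le_pow_left₀ h8 h7 2]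
  have h7 : ‖deriv f ζ - α * conj ζ * f ζ‖ ^ 2 * Real.exp (-α * ‖ζ‖ ^ 2)
      ≤ 4 * (Real.exp α * D) := by
    rw [← h5, ← mul_pow]
    refine (pow_le_pow_left₀ (by positivity) h3 2).trans (le_of_eq ?_)
    rw [div_pow, Real.sq_sqrt (by positivity)]
    ring
  have h8 : ‖f ζ‖ ^ 2 * Real.exp (-α * ‖ζ‖ ^ 2) ≤ D := by
    simpa [fockDensity] using h1 0 (by simp)
  have h9 : fockDensity α (deriv f) ζ ≤
      2 * (4 * Real.exp α + α ^ 2) * (1 + ‖ζ‖) ^ 2 * D := by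
    have h10 : 1 ≤ (1 + ‖ζ‖) ^ 2 := by nlinarith [norm_nonneg ζ]
    have h11 : ‖ζ‖ ^ 2 ≤ (1 + ‖ζ‖) ^ 2 := by nlinarith [norm_nonneg ζ]
    calc fockDensity α (deriv f) ζ ≤ (2 * ‖deriv f ζ - α * conj ζ * f ζ‖ ^ 2
          + 2 * (α ^ 2 * ‖ζ‖ ^ 2 * ‖f ζ‖ ^ 2)) * Real.exp (-α * ‖ζ‖ ^ 2) := by
          unfold fockDensity; gcongr
      _ = 2 * (‖deriv f ζ - α * conj ζ * f ζ‖ ^ 2 * Real.exp (-α * ‖ζ‖ ^ 2))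
          + 2 * α ^ 2 * ‖ζ‖ ^ 2 * (‖f ζ‖ ^ 2 * Real.exp (-α * ‖ζ‖ ^ 2)) := by ring
      _ ≤ 2 * (4 * (Real.exp α * D)) * (1 + ‖ζ‖) ^ 2 + 2 * α ^ 2 * (1 + ‖ζ‖) ^ 2 * D := by
          have h13 : 0 ≤ 2 * (4 * (Real.exp α * D)) := by positivity
          refine add_le_add ((mul_le_mul_of_nonneg_left h7 (by norm_num)).trans
            (le_mul_of_one_le_right h13 h10)) ?_
          gcongr
      _ = _ := by ring
  refine (ENNReal.ofReal_le_ofReal h9).trans (le_of_eq ?_)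
  rw [ENNReal.ofReal_mul (by positivity), hD, ENNReal.ofReal_toReal hCI,
    ENNReal.ofReal_mul (by positivity)]
  have h12 : ENNReal.ofReal (2 * (4 * Real.exp α + α ^ 2))
      = ((2 * (4 * (Real.exp α).toNNReal + (α ^ 2).toNNReal) : ℝ≥0) : ℝ≥0∞) := by
    rw [ENNReal.ofReal, Real.toNNReal_mul (by norm_num), Real.toNNReal_add (by positivity)
      (by positivity), Real.toNNReal_mul (by norm_num)]
    simp
  rw [h12, ENNReal.coe_mul _ C]
  ring

theorem norm_normKernel_sq (α : ℝ) (w z : ℂ) :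
    ‖normKernel α w z‖ ^ 2 = Real.exp (α * ‖z‖ ^ 2 - α * ‖z - w‖ ^ 2) := by
  unfold normKernel
  have : (α * (z * conj w) - α * (‖w‖ ^ 2 : ℝ) / 2 : ℂ).re
      = α * (z * conj w).re - α * ‖w‖ ^ 2 / 2 := by
    rw [Complex.sub_re, Complex.re_ofReal_mul]
    have : (α * (‖w‖ ^ 2 : ℝ) / 2 : ℂ) = ((α * ‖w‖ ^ 2 / 2 : ℝ) : ℂ) := by push_cast; ring
    rw [this, Complex.ofReal_re]
  rw [Complex.norm_exp, ← Real.exp_nat_mul, this, norm_sq_sub]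
  congr 1
  push_cast
  ring

theorem fockDensity_normKernel (α : ℝ) (w z : ℂ) :
    fockDensity α (normKernel α w) z = Real.exp (-α * ‖z - w‖ ^ 2) := by
  rw [fockDensity, norm_normKernel_sq, ← Real.exp_add]
  congr 1
  ring

theorem differentiable_normKernel (α : ℝ) (w : ℂ) : Differentiable ℂ (normKernel α w) := by
  unfold normKernel; fun_prop

theorem deriv_normKernel (α : ℝ) (w z : ℂ) :
    deriv (normKernel α w) z = α * conj w * normKernel α w z := by
  have h : HasDerivAt (fun z : ℂ => α * (z * conj w) - α * (‖w‖ ^ 2 : ℝ) / 2)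
      (α * conj w) z := by
    simpa using (((hasDerivAt_id z).mul_const (conj w)).const_mul (α : ℂ)).sub_const
      (α * (‖w‖ ^ 2 : ℝ) / 2 : ℂ)
  have := h.cexp.deriv
  rw [show normKernel α w = fun z : ℂ => Complex.exp (α * (z * conj w) - α * (‖w‖ ^ 2 : ℝ) / 2)
    from rfl, this]
  ring

theorem continuous_normKernel (α : ℝ) : Continuous (fun q : ℂ × ℂ => normKernel α q.1 q.2) := by
  unfold normKernel
  have := Complex.continuous_conj
  fun_prop

theorem weightQ_sq (α : ℝ) (h : ℂ → ℂ) (z : ℂ) :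
    weightQ α h z ^ 2 = fockDensity α h z * ((1 + ‖z‖) ^ 2)⁻¹ := by
  unfold weightQ fockDensity
  rw [mul_pow, mul_pow, ← Real.exp_nat_mul, inv_pow]
  congr 3
  push_cast
  ring

theorem continuous_weightQ (α : ℝ) {h : ℂ → ℂ} (hh : Continuous h) : Continuous (weightQ α h) := by
  unfold weightQ
  refine ((hh.norm).mul (by fun_prop)).mul (Continuous.inv₀ (by fun_prop) fun z => ?_)
  positivity

theorem deriv_continuous {f : ℂ → ℂ} (hf : Differentiable ℂ f) : Continuous (deriv f) :=
  hf.deriv.continuous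

theorem exists_weightQ_deriv_le {α : ℝ} (hα : 0 < α) :
    ∃ C : ℝ≥0, ∀ f : ℂ → ℂ, Differentiable ℂ f → ∀ ζ : ℂ,
      ENNReal.ofReal (weightQ α (deriv f) ζ ^ 2) ≤
        C * ∫⁻ w in Metric.ball ζ 1, ENNReal.ofReal (fockDensity α f w) := by
  obtain ⟨C, hC⟩ := exists_fockDensity_deriv_le hα
  refine ⟨C, fun f hf ζ => ?_⟩
  have h0 : (0 : ℝ) < (1 + ‖ζ‖) ^ 2 := by positivity
  rw [weightQ_sq, ENNReal.ofReal_mul (fockDensity_nonneg _ _ _), ENNReal.ofReal_inv_of_pos h0,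
    ← div_eq_mul_inv]
  refine ENNReal.div_le_of_le_mul ((hC f hf ζ).trans (le_of_eq ?_))
  ring

/-- One half of the Littlewood-Paley formula for the Fock space. -/
theorem exists_lintegral_weightQ_deriv_le {α : ℝ} (hα : 0 < α) :
    ∃ C : ℝ≥0, ∀ f : ℂ → ℂ, Differentiable ℂ f →
      ∫⁻ z, ENNReal.ofReal (weightQ α (deriv f) z ^ 2) ≤
        C * ∫⁻ w, ENNReal.ofReal (fockDensity α f w) := by
  obtain ⟨C, hC⟩ := exists_weightQ_deriv_le hα
  have hVt : volume (Metric.ball (0 : ℂ) 1) ≠ ∞ := measure_ball_lt_top.ne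
  refine ⟨C * (volume (Metric.ball (0 : ℂ) 1)).toNNReal, fun f hf => ?_⟩
  have hm := measurable_fockDensity (α := α) hf.continuous
  calc ∫⁻ z, ENNReal.ofReal (weightQ α (deriv f) z ^ 2)
      ≤ ∫⁻ z, C * ∫⁻ w in Metric.ball z 1, ENNReal.ofReal (fockDensity α f w) :=
        lintegral_mono fun z => hC f hf z
    _ = C * ∫⁻ z, ∫⁻ w in Metric.ball z 1, ENNReal.ofReal (fockDensity α f w) :=
        lintegral_const_mul' _ _ ENNReal.coe_ne_top
    _ = C * ∫⁻ z, ∫⁻ w in Metric.ball (0 : ℂ) 1, ENNReal.ofReal (fockDensity α f (z + w)) := by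
        simp only [lintegral_ball_translate _ _ hm]
    _ = C * ∫⁻ w in Metric.ball (0 : ℂ) 1, ∫⁻ z, ENNReal.ofReal (fockDensity α f (z + w)) := by
        rw [lintegral_lintegral_swap]
        exact (hm.comp (measurable_fst.add measurable_snd)).aemeasurable
    _ = _ := by
        simp only [lintegral_add_right_eq_self (fun z => ENNReal.ofReal (fockDensity α f z))]
        rw [setLIntegral_const, ENNReal.coe_mul, ENNReal.coe_toNNReal hVt]
        ring

/-- The derivative of `f` at `ζ` is controlled by the values of `f`, weighted by kernel functions:
near `ζ`, `|k_w(ζ)|²` is comparable to `e^{α|ζ|²}`. -/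
theorem exists_norm_deriv_sq_le_lintegral_kernel {α : ℝ} (hα : 0 < α) :
    ∃ C : ℝ≥0, ∀ f : ℂ → ℂ, Differentiable ℂ f → ∀ ζ : ℂ,
      ENNReal.ofReal (‖deriv f ζ‖ ^ 2) ≤
        C * ∫⁻ w, ENNReal.ofReal ((‖w‖ + 1) ^ 2 * ‖normKernel α w ζ‖ ^ 2) *
          ENNReal.ofReal (fockDensity α f w) := by
  obtain ⟨C, hC⟩ := exists_fockDensity_deriv_le hα
  refine ⟨C * (4 * Real.exp α).toNNReal, fun f hf ζ => ?_⟩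
  have h1 : ENNReal.ofReal (‖deriv f ζ‖ ^ 2)
      = ENNReal.ofReal (Real.exp (α * ‖ζ‖ ^ 2)) * ENNReal.ofReal (fockDensity α (deriv f) ζ) := by
    rw [← ENNReal.ofReal_mul (by positivity), fockDensity, mul_left_comm, ← Real.exp_add]
    simp
  calc ENNReal.ofReal (‖deriv f ζ‖ ^ 2)
      ≤ ENNReal.ofReal (Real.exp (α * ‖ζ‖ ^ 2)) * (C * ENNReal.ofReal ((1 + ‖ζ‖) ^ 2) *
          ∫⁻ w in Metric.ball ζ 1, ENNReal.ofReal (fockDensity α f w)) := by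
        rw [h1]; gcongr; exact hC f hf ζ
    _ = C * ∫⁻ w in Metric.ball ζ 1, ENNReal.ofReal (Real.exp (α * ‖ζ‖ ^ 2) * (1 + ‖ζ‖) ^ 2) *
          ENNReal.ofReal (fockDensity α f w) := by
        rw [lintegral_const_mul' _ _ ENNReal.ofReal_ne_top, ENNReal.ofReal_mul (by positivity)]
        ring
    _ ≤ C * ∫⁻ w in Metric.ball ζ 1, (4 * Real.exp α).toNNReal *
          (ENNReal.ofReal ((‖w‖ + 1) ^ 2 * ‖normKernel α w ζ‖ ^ 2) *
          ENNReal.ofReal (fockDensity α f w)) := by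
        refine mul_le_mul_right ?_ _
        refine setLIntegral_mono_ae' measurableSet_ball
          (Filter.Eventually.of_forall fun w hw => ?_)
        rw [← mul_assoc]
        gcongr
        change _ ≤ ENNReal.ofReal _ * _
        rw [← ENNReal.ofReal_mul (by positivity)]
        refine ENNReal.ofReal_le_ofReal ?_
        have hw' : ‖ζ - w‖ < 1 := by rw [← dist_eq_norm, dist_comm]; exact hw
        have h2 : 1 + ‖ζ‖ ≤ 2 * (‖w‖ + 1) := by
          have := norm_le_insert' ζ w
          linarith [norm_nonneg w]
        have h3 : Real.exp (α * ‖ζ‖ ^ 2) ≤ Real.exp α * ‖normKernel α w ζ‖ ^ 2 := by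
          rw [norm_normKernel_sq, ← Real.exp_add]
          refine Real.exp_le_exp.2 ?_
          have : ‖ζ - w‖ ^ 2 ≤ 1 := by nlinarith [norm_nonneg (ζ - w)]
          nlinarith
        calc Real.exp (α * ‖ζ‖ ^ 2) * (1 + ‖ζ‖) ^ 2
            ≤ (Real.exp α * ‖normKernel α w ζ‖ ^ 2) * (2 * (‖w‖ + 1)) ^ 2 := by gcongr
          _ = _ := by ring
    _ ≤ C * ∫⁻ w, (4 * Real.exp α).toNNReal *
          (ENNReal.ofReal ((‖w‖ + 1) ^ 2 * ‖normKernel α w ζ‖ ^ 2) *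
          ENNReal.ofReal (fockDensity α f w)) := by
        refine mul_le_mul_right ?_ _
        exact setLIntegral_le_lintegral _ _
    _ = _ := by
        rw [lintegral_const_mul' _ _ ENNReal.coe_ne_top, ENNReal.coe_mul, mul_assoc]

/-! ### The Littlewood-Paley formula -/

theorem exists_norm_sq_le_lintegral_weightQ {α : ℝ} (hα : 0 < α) (R : ℝ) :
    ∃ C : ℝ≥0, ∀ g : ℂ → ℂ, Differentiable ℂ g → ∀ z : ℂ, ‖z‖ ≤ R →
      ENNReal.ofReal (‖g z‖ ^ 2) ≤ C * ∫⁻ w, ENNReal.ofReal (weightQ α g w ^ 2) := by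
  obtain ⟨C, hC⟩ := exists_fockDensity_le hα one_pos
  refine ⟨(Real.exp (α * R ^ 2)).toNNReal * (C * ((2 + R) ^ 2).toNNReal), fun g hg z hz => ?_⟩
  have hR : 0 ≤ R := (norm_nonneg z).trans hz
  rw [ENNReal.coe_mul, ENNReal.coe_mul]
  change _ ≤ ENNReal.ofReal _ * (_ * ENNReal.ofReal _) * _
  have h1 : ‖g z‖ ^ 2 ≤ Real.exp (α * R ^ 2) * fockDensity α g z := by
    rw [fockDensity, mul_left_comm, ← Real.exp_add]
    refine le_mul_of_one_le_right (by positivity) (Real.one_le_exp ?_)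
    have : ‖z‖ ^ 2 ≤ R ^ 2 := by gcongr
    nlinarith
  refine (ENNReal.ofReal_le_ofReal h1).trans ?_
  rw [ENNReal.ofReal_mul (by positivity), mul_assoc]
  gcongr
  refine (hC g hg z).trans ?_
  rw [mul_assoc, ← lintegral_const_mul' _ _ ENNReal.ofReal_ne_top]
  refine mul_le_mul_right ?_ _
  refine (setLIntegral_mono_ae' (measurableSet_ball (x := z) (ε := 1))
    (Filter.Eventually.of_forall fun w hw => ?_)).trans (setLIntegral_le_lintegral _ _)
  rw [← ENNReal.ofReal_mul (by positivity), weightQ_sq]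
  refine ENNReal.ofReal_le_ofReal ?_
  have h2 : ‖w‖ ≤ 1 + R := by
    have h3 : ‖w - z‖ < 1 := by rw [← dist_eq_norm]; exact hw
    have := norm_le_insert' w z
    linarith
  rw [mul_left_comm]
  refine le_mul_of_one_le_right (fockDensity_nonneg _ _ _) ?_
  rw [← div_eq_mul_inv, one_le_div (by positivity)]
  exact pow_le_pow_left₀ (by positivity) (by linarith) 2

theorem lintegral_Ioi_mul_exp {a : ℝ} (ha : 0 < a) (s : ℝ) (hs : 0 ≤ s) :
    ∫⁻ r in Set.Ioi s, ENNReal.ofReal (r * Real.exp (-(a / 2) * r ^ 2))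
      = ENNReal.ofReal (a⁻¹ * Real.exp (-(a / 2) * s ^ 2)) := by
  have hd : ∀ x : ℝ, HasDerivAt (fun x => -a⁻¹ * Real.exp (-(a / 2) * x ^ 2))
      (x * Real.exp (-(a / 2) * x ^ 2)) x := by
    intro x
    have h1 : HasDerivAt (fun x : ℝ => -(a / 2) * x ^ 2) (-(a / 2) * (2 * x)) x := by
      simpa using (hasDerivAt_pow 2 x).const_mul (-(a / 2))
    exact (h1.exp.const_mul (-a⁻¹)).congr_deriv (by field_simp)
  have ht : Filter.Tendsto (fun x : ℝ => -a⁻¹ * Real.exp (-(a / 2) * x ^ 2)) Filter.atTop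
      (nhds (-a⁻¹ * 0)) := by
    refine (Real.tendsto_exp_atBot.comp ?_).const_mul _
    exact (Filter.tendsto_pow_atTop two_ne_zero).const_mul_atTop_of_neg (by linarith)
  have hpos : ∀ x ∈ Set.Ioi s, 0 ≤ x * Real.exp (-(a / 2) * x ^ 2) := fun x hx =>
    mul_nonneg (hs.trans (le_of_lt hx)) (Real.exp_pos _).le
  have hint := integrableOn_Ioi_deriv_of_nonneg' (fun x _ => hd x) hpos ht
  have hval := integral_Ioi_of_hasDerivAt_of_tendsto' (fun x _ => hd x) hint ht
  rw [← ofReal_integral_eq_lintegral_ofReal hint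
    ((ae_restrict_iff' measurableSet_Ioi).2 (Filter.Eventually.of_forall hpos)), hval]
  congr 1
  ring

theorem lintegral_Ioo_mul_exp_le {a : ℝ} (ha : 0 < a) (r : ℝ) :
    ∫⁻ s in Set.Ioo 1 r, ENNReal.ofReal ((1 + s) * Real.exp ((a / 2) * s ^ 2))
      ≤ ENNReal.ofReal (2 / a * Real.exp ((a / 2) * r ^ 2)) := by
  rcases le_or_gt r 1 with hr | hr
  · simp [Set.Ioo_eq_empty (not_lt.2 hr)]
  have hd : ∀ x : ℝ, HasDerivAt (fun x => 2 / a * Real.exp ((a / 2) * x ^ 2))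
      (2 * x * Real.exp ((a / 2) * x ^ 2)) x := by
    intro x
    have h1 : HasDerivAt (fun x : ℝ => (a / 2) * x ^ 2) ((a / 2) * (2 * x)) x := by
      simpa using (hasDerivAt_pow 2 x).const_mul (a / 2)
    exact (h1.exp.const_mul (2 / a)).congr_deriv (by field_simp)
  have hi : IntervalIntegrable (fun x : ℝ => 2 * x * Real.exp ((a / 2) * x ^ 2)) volume 1 r :=
    Continuous.intervalIntegrable (by fun_prop) _ _
  have h2 := intervalIntegral.integral_eq_sub_of_hasDerivAt (fun x _ => hd x) hi
  rw [intervalIntegral.integral_of_le hr.le, integral_Ioc_eq_integral_Ioo] at h2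
  have hio : IntegrableOn (fun x : ℝ => 2 * x * Real.exp ((a / 2) * x ^ 2)) (Set.Ioo 1 r) :=
    ((intervalIntegrable_iff_integrableOn_Ioc_of_le hr.le).1 hi).mono_set Set.Ioo_subset_Ioc_self
  calc ∫⁻ s in Set.Ioo 1 r, ENNReal.ofReal ((1 + s) * Real.exp ((a / 2) * s ^ 2))
      ≤ ∫⁻ s in Set.Ioo 1 r, ENNReal.ofReal (2 * s * Real.exp ((a / 2) * s ^ 2)) := by
        refine setLIntegral_mono_ae' measurableSet_Ioo (Filter.Eventually.of_forall fun x hx => ?_)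
        refine ENNReal.ofReal_le_ofReal ?_
        have := hx.1
        gcongr
        linarith
    _ = ENNReal.ofReal (2 / a * Real.exp ((a / 2) * r ^ 2) - 2 / a * Real.exp ((a / 2) * 1 ^ 2)) := by
        rw [← h2, ofReal_integral_eq_lintegral_ofReal hio]
        refine (ae_restrict_iff' measurableSet_Ioo).2 (Filter.Eventually.of_forall fun x hx => ?_)
        have : 0 < x := one_pos.trans hx.1
        positivity
    _ ≤ _ := ENNReal.ofReal_le_ofReal (sub_le_self _ (by positivity))

/-- The Cauchy-Schwarz inequality with a positive weight `ω`. -/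
theorem lintegral_sq_le_mul {X : Type*} [MeasurableSpace X] (μ : Measure X) {v : X → ℝ≥0∞}
    (hv : Measurable v) {ω : X → ℝ} (hω : Measurable ω) (h0 : ∀ᵐ x ∂μ, 0 < ω x) :
    (∫⁻ x, v x ∂μ) ^ 2 ≤
      (∫⁻ x, v x ^ 2 * ENNReal.ofReal (ω x)⁻¹ ∂μ) * ∫⁻ x, ENNReal.ofReal (ω x) ∂μ := by
  have h := ENNReal.lintegral_mul_le_Lp_mul_Lq μ Real.HolderConjugate.two_two
    (f := fun x => v x * ENNReal.ofReal (Real.sqrt (ω x))⁻¹)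
    (g := fun x => ENNReal.ofReal (Real.sqrt (ω x)))
    (hv.mul (hω.sqrt.inv.ennreal_ofReal)).aemeasurable hω.sqrt.ennreal_ofReal.aemeasurable
  have h1 : ∫⁻ x, v x ∂μ = ∫⁻ x, ((fun x => v x * ENNReal.ofReal (Real.sqrt (ω x))⁻¹) *
      fun x => ENNReal.ofReal (Real.sqrt (ω x))) x ∂μ := by
    refine lintegral_congr_ae ?_
    filter_upwards [h0] with x hx
    have : 0 < Real.sqrt (ω x) := Real.sqrt_pos.2 hx
    simp only [Pi.mul_apply]
    rw [mul_assoc, ← ENNReal.ofReal_mul (by positivity), inv_mul_cancel₀ this.ne']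
    simp
  have h2 : ∫⁻ x, (v x * ENNReal.ofReal (Real.sqrt (ω x))⁻¹) ^ (2 : ℝ) ∂μ
      = ∫⁻ x, v x ^ 2 * ENNReal.ofReal (ω x)⁻¹ ∂μ := by
    refine lintegral_congr_ae ?_
    filter_upwards [h0] with x hx
    rw [ENNReal.rpow_two, mul_pow, ← ENNReal.ofReal_pow (by positivity), inv_pow, Real.sq_sqrt hx.le]
  have h3 : ∫⁻ x, ENNReal.ofReal (Real.sqrt (ω x)) ^ (2 : ℝ) ∂μ
      = ∫⁻ x, ENNReal.ofReal (ω x) ∂μ := by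
    refine lintegral_congr_ae ?_
    filter_upwards [h0] with x hx
    rw [ENNReal.rpow_two, ← ENNReal.ofReal_pow (by positivity), Real.sq_sqrt hx.le]
  rw [← h1, h2, h3] at h
  refine (pow_le_pow_left' h 2).trans (le_of_eq ?_)
  rw [mul_pow, ← ENNReal.rpow_two, ← ENNReal.rpow_two, ← ENNReal.rpow_mul, ← ENNReal.rpow_mul]
  norm_num

/-- A weighted Hardy inequality on the half-line: Cauchy-Schwarz with the weight
`(1 + s) e^{a s²/2}` in the inner integral, followed by Tonelli's theorem. -/
theorem hardy_gauss {a : ℝ} (ha : 0 < a) {V : ℝ → ℝ≥0∞} (hV : Measurable V) :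
    ∫⁻ r in Set.Ioi (0 : ℝ), ENNReal.ofReal (r * Real.exp (-a * r ^ 2)) *
        (∫⁻ s in Set.Ioo 1 r, V s) ^ 2 ≤
      ENNReal.ofReal (4 / a ^ 2) * ∫⁻ s in Set.Ioi (0 : ℝ),
        ENNReal.ofReal s * (V s ^ 2 * ENNReal.ofReal (Real.exp (-a * s ^ 2) * ((1 + s) ^ 2)⁻¹)) := by
  set U : ℝ → ℝ≥0∞ := fun s =>
    V s ^ 2 * ENNReal.ofReal ((1 + s) * Real.exp ((a / 2) * s ^ 2))⁻¹ with hU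
  have hUm : Measurable U := by
    refine (hV.pow_const 2).mul (Measurable.ennreal_ofReal ?_)
    fun_prop
  have hG : Measurable fun r : ℝ => ENNReal.ofReal (2 / a * (r * Real.exp (-(a / 2) * r ^ 2))) := by
    fun_prop
  calc ∫⁻ r in Set.Ioi (0 : ℝ), ENNReal.ofReal (r * Real.exp (-a * r ^ 2)) *
        (∫⁻ s in Set.Ioo 1 r, V s) ^ 2
      ≤ ∫⁻ r in Set.Ioi (0 : ℝ), ∫⁻ s in Set.Ioi (1 : ℝ),
          (Set.Ioi s).indicator
            (fun r => ENNReal.ofReal (2 / a * (r * Real.exp (-(a / 2) * r ^ 2)))) r * U s := by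
        refine setLIntegral_mono_ae' measurableSet_Ioi (Filter.Eventually.of_forall fun r hr => ?_)
        have hr' : (0 : ℝ) < r := hr
        have h1 := lintegral_sq_le_mul (volume.restrict (Set.Ioo 1 r)) hV
          (ω := fun s => (1 + s) * Real.exp ((a / 2) * s ^ 2)) (by fun_prop) (by
            refine (ae_restrict_iff' measurableSet_Ioo).2 (Filter.Eventually.of_forall fun x hx => ?_)
            have : 0 < x := one_pos.trans hx.1
            positivity)
        calc ENNReal.ofReal (r * Real.exp (-a * r ^ 2)) * (∫⁻ s in Set.Ioo 1 r, V s) ^ 2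
            ≤ ENNReal.ofReal (r * Real.exp (-a * r ^ 2)) * ((∫⁻ s in Set.Ioo 1 r, U s) *
                ENNReal.ofReal (2 / a * Real.exp ((a / 2) * r ^ 2))) := by
              gcongr
              refine h1.trans ?_
              gcongr
              exact lintegral_Ioo_mul_exp_le ha r
          _ = ENNReal.ofReal (2 / a * (r * Real.exp (-(a / 2) * r ^ 2))) *
                ∫⁻ s in Set.Ioo 1 r, U s := by
              rw [mul_comm (∫⁻ s in Set.Ioo 1 r, U s), ← mul_assoc,
                ← ENNReal.ofReal_mul (by positivity)]
              congr 2
              have : Real.exp (-(a / 2) * r ^ 2)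
                  = Real.exp (-a * r ^ 2) * Real.exp ((a / 2) * r ^ 2) := by
                rw [← Real.exp_add]
                congr 1
                ring
              rw [this]
              ring
          _ = ∫⁻ s in Set.Ioi (1 : ℝ), (Set.Ioi s).indicator
            (fun r => ENNReal.ofReal (2 / a * (r * Real.exp (-(a / 2) * r ^ 2)))) r * U s := by
              rw [← lintegral_const_mul' _ _ ENNReal.ofReal_ne_top,
                ← Set.Ioi_inter_Iio, Set.inter_comm, ← Measure.restrict_restrict measurableSet_Iio,
                ← lintegral_indicator measurableSet_Iio]
              refine lintegral_congr fun s => ?_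
              by_cases hs : s < r
              · simp [Set.indicator, hs]
              · simp [Set.indicator, hs]
    _ = ∫⁻ s in Set.Ioi (1 : ℝ), ∫⁻ r in Set.Ioi (0 : ℝ), (Set.Ioi s).indicator
            (fun r => ENNReal.ofReal (2 / a * (r * Real.exp (-(a / 2) * r ^ 2)))) r * U s := by
        refine lintegral_lintegral_swap (Measurable.aemeasurable ?_)
        refine Measurable.mul ?_ (hUm.comp measurable_snd)
        have h2 : MeasurableSet {q : ℝ × ℝ | q.2 < q.1} := measurableSet_lt measurable_snd measurable_fst
        exact (hG.comp measurable_fst).indicator h2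
    _ = ∫⁻ s in Set.Ioi (1 : ℝ),
          ENNReal.ofReal (2 / a * (a⁻¹ * Real.exp (-(a / 2) * s ^ 2))) * U s := by
        refine setLIntegral_congr_fun measurableSet_Ioi fun s hs => ?_
        have hs' : (1 : ℝ) < s := hs
        rw [lintegral_mul_const _ (hG.indicator measurableSet_Ioi),
          lintegral_indicator measurableSet_Ioi, Measure.restrict_restrict measurableSet_Ioi,
          Set.inter_eq_left.2 (Set.Ioi_subset_Ioi (by linarith))]
        congr 1
        rw [ENNReal.ofReal_mul (by positivity), ← lintegral_Ioi_mul_exp ha s (by linarith),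
          ← lintegral_const_mul' _ _ ENNReal.ofReal_ne_top]
        refine lintegral_congr fun r => ?_
        rw [ENNReal.ofReal_mul (by positivity)]
    _ ≤ ∫⁻ s in Set.Ioi (1 : ℝ), ENNReal.ofReal (4 / a ^ 2) * (ENNReal.ofReal s *
          (V s ^ 2 * ENNReal.ofReal (Real.exp (-a * s ^ 2) * ((1 + s) ^ 2)⁻¹))) := by
        refine setLIntegral_mono_ae' measurableSet_Ioi (Filter.Eventually.of_forall fun s hs => ?_)
        have hs' : (1 : ℝ) < s := hs
        have hs0 : (0 : ℝ) < s := by linarith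
        rw [hU]
        beta_reduce
        have h3 : ∀ x y z t : ℝ≥0∞, x * (y * (z * t)) = z * (x * (y * t)) := by intros; ring
        rw [h3, ← mul_assoc, mul_comm _ (V s ^ 2), mul_assoc, ← ENNReal.ofReal_mul (by positivity),
          ← ENNReal.ofReal_mul (by positivity), ← ENNReal.ofReal_mul (by positivity)]
        refine mul_le_mul_right (ENNReal.ofReal_le_ofReal ?_) _
        have h4 : Real.exp (-a * s ^ 2)
            = Real.exp (-(a / 2) * s ^ 2) * (Real.exp ((a / 2) * s ^ 2))⁻¹ := by
          rw [← Real.exp_neg, ← Real.exp_add]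
          congr 1
          ring
        have h5 : (1 + s)⁻¹ ≤ 2 * s * ((1 + s) ^ 2)⁻¹ := by
          rw [inv_eq_one_div, ← div_eq_mul_inv, div_le_div_iff₀ (by positivity) (by positivity)]
          nlinarith
        rw [h4, mul_inv]
        have h6 : 0 ≤ Real.exp (-(a / 2) * s ^ 2) * (Real.exp ((a / 2) * s ^ 2))⁻¹ := by positivity
        calc 2 / a * (a⁻¹ * Real.exp (-(a / 2) * s ^ 2)) *
              ((1 + s)⁻¹ * (Real.exp (a / 2 * s ^ 2))⁻¹)
            = 2 / a ^ 2 * ((Real.exp (-(a / 2) * s ^ 2) * (Real.exp ((a / 2) * s ^ 2))⁻¹) *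
              (1 + s)⁻¹) := by field_simp
          _ ≤ 2 / a ^ 2 * ((Real.exp (-(a / 2) * s ^ 2) * (Real.exp ((a / 2) * s ^ 2))⁻¹) *
              (2 * s * ((1 + s) ^ 2)⁻¹)) := by gcongr
          _ = _ := by ring
    _ ≤ _ := by
        rw [lintegral_const_mul' _ _ ENNReal.ofReal_ne_top]
        gcongr
        norm_num

theorem ENNReal.add_sq_le_four_mul (a b : ℝ≥0∞) : (a + b) ^ 2 ≤ 4 * (a ^ 2 + b ^ 2) := by
  rcases le_total a b with h | h
  · calc (a + b) ^ 2 ≤ (b + b) ^ 2 := by gcongr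
      _ = 4 * b ^ 2 := by ring
      _ ≤ _ := by gcongr; exact le_add_self
  · calc (a + b) ^ 2 ≤ (a + a) ^ 2 := by gcongr
      _ = 4 * a ^ 2 := by ring
      _ ≤ _ := by gcongr; exact le_self_add

theorem ofReal_fockDensity (α : ℝ) (f : ℂ → ℂ) (z : ℂ) :
    ENNReal.ofReal (fockDensity α f z) = ‖f z‖ₑ ^ 2 * ENNReal.ofReal (Real.exp (-α * ‖z‖ ^ 2)) := by
  rw [fockDensity, ENNReal.ofReal_mul (by positivity), ENNReal.ofReal_pow (norm_nonneg _), ofReal_norm]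

/-- Growth of an entire function along a ray, outside the unit disc. -/
theorem enorm_le_add_lintegral_ray {h : ℂ → ℂ} (hh : Differentiable ℂ h) {S : ℝ}
    (hS : ∀ x : ℂ, ‖x‖ ≤ 1 → ‖deriv h x‖ ≤ S) {e : ℂ} (he : ‖e‖ = 1) {r : ℝ} (hr : 0 < r) :
    ‖h (r * e)‖ₑ ≤ ENNReal.ofReal (‖h 0‖ + S) + ∫⁻ s in Set.Ioo 1 r, ‖deriv h (s * e)‖ₑ := by
  have hS0 : 0 ≤ S := (norm_nonneg _).trans (hS 0 (by simp))
  have h1 : ∀ z : ℂ, ‖z‖ ≤ 1 → ‖h z‖ ≤ ‖h 0‖ + S := by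
    intro z hz
    have h2 := (convex_closedBall (0 : ℂ) 1).norm_image_sub_le_of_norm_deriv_le (f := h) (C := S)
      (fun x _ => hh x) (fun x hx => hS x (by simpa using hx)) (x := 0) (y := z) (by simp)
      (by simpa using hz)
    have h3 := norm_le_insert' (h z) (h 0)
    have h4 : S * ‖z - 0‖ ≤ S := by
      rw [sub_zero]
      exact mul_le_of_le_one_right hS0 hz
    linarith
  rcases le_or_gt r 1 with hr1 | hr1
  · refine le_add_right ?_
    rw [← ofReal_norm]
    refine ENNReal.ofReal_le_ofReal (h1 _ ?_)
    simpa [he, abs_of_pos hr] using hr1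
  have hcont := deriv_continuous hh
  have hd : ∀ t : ℝ, HasDerivAt (fun t : ℝ => h (t * e)) (deriv h (t * e) * e) t := by
    intro t
    have h2 : HasDerivAt (fun s : ℂ => h (s * e)) (deriv h (t * e) * e) (t : ℂ) := by
      have := (hh ((t : ℂ) * e)).hasDerivAt.comp (t : ℂ) ((hasDerivAt_id (t : ℂ)).mul_const e)
      simpa [Function.comp_def] using this
    exact h2.comp_ofReal
  have hint := intervalIntegral.integral_eq_sub_of_hasDerivAt (a := 1) (b := r)
    (fun t _ => hd t) (Continuous.intervalIntegrable (by fun_prop) _ _)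
  rw [intervalIntegral.integral_of_le hr1.le, integral_Ioc_eq_integral_Ioo] at hint
  have h5 : h (r * e) = h e + ∫ t in Set.Ioo 1 r, deriv h (t * e) * e := by
    rw [hint]; simp
  rw [h5]
  refine (enorm_add_le _ _).trans (add_le_add ?_ ?_)
  · rw [← ofReal_norm]
    exact ENNReal.ofReal_le_ofReal (h1 _ he.le)
  · refine (enorm_integral_le_lintegral_enorm _).trans (le_of_eq ?_)
    refine lintegral_congr fun t => ?_
    rw [enorm_mul, ← ofReal_norm e, he]
    simp

/-- The other half of the Littlewood-Paley formula: an entire function is controlled by its value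
at the origin and the weighted square integral of its derivative. -/
theorem exists_lintegral_fockDensity_le {α : ℝ} (hα : 0 < α) :
    ∃ C : ℝ≥0, ∀ h : ℂ → ℂ, Differentiable ℂ h →
      ∫⁻ z, ENNReal.ofReal (fockDensity α h z) ≤
        C * (ENNReal.ofReal (‖h 0‖ ^ 2) + ∫⁻ z, ENNReal.ofReal (weightQ α (deriv h) z ^ 2)) := by
  obtain ⟨C₁, hC₁⟩ := exists_norm_sq_le_lintegral_weightQ hα 1
  refine ⟨16 * (Real.pi / α).toNNReal * (1 + C₁) + 4 * (4 / α ^ 2).toNNReal, fun h hh => ?_⟩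
  set W := ∫⁻ z, ENNReal.ofReal (weightQ α (deriv h) z ^ 2) with hW
  have hcont := deriv_continuous hh
  obtain ⟨x₀, hx₀m, hx₀⟩ := (isCompact_closedBall (0 : ℂ) 1).exists_isMaxOn ⟨0, by simp⟩
    hcont.norm.continuousOn
  set S := ‖deriv h x₀‖ with hS
  have hSle : ∀ x : ℂ, ‖x‖ ≤ 1 → ‖deriv h x‖ ≤ S := fun x hx => hx₀ (by simpa using hx)
  have hS2 : ENNReal.ofReal (S ^ 2) ≤ C₁ * W := hC₁ _ hh.deriv x₀ (by simpa using hx₀m)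
  set A : ℝ≥0∞ := ENNReal.ofReal (‖h 0‖ + S) ^ 2 with hA
  have hA' : A ≤ 4 * (ENNReal.ofReal (‖h 0‖ ^ 2) + C₁ * W) := by
    rw [hA, ENNReal.ofReal_add (norm_nonneg _) (norm_nonneg _)]
    refine (ENNReal.add_sq_le_four_mul _ _).trans ?_
    rw [← ENNReal.ofReal_pow (norm_nonneg _), ← ENNReal.ofReal_pow (norm_nonneg _)]
    gcongr
  set E : ℝ → ℂ := fun θ => Real.cos θ + Real.sin θ * Complex.I with hE
  have hEn : ∀ θ, ‖E θ‖ = 1 := fun θ => by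
    change ‖(Real.cos θ + Real.sin θ * Complex.I : ℂ)‖ = 1
    rw [Complex.ofReal_cos, Complex.ofReal_sin, ← Complex.exp_mul_I,
      Complex.norm_exp_ofReal_mul_I]
  have hEm : Measurable E := by fun_prop
  set X : ℝ × ℝ → ℝ≥0∞ := fun q => ∫⁻ s in Set.Ioo 1 q.1, ‖deriv h (s * E q.2)‖ₑ with hX
  have hXm : Measurable X := by
    have h1 : ∀ q : ℝ × ℝ, X q = ∫⁻ s, {u : (ℝ × ℝ) × ℝ | 1 < u.2 ∧ u.2 < u.1.1}.indicator
        (fun u => ‖deriv h (u.2 * E u.1.2)‖ₑ) (q, s) := by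
      intro q
      change ∫⁻ s in Set.Ioo 1 q.1, ‖deriv h (s * E q.2)‖ₑ = _
      rw [← lintegral_indicator measurableSet_Ioo]
      rfl
    rw [funext h1]
    refine Measurable.lintegral_prod_right' (f := {u : (ℝ × ℝ) × ℝ | 1 < u.2 ∧ u.2 < u.1.1}.indicator
        (fun u => ‖deriv h (u.2 * E u.1.2)‖ₑ)) ?_
    refine Measurable.indicator ?_ ?_
    · exact (hcont.measurable.comp (by fun_prop)).enorm
    · exact (measurableSet_lt measurable_const measurable_snd).inter
        (measurableSet_lt measurable_snd (measurable_fst.comp measurable_fst))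
  have htar : polarCoord.target = Set.Ioi (0 : ℝ) ×ˢ Set.Ioo (-Real.pi) Real.pi := rfl
  have htm : MeasurableSet polarCoord.target := measurableSet_Ioi.prod measurableSet_Ioo
  have hsymm : ∀ q : ℝ × ℝ, Complex.polarCoord.symm q = q.1 * E q.2 := fun q => by
    rw [Complex.polarCoord_symm_apply]
  have hnorm : ∀ q ∈ polarCoord.target, ‖Complex.polarCoord.symm q‖ = q.1 := fun q hq => by
    rw [Complex.norm_polarCoord_symm, abs_of_pos hq.1]
  have hwm : Measurable fun z => ENNReal.ofReal (weightQ α (deriv h) z ^ 2) :=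
    ((continuous_weightQ α hcont).measurable.pow_const 2).ennreal_ofReal
  have hm1 : Measurable fun q : ℝ × ℝ =>
      ENNReal.ofReal (q.1 * Real.exp (-α * q.1 ^ 2)) * X q ^ 2 :=
    (Measurable.ennreal_ofReal (by fun_prop)).mul (hXm.pow_const 2)
  -- Hardy's inequality on every ray
  have hrad : ∫⁻ q in polarCoord.target,
      ENNReal.ofReal (q.1 * Real.exp (-α * q.1 ^ 2)) * X q ^ 2 ≤ ENNReal.ofReal (4 / α ^ 2) * W := by
    have hm2 : Measurable fun q : ℝ × ℝ => ENNReal.ofReal q.1 •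
        ENNReal.ofReal (weightQ α (deriv h) (Complex.polarCoord.symm q) ^ 2) := by
      simp only [hsymm]
      exact (measurable_fst.ennreal_ofReal).smul (hwm.comp (by fun_prop))
    rw [hW, ← Complex.lintegral_comp_polarCoord_symm, htar, Measure.volume_eq_prod,
      ← Measure.prod_restrict, lintegral_prod_symm _ hm1.aemeasurable,
      lintegral_prod_symm _ hm2.aemeasurable, ← lintegral_const_mul' _ _ ENNReal.ofReal_ne_top]
    refine lintegral_mono fun θ => ?_
    have h2 := hardy_gauss hα (V := fun s : ℝ => ‖deriv h (s * E θ)‖ₑ)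
      (hcont.measurable.comp (by fun_prop)).enorm
    refine h2.trans (le_of_eq ?_)
    congr 1
    refine setLIntegral_congr_fun measurableSet_Ioi fun s hs => ?_
    have hs0 : (0 : ℝ) < s := hs
    have h3 : ‖(s : ℂ) * E θ‖ = s := by
      rw [norm_mul, hEn, mul_one, Complex.norm_real, Real.norm_of_nonneg hs0.le]
    simp only [hsymm]
    rw [smul_eq_mul, weightQ_sq, fockDensity, h3, mul_assoc,
      ENNReal.ofReal_mul (p := ‖deriv h (s * E θ)‖ ^ 2) (by positivity),
      ENNReal.ofReal_pow (norm_nonneg _), ofReal_norm]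
  have hgau : ∫⁻ z : ℂ, ENNReal.ofReal (Real.exp (-α * ‖z‖ ^ 2)) = ENNReal.ofReal (Real.pi / α) := by
    rw [← ofReal_integral_eq_lintegral_ofReal (integrable_gauss_complex hα)
      (Filter.Eventually.of_forall fun z => (Real.exp_pos _).le), integral_gauss_complex hα]
  have hsplit : ∫⁻ z, ENNReal.ofReal (fockDensity α h z) ≤
      4 * A * ENNReal.ofReal (Real.pi / α) + 4 * (ENNReal.ofReal (4 / α ^ 2) * W) := by
    rw [← Complex.lintegral_comp_polarCoord_symm]
    calc ∫⁻ q in polarCoord.target, ENNReal.ofReal q.1 •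
          ENNReal.ofReal (fockDensity α h (Complex.polarCoord.symm q))
        ≤ ∫⁻ q in polarCoord.target, (4 * A * (ENNReal.ofReal q.1 •
            ENNReal.ofReal (Real.exp (-α * ‖Complex.polarCoord.symm q‖ ^ 2))) +
            4 * (ENNReal.ofReal (q.1 * Real.exp (-α * q.1 ^ 2)) * X q ^ 2)) := by
          refine setLIntegral_mono_ae' htm (Filter.Eventually.of_forall fun q hq => ?_)
          have hq0 : 0 < q.1 := hq.1
          rw [ofReal_fockDensity, hnorm q hq, smul_eq_mul, smul_eq_mul,
            ENNReal.ofReal_mul hq0.le, hsymm]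
          have h4 : ‖h (q.1 * E q.2)‖ₑ ^ 2 ≤ 4 * (A + X q ^ 2) :=
            (pow_le_pow_left' (enorm_le_add_lintegral_ray hh hSle (hEn q.2) hq0) 2).trans
              (ENNReal.add_sq_le_four_mul _ _)
          refine (mul_le_mul_right (mul_le_mul_left h4 _) _).trans (le_of_eq ?_)
          ring
      _ = _ := by
          rw [lintegral_add_right _ (hm1.const_mul _),
            lintegral_const_mul' _ _ (by finiteness), lintegral_const_mul' _ _ (by finiteness),
            Complex.lintegral_comp_polarCoord_symm (fun z : ℂ =>
              ENNReal.ofReal (Real.exp (-α * ‖z‖ ^ 2))), hgau]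
      _ ≤ _ := by gcongr
  refine hsplit.trans ?_
  calc 4 * A * ENNReal.ofReal (Real.pi / α) + 4 * (ENNReal.ofReal (4 / α ^ 2) * W)
      ≤ 4 * (4 * (ENNReal.ofReal (‖h 0‖ ^ 2) + C₁ * W)) * ENNReal.ofReal (Real.pi / α) +
          4 * (ENNReal.ofReal (4 / α ^ 2) * W) := by gcongr
    _ = 16 * ENNReal.ofReal (Real.pi / α) * (1 * ENNReal.ofReal (‖h 0‖ ^ 2) + C₁ * W) +
          4 * ENNReal.ofReal (4 / α ^ 2) * (0 + W) := by ring
    _ ≤ 16 * ENNReal.ofReal (Real.pi / α) * ((1 + C₁) * ENNReal.ofReal (‖h 0‖ ^ 2) + (1 + C₁) * W) +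
          4 * ENNReal.ofReal (4 / α ^ 2) * (ENNReal.ofReal (‖h 0‖ ^ 2) + W) := by
        gcongr
        · exact le_self_add
        · exact le_add_self
        · exact zero_le
    _ = _ := by
        push_cast
        change _ = (16 * ENNReal.ofReal _ * _ + 4 * ENNReal.ofReal _) * _
        ring

/-! ### The Fock space as a reproducing kernel Hilbert space -/

theorem integrable_fockDensity_of_lintegral {α : ℝ} {f : ℂ → ℂ} (hf : Differentiable ℂ f)
    (h : ∫⁻ z, ENNReal.ofReal (fockDensity α f z) ≠ ∞) : Integrable (fockDensity α f) := by
  refine ⟨(continuous_fockDensity hf.continuous).aestronglyMeasurable, ?_⟩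
  rw [hasFiniteIntegral_iff_ofReal (Filter.Eventually.of_forall (fockDensity_nonneg α f))]
  exact h.lt_top

namespace FockSpace

variable {α : ℝ}

/-- An entire function with `∫ |f|² e^{-α|z|²} dm < ∞`, as an element of the Fock space. -/
noncomputable def mk (f : ℂ → ℂ) (hf : Differentiable ℂ f)
    (h : ∫⁻ z, ENNReal.ofReal (fockDensity α f z) ≠ ∞) : FockSpace α :=
  ⟨f, hf, integrable_fockDensity_of_lintegral hf h⟩

@[simp] theorem mk_apply {f : ℂ → ℂ} (hf : Differentiable ℂ f)
    (h : ∫⁻ z, ENNReal.ofReal (fockDensity α f z) ≠ ∞) (z : ℂ) : mk f hf h z = f z := rfl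

@[simp] theorem sub_apply (f h : FockSpace α) (z : ℂ) : (f - h) z = f z - h z := rfl

@[simp] theorem zero_apply (z : ℂ) : (0 : FockSpace α) z = 0 := rfl

theorem sum_apply {ι : Type*} (s : Finset ι) (f : ι → FockSpace α) (z : ℂ) :
    (∑ i ∈ s, f i) z = ∑ i ∈ s, f i z := by
  classical
  induction s using Finset.induction_on with
  | empty => simp
  | insert i s hi ih => rw [Finset.sum_insert hi, Finset.sum_insert hi, add_apply, ih]

variable [hα : Fact (0 < α)]

theorem inner_def (f h : FockSpace α) : inner ℂ f h =
    (α / Real.pi : ℝ) * ∫ z : ℂ, conj (f z) * h z * (Real.exp (-α * ‖z‖ ^ 2) : ℂ) := rfl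

theorem norm_sq_eq (f : FockSpace α) : ‖f‖ ^ 2 = α / Real.pi * ∫ z, fockDensity α f z := by
  have h1 : inner ℂ f f = ((‖f‖ ^ 2 : ℝ) : ℂ) := by
    rw [inner_self_eq_norm_sq_to_K]; norm_cast
  have h2 : ∀ z : ℂ, conj (f z) * f z * (Real.exp (-α * ‖z‖ ^ 2) : ℂ)
      = ((fockDensity α f z : ℝ) : ℂ) := by
    intro z
    rw [Complex.conj_mul', fockDensity]
    push_cast
    ring
  rw [inner_def] at h1
  simp only [h2] at h1
  rw [integral_complex_ofReal] at h1
  exact_mod_cast h1.symm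

theorem ofReal_norm_sq (f : FockSpace α) : ENNReal.ofReal (‖f‖ ^ 2) =
    ENNReal.ofReal (α / Real.pi) * ∫⁻ z, ENNReal.ofReal (fockDensity α f z) := by
  have h0 : 0 < α := hα.out
  rw [norm_sq_eq, ENNReal.ofReal_mul (by positivity), ofReal_integral_eq_lintegral_ofReal
    (f := fockDensity α f) f.integrable (Filter.Eventually.of_forall (fockDensity_nonneg α f))]

theorem lintegral_fockDensity (f : FockSpace α) :
    ∫⁻ z, ENNReal.ofReal (fockDensity α f z) =
      ENNReal.ofReal (Real.pi / α) * ENNReal.ofReal (‖f‖ ^ 2) := by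
  have h0 : 0 < α := hα.out
  rw [ofReal_norm_sq, ← mul_assoc, ← ENNReal.ofReal_mul (by positivity)]
  have : Real.pi / α * (α / Real.pi) = 1 := by field_simp
  rw [this]
  simp

variable (α) in
theorem lintegral_fockDensity_normKernel (w : ℂ) :
    ∫⁻ z, ENNReal.ofReal (fockDensity α (normKernel α w) z) = ENNReal.ofReal (Real.pi / α) := by
  have h0 : 0 < α := hα.out
  simp only [fockDensity_normKernel]
  rw [lintegral_sub_right_eq_self (fun z : ℂ => ENNReal.ofReal (Real.exp (-α * ‖z‖ ^ 2))),
    ← ofReal_integral_eq_lintegral_ofReal (integrable_gauss_complex h0)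
      (Filter.Eventually.of_forall fun z => (Real.exp_pos _).le), integral_gauss_complex h0]

variable (α) in
/-- The normalized kernel function `k_w`, as an element of the Fock space. -/
noncomputable def kernel (w : ℂ) : FockSpace α :=
  mk (normKernel α w) (differentiable_normKernel α w)
    (by rw [lintegral_fockDensity_normKernel]; exact ENNReal.ofReal_ne_top)

theorem coe_kernel (w : ℂ) : ⇑(kernel α w) = normKernel α w := rfl

theorem norm_kernel (w : ℂ) : ‖kernel α w‖ = 1 := by
  have h0 : 0 < α := hα.out
  have h := lintegral_fockDensity (kernel α w)
  rw [coe_kernel, lintegral_fockDensity_normKernel, ← ENNReal.ofReal_mul (by positivity),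
    ENNReal.ofReal_eq_ofReal_iff (by positivity) (by positivity)] at h
  have h1 : Real.pi / α ≠ 0 := by positivity
  have h2 : ‖kernel α w‖ ^ 2 = 1 := by
    have := mul_left_cancel₀ h1 ((mul_one _).trans h)
    exact this.symm
  nlinarith [norm_nonneg (kernel α w)]

/-- The reproducing property: the Gaussian mean value property of the Weyl translate of `f`. -/
theorem inner_kernel (w : ℂ) (f : FockSpace α) :
    inner ℂ (kernel α w) f = f w * Complex.exp (-(α * (‖w‖ ^ 2 : ℝ) / 2)) := by
  have h0 : 0 < α := hα.out
  have hpt : ∀ z : ℂ, (Real.exp (-α * ‖z‖ ^ 2) : ℂ) * weyl α w f z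
      = conj (normKernel α w (w + z)) * f (w + z) * (Real.exp (-α * ‖w + z‖ ^ 2) : ℂ) := by
    intro z
    unfold weyl normKernel
    rw [← Complex.exp_conj, Complex.ofReal_exp, Complex.ofReal_exp, mul_left_comm,
      ← Complex.exp_add, mul_comm (Complex.exp _) (f (w + z)), mul_assoc (f (w + z)),
      ← Complex.exp_add]
    congr 2
    have h1 : ((‖w + z‖ ^ 2 : ℝ) : ℂ) = (w + z) * conj (w + z) := by
      rw [Complex.mul_conj, Complex.sq_norm]
    have h2 : ((‖z‖ ^ 2 : ℝ) : ℂ) = z * conj z := by rw [Complex.mul_conj, Complex.sq_norm]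
    have h3 : ((‖w‖ ^ 2 : ℝ) : ℂ) = w * conj w := by rw [Complex.mul_conj, Complex.sq_norm]
    rw [Complex.ofReal_mul, Complex.ofReal_mul, h1, h2, h3]
    simp only [map_sub, map_mul, map_add, map_div₀, Complex.conj_ofReal, Complex.conj_conj,
      Complex.ofReal_neg, map_ofNat]
    ring
  have hint : Integrable (fun z : ℂ => conj (normKernel α w (w + z)) * f (w + z) *
      (Real.exp (-α * ‖w + z‖ ^ 2) : ℂ)) :=
    (integrable_mul (kernel α w) f).comp_add_left w
  have h1 := integral_gauss_mul (differentiable_weyl α w f.differentiable) h0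
    (by simpa only [hpt] using hint)
  simp only [hpt] at h1
  rw [integral_add_left_eq_self (fun z => conj (normKernel α w z) * f z *
      (Real.exp (-α * ‖z‖ ^ 2) : ℂ)) w] at h1
  rw [inner_def, coe_kernel, h1, ← mul_assoc, ← Complex.ofReal_mul]
  have h2 : α / Real.pi * (Real.pi / α) = 1 := by field_simp
  rw [h2, weyl]
  simp

theorem norm_inner_kernel_sq (w : ℂ) (f : FockSpace α) :
    ‖inner ℂ (kernel α w) f‖ ^ 2 = fockDensity α f w := by
  rw [inner_kernel, norm_mul, mul_pow, fockDensity]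
  congr 1
  have : (-(α * (‖w‖ ^ 2 : ℝ) / 2) : ℂ) = ((-(α * ‖w‖ ^ 2 / 2) : ℝ) : ℂ) := by push_cast; ring
  rw [this, Complex.norm_exp_ofReal, ← Real.exp_nat_mul]
  congr 1
  push_cast
  ring

theorem fockDensity_le_norm_sq (f : FockSpace α) (w : ℂ) : fockDensity α f w ≤ ‖f‖ ^ 2 := by
  rw [← norm_inner_kernel_sq]
  have h := norm_inner_le_norm (𝕜 := ℂ) (kernel α w) f
  rw [norm_kernel, one_mul] at h
  gcongr

theorem norm_inner_kernel_kernel (w v : ℂ) :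
    ‖inner ℂ (kernel α w) (kernel α v)‖ = Real.exp (-(α / 2) * ‖w - v‖ ^ 2) := by
  have h := norm_inner_kernel_sq w (kernel α v)
  rw [coe_kernel, fockDensity_normKernel] at h
  rw [← Real.sqrt_sq (norm_nonneg (inner ℂ (kernel α w) (kernel α v))), h, ← Real.exp_half]
  congr 1
  ring

theorem norm_apply_le (f : FockSpace α) (z : ℂ) : ‖f z‖ ≤ Real.exp (α / 2 * ‖z‖ ^ 2) * ‖f‖ := by
  have h := fockDensity_le_norm_sq f z
  refine le_of_sq_le_sq ?_ (by positivity)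
  have h1 : ‖f z‖ ^ 2 = Real.exp (α * ‖z‖ ^ 2) * fockDensity α f z := by
    rw [fockDensity, mul_left_comm, ← Real.exp_add]
    simp
  rw [mul_pow, ← Real.exp_nat_mul, h1]
  have h2 : ((2 : ℕ) : ℝ) * (α / 2 * ‖z‖ ^ 2) = α * ‖z‖ ^ 2 := by push_cast; ring
  rw [h2]
  gcongr

/-- Bessel's inequality for the kernel function. -/
theorem tsum_fockDensity_le {e : ℕ → FockSpace α} (he : Orthonormal ℂ e) (w : ℂ) :
    ∑' n, ENNReal.ofReal (fockDensity α (e n) w) ≤ 1 := by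
  have h1 : ∀ n, fockDensity α (e n) w = ‖inner ℂ (e n) (kernel α w)‖ ^ 2 := fun n => by
    rw [norm_inner_symm, norm_inner_kernel_sq]
  simp only [h1]
  rw [← ENNReal.ofReal_tsum_of_nonneg (fun n => by positivity) (he.inner_products_summable _)]
  refine ENNReal.ofReal_le_one.2 ((he.tsum_inner_products_le _).trans ?_)
  rw [norm_kernel]
  norm_num

/-- The kernel on the diagonal, `∑ᵢ |bᵢ(w)|² e^{-α|w|²} = 1`, would otherwise be integrable. -/
theorem not_finiteDimensional : ¬ FiniteDimensional ℂ (FockSpace α) := by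
  intro hfd
  have h0 : 0 < α := hα.out
  set b := stdOrthonormalBasis ℂ (FockSpace α)
  have h1 : ∀ w : ℂ, (1 : ℝ≥0∞) = ∑ i, ENNReal.ofReal (fockDensity α (b i) w) := by
    intro w
    have h2 := b.sum_sq_norm_inner_right (kernel α w)
    rw [norm_kernel] at h2
    rw [← ENNReal.ofReal_sum_of_nonneg fun i _ => fockDensity_nonneg _ _ _]
    have h3 : ∀ i, fockDensity α (b i) w = ‖inner ℂ (b i) (kernel α w)‖ ^ 2 := fun i => by
      rw [norm_inner_symm, norm_inner_kernel_sq]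
    simp only [h3, h2]
    simp
  have h4 : ∫⁻ _ : ℂ, (1 : ℝ≥0∞) = ∑ i, ∫⁻ w, ENNReal.ofReal (fockDensity α (b i) w) := by
    rw [← lintegral_finsetSum]
    · exact lintegral_congr h1
    · exact fun i _ => measurable_fockDensity (b i).differentiable.continuous
  have h5 : ∑ i, ∫⁻ w, ENNReal.ofReal (fockDensity α (b i) w) ≠ ∞ := by
    refine ENNReal.sum_ne_top.2 fun i _ => ?_
    rw [lintegral_fockDensity]
    finiteness
  rw [← h4] at h5
  simp at h5

instance : CompleteSpace (FockSpace α) := by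
  have h0 : 0 < α := hα.out
  refine Metric.complete_of_cauchySeq_tendsto fun u hu => ?_
  have hev : ∀ (z : ℂ) (n m : ℕ),
      ‖u n z - u m z‖ ≤ Real.exp (α / 2 * ‖z‖ ^ 2) * ‖u n - u m‖ := fun z n m => by
    rw [← sub_apply]; exact norm_apply_le _ z
  have hC : ∀ ε > 0, ∃ N, ∀ n ≥ N, ∀ m ≥ N, ‖u n - u m‖ < ε := by
    intro ε hε
    obtain ⟨N, hN⟩ := Metric.cauchySeq_iff.1 hu ε hε
    exact ⟨N, fun n hn m hm => by rw [← dist_eq_norm]; exact hN n hn m hm⟩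
  have hlim : ∀ z : ℂ, ∃ c, Filter.Tendsto (fun n => u n z) Filter.atTop (nhds c) := by
    intro z
    refine cauchySeq_tendsto_of_complete (Metric.cauchySeq_iff.2 fun ε hε => ?_)
    obtain ⟨N, hN⟩ := hC (ε / Real.exp (α / 2 * ‖z‖ ^ 2)) (by positivity)
    refine ⟨N, fun m hm n hn => ?_⟩
    rw [dist_eq_norm]
    refine (hev z m n).trans_lt ?_
    rw [← lt_div_iff₀' (Real.exp_pos _)]
    exact hN m hm n hn
  choose F hF using hlim
  have hFu : ∀ R : ℝ, TendstoUniformlyOn (fun n z => u n z) F Filter.atTop (Metric.ball 0 R) := by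
    intro R
    rw [Metric.tendstoUniformlyOn_iff]
    intro ε hε
    obtain ⟨N, hN⟩ := hC (ε / 2 / Real.exp (α / 2 * R ^ 2)) (by positivity)
    filter_upwards [Filter.eventually_ge_atTop N] with n hn z hz
    have h1 : ‖F z - u n z‖ ≤ ε / 2 := by
      refine le_of_tendsto ((hF z).sub_const (u n z)).norm ?_
      filter_upwards [Filter.eventually_ge_atTop N] with m hm
      refine (hev z m n).trans ?_
      have hz' : ‖z‖ ≤ R := by simpa using (Metric.mem_ball.1 hz).le
      calc Real.exp (α / 2 * ‖z‖ ^ 2) * ‖u m - u n‖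
          ≤ Real.exp (α / 2 * R ^ 2) * (ε / 2 / Real.exp (α / 2 * R ^ 2)) := by
            gcongr
            exact (hN m hm n hn).le
        _ = ε / 2 := by field_simp
    rw [dist_eq_norm]
    linarith
  have hFd : Differentiable ℂ F := by
    intro z
    have hz : z ∈ Metric.ball (0 : ℂ) (‖z‖ + 1) := by simp
    have h1 := (hFu (‖z‖ + 1)).tendstoLocallyUniformlyOn.differentiableOn
      (Filter.Eventually.of_forall fun n => (u n).differentiable.differentiableOn)
      Metric.isOpen_ball
    exact h1.differentiableAt (Metric.isOpen_ball.mem_nhds hz)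
  -- the convergence to the pointwise limit holds in the norm as well, by Fatou's lemma
  have hfat : ∀ ε > 0, ∃ N, ∀ n ≥ N, ∫⁻ z, ENNReal.ofReal (fockDensity α (fun z => u n z - F z) z)
      ≤ ENNReal.ofReal (Real.pi / α) * ENNReal.ofReal (ε ^ 2) := by
    intro ε hε
    obtain ⟨N, hN⟩ := hC ε hε
    refine ⟨N, fun n hn => ?_⟩
    have h1 : ∀ z, Filter.Tendsto (fun m => ENNReal.ofReal (fockDensity α ⇑(u n - u m) z))
        Filter.atTop (nhds (ENNReal.ofReal (fockDensity α (fun z => u n z - F z) z))) := by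
      intro z
      refine (ENNReal.continuous_ofReal.tendsto _).comp ?_
      exact (((hF z).const_sub (u n z)).norm.pow 2).mul_const _
    calc ∫⁻ z, ENNReal.ofReal (fockDensity α (fun z => u n z - F z) z)
        = ∫⁻ z, Filter.liminf (fun m => ENNReal.ofReal (fockDensity α ⇑(u n - u m) z))
            Filter.atTop := lintegral_congr fun z => (h1 z).liminf_eq.symm
      _ ≤ Filter.liminf (fun m => ∫⁻ z, ENNReal.ofReal (fockDensity α ⇑(u n - u m) z))
            Filter.atTop :=
          lintegral_liminf_le fun m => measurable_fockDensity (u n - u m).differentiable.continuous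
      _ ≤ _ := by
          refine Filter.liminf_le_of_frequently_le' (Filter.Eventually.frequently ?_)
          filter_upwards [Filter.eventually_ge_atTop N] with m hm
          rw [lintegral_fockDensity]
          gcongr
          exact (hN n hn m hm).le
  have hmem : ∀ n, ∀ ε : ℝ, ∫⁻ z, ENNReal.ofReal (fockDensity α (fun z => u n z - F z) z)
      ≤ ENNReal.ofReal (Real.pi / α) * ENNReal.ofReal (ε ^ 2) →
      ∫⁻ z, ENNReal.ofReal (fockDensity α (fun z => u n z - F z) z) ≠ ∞ := fun n ε h =>
    ne_top_of_le_ne_top (by finiteness) h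
  obtain ⟨N₁, hN₁⟩ := hfat 1 one_pos
  set G : FockSpace α := mk (fun z => u N₁ z - F z) ((u N₁).differentiable.sub hFd)
    (hmem N₁ 1 (hN₁ N₁ le_rfl)) with hG
  refine ⟨u N₁ - G, ?_⟩
  rw [Metric.tendsto_atTop]
  intro ε hε
  obtain ⟨N, hN⟩ := hfat (ε / 2) (by positivity)
  refine ⟨N, fun n hn => ?_⟩
  have h1 : ⇑(u n - (u N₁ - G)) = fun z => u n z - F z := by
    ext z
    simp [hG]
  have h2 := hN n hn
  rw [← h1, lintegral_fockDensity] at h2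
  have h3 : ‖u n - (u N₁ - G)‖ ^ 2 ≤ (ε / 2) ^ 2 := by
    have h4 : ENNReal.ofReal (Real.pi / α) ≠ 0 := by
      simp only [ne_eq, ENNReal.ofReal_eq_zero, not_le]; positivity
    rw [ENNReal.mul_le_mul_iff_right h4 ENNReal.ofReal_ne_top] at h2
    exact (ENNReal.ofReal_le_ofReal_iff (by positivity)).1 h2
  have h5 := le_of_sq_le_sq h3 (by positivity)
  rw [dist_eq_norm]
  linarith

end FockSpace

/-! ### Schmidt decompositions and Schatten norms -/

section Schatten

variable {H : Type*} [NormedAddCommGroup H] [InnerProductSpace ℂ H]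

namespace IsSchmidtDecomposition

variable {T : H →L[ℂ] H} {e u : ℕ → H} {s : ℕ → ℝ}

theorem hasSum_norm_sq (h : IsSchmidtDecomposition T e u s) (f : H) :
    HasSum (fun n => s n ^ 2 * ‖inner ℂ (e n) f‖ ^ 2) (‖T f‖ ^ 2) := by
  have h1 : Filter.Tendsto (fun F : Finset ℕ =>
      ‖∑ n ∈ F, ((s n : ℂ) * inner ℂ (e n) f) • u n‖ ^ 2) Filter.atTop (nhds (‖T f‖ ^ 2)) :=
    (Filter.Tendsto.norm (h.hasSum f)).pow 2
  have h2 : ∀ F : Finset ℕ, ‖∑ n ∈ F, ((s n : ℂ) * inner ℂ (e n) f) • u n‖ ^ 2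
      = ∑ n ∈ F, s n ^ 2 * ‖inner ℂ (e n) f‖ ^ 2 := by
    intro F
    have h3 := h.orthonormal_right.inner_sum (fun n => (s n : ℂ) * inner ℂ (e n) f)
      (fun n => (s n : ℂ) * inner ℂ (e n) f) F
    have h5 : ∀ x : H, inner ℂ x x = ((‖x‖ ^ 2 : ℝ) : ℂ) := fun x => by
      rw [inner_self_eq_norm_sq_to_K]; norm_cast
    rw [h5] at h3
    have h4 : ∀ n, conj ((s n : ℂ) * inner ℂ (e n) f) * ((s n : ℂ) * inner ℂ (e n) f)
        = ((s n ^ 2 * ‖inner ℂ (e n) f‖ ^ 2 : ℝ) : ℂ) := by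
      intro n
      rw [Complex.conj_mul', norm_mul, Complex.norm_real, Real.norm_of_nonneg (h.nonneg n)]
      push_cast
      ring
    simp only [h4] at h3
    rw [← Complex.ofReal_sum] at h3
    exact Complex.ofReal_injective h3
  simp only [h2] at h1
  exact h1

theorem norm_apply_left (h : IsSchmidtDecomposition T e u s) (m : ℕ) : ‖T (e m)‖ = s m := by
  have h1 := h.hasSum_norm_sq (e m)
  have h2 : HasSum (fun n => s n ^ 2 * ‖inner ℂ (e n) (e m)‖ ^ 2) (s m ^ 2) := by
    convert hasSum_ite_eq m (s m ^ 2) using 2 with n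
    rw [orthonormal_iff_ite.1 h.orthonormal_left n m]
    split_ifs with hn
    · rw [hn]; simp
    · simp
  have h3 := h1.unique h2
  exact (pow_left_inj₀ (norm_nonneg _) (h.nonneg m) two_ne_zero).1 h3

/-- The minimax principle: on a subspace of dimension `card ι` where `T` is bounded below by `t`,
at least `card ι` singular values are bounded below by a multiple of `t`. -/
theorem card_le_encard (h : IsSchmidtDecomposition T e u s) {ι : Type*} [Fintype ι]
    {V : (ι → ℂ) →ₗ[ℂ] H} {c t : ℝ} (hc : 0 < c) (ht : 0 < t)
    (hV : ∀ a, ‖V a‖ ^ 2 ≤ c ^ 2 * ∑ i, ‖a i‖ ^ 2)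
    (hT : ∀ a, t ^ 2 * ∑ i, ‖a i‖ ^ 2 ≤ ‖T (V a)‖ ^ 2) :
    (Fintype.card ι : ℕ∞) ≤ {n | t < 2 * c * s n}.encard := by
  set S := {n | t < 2 * c * s n} with hS
  by_contra hlt
  rw [not_le] at hlt
  have hfin : S.Finite := Set.encard_lt_top_iff.1 (hlt.trans_le le_top)
  have : Fintype S := hfin.fintype
  -- a vector of the subspace orthogonal to the corresponding singular vectors
  set L : (ι → ℂ) →ₗ[ℂ] (S → ℂ) :=
    LinearMap.pi fun n => (innerSL ℂ (e n)).toLinearMap ∘ₗ V with hL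
  have hdim : Module.finrank ℂ (S → ℂ) < Module.finrank ℂ (ι → ℂ) := by
    rw [Module.finrank_fintype_fun_eq_card, Module.finrank_fintype_fun_eq_card]
    rw [← Set.coe_fintypeCard] at hlt
    exact_mod_cast hlt
  have hker := L.ker_ne_bot_of_finrank_lt hdim
  obtain ⟨a, ha, ha0⟩ := Submodule.exists_mem_ne_zero_of_ne_bot hker
  have hin : ∀ n ∈ S, inner ℂ (e n) (V a) = 0 := fun n hn => by
    have := congrFun (LinearMap.mem_ker.1 ha) ⟨n, hn⟩
    simpa [hL] using this
  have hpos : 0 < ∑ i, ‖a i‖ ^ 2 := by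
    obtain ⟨i, hi⟩ := Function.ne_iff.1 ha0
    refine Finset.sum_pos' (fun i _ => by positivity) ⟨i, Finset.mem_univ _, ?_⟩
    have : 0 < ‖a i‖ := norm_pos_iff.2 hi
    positivity
  have h1 := h.hasSum_norm_sq (V a)
  have hbes : ∑' n, ‖inner ℂ (e n) (V a)‖ ^ 2 ≤ ‖V a‖ ^ 2 :=
    h.orthonormal_left.tsum_inner_products_le _
  have hsum := h.orthonormal_left.inner_products_summable (V a)
  have h2 : ‖T (V a)‖ ^ 2 ≤ (t / (2 * c)) ^ 2 * ‖V a‖ ^ 2 := by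
    refine le_trans ?_ (mul_le_mul_of_nonneg_left hbes (by positivity))
    rw [← tsum_mul_left]
    refine hasSum_le (fun n => ?_) h1 (hsum.mul_left _).hasSum
    by_cases hn : n ∈ S
    · rw [hin n hn]; simp
    · have hsn : s n ≤ t / (2 * c) := by
        rw [le_div_iff₀ (by positivity)]
        have : ¬ t < 2 * c * s n := hn
        linarith
      have := h.nonneg n
      gcongr
  have h3 := hT a
  have h4 := hV a
  have h5 : (t / (2 * c)) ^ 2 * ‖V a‖ ^ 2 ≤ (t / (2 * c)) ^ 2 * (c ^ 2 * ∑ i, ‖a i‖ ^ 2) := by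
    gcongr
  have h6 : (t / (2 * c)) ^ 2 * (c ^ 2 * ∑ i, ‖a i‖ ^ 2) = t ^ 2 / 4 * ∑ i, ‖a i‖ ^ 2 := by
    field_simp
    ring
  nlinarith [mul_pos (pow_pos ht 2) hpos]

end IsSchmidtDecomposition

/-- Layer cake: if the counting functions of two families of numbers are comparable, then so are
the sums of their `p`-th powers. -/
theorem sum_rpow_le_tsum_rpow {ι : Type*} (F : Finset ι) {m : ι → ℝ} (hm : ∀ i, 0 ≤ m i)
    {s : ℕ → ℝ} (hs : ∀ n, 0 ≤ s n) {p : ℝ} (hp : 0 < p)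
    (h : ∀ t > 0, ((F.filter fun i => t < m i).card : ℕ∞) ≤ {n | t < s n}.encard) :
    ∑ i ∈ F, ENNReal.ofReal (m i ^ p) ≤ ∑' n, ENNReal.ofReal (s n ^ p) := by
  let _ : MeasurableSpace ι := ⊤
  have h1 := lintegral_rpow_eq_lintegral_meas_lt_mul
    (μ := (Measure.count : Measure F)) (f := fun i => m i)
    (Filter.Eventually.of_forall fun i => hm i) (Measurable.of_discrete).aemeasurable hp
  have h2 := lintegral_rpow_eq_lintegral_meas_lt_mul (μ := (Measure.count : Measure ℕ)) (f := s)
    (Filter.Eventually.of_forall hs) (Measurable.of_discrete).aemeasurable hp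
  rw [lintegral_count] at h1 h2
  rw [← Finset.tsum_subtype F fun i => ENNReal.ofReal (m i ^ p)]
  rw [h1, h2]
  refine mul_le_mul_right ?_ _
  refine setLIntegral_mono_ae' measurableSet_Ioi (Filter.Eventually.of_forall fun t ht => ?_)
  refine mul_le_mul_left ?_ _
  rw [Measure.count_apply MeasurableSet.of_discrete, Measure.count_apply MeasurableSet.of_discrete]
  have h3 : {a : F | t < m a}.encard = (F.filter fun i => t < m i).card := by
    rw [← Set.encard_coe_eq_coe_finsetCard, ← Subtype.val_injective.encard_image]
    congr 1
    ext i
    simp [and_comm]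
  rw [h3]
  exact_mod_cast h t ht

theorem exists_infinite_orthonormal_extension [CompleteSpace H] (hH : ¬ FiniteDimensional ℂ H)
    {ι : Type*} [Finite ι] {e : ι → H} (he : Orthonormal ℂ e) :
    ∃ g : ℕ → H, Orthonormal ℂ (Sum.elim e g) := by
  obtain ⟨w, b, hw, hb⟩ := he.toSubtypeRange.exists_hilbertBasis_extension
  have hwi : w.Infinite := by
    intro hfin
    have := hfin.fintype
    exact hH b.toOrthonormalBasis.toBasis.finiteDimensional_of_finite
  have hdi : (w \ Set.range e).Infinite := hwi.sdiff (Set.finite_range e)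
  set g := hdi.natEmbedding
  refine ⟨fun n => g n, ?_⟩
  have hmem : ∀ i : ι ⊕ ℕ, Sum.elim e (fun n => (g n : H)) i ∈ w := by
    rintro (i | n)
    · exact hw ⟨i, rfl⟩
    · exact (g n).2.1
  have hinj : Function.Injective fun i : ι ⊕ ℕ => (⟨_, hmem i⟩ : w) := by
    rintro (i | n) (j | m) hij
    · simp only [Subtype.mk.injEq, Sum.elim_inl] at hij
      rw [he.linearIndependent.injective hij]
    · simp only [Subtype.mk.injEq, Sum.elim_inl, Sum.elim_inr] at hij
      exact absurd ⟨i, hij⟩ (g m).2.2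
    · simp only [Subtype.mk.injEq, Sum.elim_inl, Sum.elim_inr] at hij
      exact absurd ⟨j, hij.symm⟩ (g n).2.2
    · simp only [Subtype.mk.injEq, Sum.elim_inr] at hij
      rw [g.injective (Subtype.ext hij)]
  have := b.orthonormal.comp _ hinj
  rw [hb] at this
  exact this

/-- A Schmidt decomposition indexed by a countable type gives one indexed by `ℕ`: the orthonormal
families are extended by singular values `0` where necessary. -/
theorem exists_schmidt_of_countable [CompleteSpace H] (hH : ¬ FiniteDimensional ℂ H)
    {ι : Type*} [Countable ι] {T : H →L[ℂ] H} {e u : ι → H} {s : ι → ℝ} (he : Orthonormal ℂ e)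
    (hu : Orthonormal ℂ u) (hs : ∀ i, 0 ≤ s i)
    (hT : ∀ f, HasSum (fun i => ((s i : ℂ) * inner ℂ (e i) f) • u i) (T f)) :
    ∃ (e' u' : ℕ → H) (s' : ℕ → ℝ), IsSchmidtDecomposition T e' u' s' ∧
      ∀ p : ℝ, 0 < p → Summable (fun i => s i ^ p) → Summable (fun n => s' n ^ p) := by
  rcases finite_or_infinite ι with hι | hι
  · obtain ⟨g, hg⟩ := exists_infinite_orthonormal_extension hH he
    obtain ⟨k, hk⟩ := exists_infinite_orthonormal_extension hH hu
    obtain ⟨φ⟩ : Nonempty (ℕ ≃ ι ⊕ ℕ) := nonempty_equiv_of_countable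
    refine ⟨Sum.elim e g ∘ φ, Sum.elim u k ∘ φ, Sum.elim s (fun _ => 0) ∘ φ,
      ⟨hg.comp _ φ.injective, hk.comp _ φ.injective, fun n => ?_, fun f => ?_⟩, fun p hp _ => ?_⟩
    · rcases h : φ n with i | m <;> simp [h, hs]
    · have h1 : HasSum (fun x : ι ⊕ ℕ => ((Sum.elim s (fun _ => 0) x : ℝ) *
          inner ℂ (Sum.elim e g x) f) • Sum.elim u k x) (T f) := by
        rw [← (Sum.inl_injective (α := ι) (β := ℕ)).hasSum_iff]
        · exact hT f
        · rintro (i | m) hx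
          · exact absurd ⟨i, rfl⟩ hx
          · simp
      exact φ.hasSum_iff.2 h1
    · have h1 : Summable (fun x : ι ⊕ ℕ => (Sum.elim s (fun _ => (0 : ℝ)) x) ^ p) := by
        rw [← (Sum.inl_injective (α := ι) (β := ℕ)).summable_iff]
        · exact Summable.of_finite
        · rintro (i | m) hx
          · exact absurd ⟨i, rfl⟩ hx
          · simp [Real.zero_rpow hp.ne']
      have h2 := (Equiv.summable_iff (f := fun x : ι ⊕ ℕ =>
        (Sum.elim s (fun _ => (0 : ℝ)) x) ^ p) φ).2 h1
      simpa only [Function.comp_def] using h2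
  · obtain ⟨φ⟩ : Nonempty (ℕ ≃ ι) := nonempty_equiv_of_countable
    refine ⟨e ∘ φ, u ∘ φ, s ∘ φ, ⟨he.comp _ φ.injective, hu.comp _ φ.injective, fun n => hs _,
      fun f => ?_⟩, fun p _ h => ?_⟩
    · exact (Equiv.hasSum_iff (f := fun i => ((s i : ℂ) * inner ℂ (e i) f) • u i) φ).2 (hT f)
    have h2 := (Equiv.summable_iff (f := fun i => s i ^ p) φ).2 h
    simpa only [Function.comp_def] using h2

/-- Schmidt decomposition of a compact operator, from the spectral theorem for `T* T`. -/
theorem exists_schmidt_of_isCompactOperator [CompleteSpace H]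
    [TopologicalSpace.SeparableSpace H] (hH : ¬ FiniteDimensional ℂ H) {T : H →L[ℂ] H}
    (hT : IsCompactOperator T) :
    ∃ (e u : ℕ → H) (s : ℕ → ℝ), IsSchmidtDecomposition T e u s := by
  set A : H →L[ℂ] H := T.adjoint ∘L T with hA
  have hAc : IsCompactOperator A := hT.clm_comp T.adjoint
  have hin : ∀ x y, inner ℂ (A x) y = inner ℂ (T x) (T y) := fun x y => by
    rw [hA, ContinuousLinearMap.comp_apply, ContinuousLinearMap.adjoint_inner_left]
  have hAs : A.IsSymmetric := fun x y => by
    change inner ℂ (A x) y = inner ℂ x (A y)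
    rw [hin, ← inner_conj_symm x (A y), hin, inner_conj_symm]
  have hspec := ContinuousLinearMap.orthogonalComplement_iSup_eigenspaces_eq_bot hAc hAs
  have hfd : ∀ μ : {μ : ℂ // μ ≠ 0},
      FiniteDimensional ℂ (Module.End.eigenspace A.toLinearMap (μ : ℂ)) := fun μ =>
    ContinuousLinearMap.finite_dimensional_eigenspace hAc μ μ.2
  let b := fun μ : {μ : ℂ // μ ≠ 0} =>
    stdOrthonormalBasis ℂ (Module.End.eigenspace A.toLinearMap (μ : ℂ))
  let ι := Σ μ : {μ : ℂ // μ ≠ 0},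
    Fin (Module.finrank ℂ (Module.End.eigenspace A.toLinearMap (μ : ℂ)))
  let e : ι → H := fun i => b i.1 i.2
  have he : Orthonormal ℂ e :=
    (hAs.orthogonalFamily_eigenspaces.comp Subtype.coe_injective).orthonormal_sigma_orthonormal
      (fun μ => (b μ).orthonormal)
  have heA : ∀ i : ι, A (e i) = (i.1 : ℂ) • e i := fun i =>
    Module.End.mem_eigenspace_iff.1 (b i.1 i.2).2
  have hTT : ∀ i j : ι, inner ℂ (T (e i)) (T (e j)) = conj (i.1 : ℂ) * inner ℂ (e i) (e j) :=
    fun i j => by rw [← hin, heA, inner_smul_left]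
  set s : ι → ℝ := fun i => ‖T (e i)‖ with hs
  have hs2 : ∀ i : ι, conj (i.1 : ℂ) = ((s i ^ 2 : ℝ) : ℂ) := by
    intro i
    have h1 := hTT i i
    have h5 : ∀ x : H, inner ℂ x x = ((‖x‖ ^ 2 : ℝ) : ℂ) := fun x => by
      rw [inner_self_eq_norm_sq_to_K]; norm_cast
    rw [h5, h5, he.1 i] at h1
    simp only [one_pow, Complex.ofReal_one, mul_one] at h1
    exact h1.symm
  have hs0 : ∀ i : ι, s i ≠ 0 := by
    intro i h0
    have h1 := hs2 i
    rw [h0] at h1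
    simp only [ne_eq, OfNat.ofNat_ne_zero, not_false_eq_true, zero_pow, Complex.ofReal_zero,
      map_eq_zero] at h1
    exact i.1.2 h1
  set u : ι → H := fun i => ((s i)⁻¹ : ℂ) • T (e i) with hu'
  have hu : Orthonormal ℂ u := by
    rw [orthonormal_iff_ite]
    intro i j
    rw [hu']
    simp only
    rw [inner_smul_left, inner_smul_right, hTT, orthonormal_iff_ite.1 he i j, hs2]
    split_ifs with hij
    · subst hij
      have : (s i : ℂ) ≠ 0 := Complex.ofReal_ne_zero.2 (hs0 i)
      rw [map_inv₀, Complex.conj_ofReal]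
      push_cast
      field_simp
    · simp
  -- `T` vanishes on the orthogonal complement of the `e i`
  have hker : ∀ f, (∀ i, inner ℂ (e i) f = 0) → T f = 0 := by
    intro f hf
    have hμ : ∀ μ : {μ : ℂ // μ ≠ 0}, ∀ x ∈ Module.End.eigenspace A.toLinearMap (μ : ℂ),
        inner ℂ x f = 0 := by
      intro μ x hx
      have h1 := (b μ).sum_repr ⟨x, hx⟩
      have h2 : x = ∑ i, (b μ).repr ⟨x, hx⟩ i • e ⟨μ, i⟩ := by
        have := congrArg (Subtype.val) h1
        simpa using this.symm
      rw [h2, sum_inner]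
      refine Finset.sum_eq_zero fun i _ => ?_
      rw [inner_smul_left, hf, mul_zero]
    have hAf : A f = 0 := by
      have h1 : A f ∈ (⨆ μ, Module.End.eigenspace (A : Module.End ℂ H) μ)ᗮ := by
        rw [Submodule.mem_orthogonal]
        intro x hx
        refine Submodule.iSup_induction _ (motive := fun x => inner ℂ x (A f) = 0) hx ?_ ?_ ?_
        · intro μ x hx
          have h2 : inner ℂ x (A f) = inner ℂ (A x) f := (hAs x f).symm
          have h3 : A x = μ • x := Module.End.mem_eigenspace_iff.1 hx
          rw [h2, h3, inner_smul_left]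
          by_cases h0 : μ = 0
          · simp [h0]
          · rw [hμ ⟨μ, h0⟩ x hx, mul_zero]
        · simp
        · intro x y hx hy
          rw [inner_add_left, hx, hy, add_zero]
      rw [hspec] at h1
      exact (Submodule.mem_bot ℂ).1 h1
    have h4 := hin f f
    rw [hAf, inner_zero_left] at h4
    exact inner_self_eq_zero.1 h4.symm
  have hsum : ∀ f, HasSum (fun i => ((s i : ℂ) * inner ℂ (e i) f) • u i) (T f) := by
    intro f
    classical
    obtain ⟨w, B, hw, hB⟩ := he.toSubtypeRange.exists_hilbertBasis_extension
    have h1 := (B.hasSum_repr f).mapL T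
    have hinj : Function.Injective fun i : ι => (⟨e i, hw ⟨i, rfl⟩⟩ : w) := by
      intro i j hij
      exact he.linearIndependent.injective (congrArg Subtype.val hij)
    have h2 := (hinj.hasSum_iff (f := fun x : w => T (B.repr f x • B x)) ?_).2 h1
    · convert h2 using 2 with i
      simp only [Function.comp_apply]
      rw [map_smul, HilbertBasis.repr_apply_apply, hB, hu']
      simp only
      rw [smul_smul]
      congr 1
      have : (s i : ℂ) ≠ 0 := Complex.ofReal_ne_zero.2 (hs0 i)
      field_simp
    · intro x hx
      rw [map_smul]
      have : T (B x) = 0 := by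
        refine hker _ fun i => ?_
        have h3 := orthonormal_iff_ite.1 B.orthonormal ⟨e i, hw ⟨i, rfl⟩⟩ x
        have h4 : (⟨e i, hw ⟨i, rfl⟩⟩ : w) ≠ x := fun h => hx ⟨i, h⟩
        rw [if_neg h4, hB] at h3
        rw [hB]
        exact h3
      rw [this, smul_zero]
  have hc : Countable ι := by
    have hdisj : (Set.univ : Set ι).PairwiseDisjoint fun i => Metric.ball (e i) (1 / 2) := by
      intro i _ j _ hij
      refine Metric.ball_disjoint_ball ?_
      have h1 : ‖e i - e j‖ ^ 2 = 2 := by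
        rw [@norm_sub_sq ℂ, he.1 i, he.1 j, he.2 hij]
        norm_num
      rw [dist_eq_norm]
      nlinarith [norm_nonneg (e i - e j)]
    exact Set.countable_univ_iff.1 (hdisj.countable_of_isOpen (fun i _ => Metric.isOpen_ball)
      fun i _ => ⟨e i, by simp⟩)
  obtain ⟨e', u', s', h, -⟩ := exists_schmidt_of_countable hH he hu (fun i => norm_nonneg _) hsum
  exact ⟨e', u', s', h⟩

end Schatten

/-! ### Carleson embeddings: upper estimates -/

/-- The form `∫ |f'|² dμ` of the embedding `f ↦ f'` into `L²(μ)`. -/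
noncomputable def derivForm (μ : Measure ℂ) (f : ℂ → ℂ) : ℝ≥0∞ :=
  ∫⁻ ζ, ENNReal.ofReal (‖deriv f ζ‖ ^ 2) ∂μ

/-- The Berezin type transform `(|w|+1)² ∫ |k_w|² dμ` of a measure. -/
noncomputable def berezinOf (α : ℝ) (μ : Measure ℂ) (w : ℂ) : ℝ≥0∞ :=
  ∫⁻ ζ, ENNReal.ofReal ((‖w‖ + 1) ^ 2 * ‖normKernel α w ζ‖ ^ 2) ∂μ

theorem measurable_kernel_weight (α : ℝ) : Measurable fun q : ℂ × ℂ =>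
    ENNReal.ofReal ((‖q.1‖ + 1) ^ 2 * ‖normKernel α q.1 q.2‖ ^ 2) := by
  have := continuous_normKernel α
  exact (Continuous.measurable (by fun_prop)).ennreal_ofReal

theorem measurable_berezinOf (α : ℝ) (μ : Measure ℂ) [SFinite μ] : Measurable (berezinOf α μ) :=
  (measurable_kernel_weight α).lintegral_prod_right'

/-- The embedding is dominated by the Toeplitz operator whose symbol is the Berezin transform. -/
theorem exists_derivForm_le {α : ℝ} (hα : 0 < α) :
    ∃ C : ℝ≥0, ∀ (μ : Measure ℂ) [SFinite μ] (f : ℂ → ℂ), Differentiable ℂ f →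
      derivForm μ f ≤ C * ∫⁻ w, berezinOf α μ w * ENNReal.ofReal (fockDensity α f w) := by
  obtain ⟨C, hC⟩ := exists_norm_deriv_sq_le_lintegral_kernel hα
  refine ⟨C, fun μ _ f hf => ?_⟩
  have hm := measurable_fockDensity (α := α) hf.continuous
  calc derivForm μ f
      ≤ ∫⁻ ζ, (C * ∫⁻ w, ENNReal.ofReal ((‖w‖ + 1) ^ 2 * ‖normKernel α w ζ‖ ^ 2) *
          ENNReal.ofReal (fockDensity α f w)) ∂μ := lintegral_mono fun ζ => hC f hf ζ
    _ = C * ∫⁻ w, ∫⁻ ζ, ENNReal.ofReal ((‖w‖ + 1) ^ 2 * ‖normKernel α w ζ‖ ^ 2) *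
          ENNReal.ofReal (fockDensity α f w) ∂μ := by
        rw [lintegral_const_mul' _ _ ENNReal.coe_ne_top, lintegral_lintegral_swap]
        exact (((measurable_kernel_weight α).comp measurable_swap).mul
          (hm.comp measurable_snd)).aemeasurable
    _ = _ := by
        congr 1
        refine lintegral_congr fun w => ?_
        rw [lintegral_mul_const' _ _ ENNReal.ofReal_ne_top, berezinOf]

theorem derivForm_normKernel_le (α : ℝ) (μ : Measure ℂ) (w : ℂ) :
    derivForm μ (normKernel α w) ≤ ENNReal.ofReal (α ^ 2) * berezinOf α μ w := by
  rw [derivForm, berezinOf, ← lintegral_const_mul' _ _ ENNReal.ofReal_ne_top]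
  refine lintegral_mono fun ζ => ?_
  rw [← ENNReal.ofReal_mul (by positivity)]
  refine ENNReal.ofReal_le_ofReal ?_
  rw [deriv_normKernel, norm_mul, norm_mul, Complex.norm_real, RCLike.norm_conj, mul_pow, mul_pow,
    Real.norm_eq_abs, sq_abs, mul_assoc]
  gcongr
  linarith

/-- Jensen's inequality for measures of mass at most one. -/
theorem lintegral_rpow_le_of_measure_univ_le_one {X : Type*} [MeasurableSpace X] {ν : Measure X}
    (hν : ν Set.univ ≤ 1) {f : X → ℝ≥0∞} (hf : Measurable f) {r : ℝ} (hr : 1 ≤ r) :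
    (∫⁻ x, f x ∂ν) ^ r ≤ ∫⁻ x, f x ^ r ∂ν := by
  have hr0 : 0 < r := one_pos.trans_le hr
  have h := eLpNorm'_le_eLpNorm'_mul_rpow_measure_univ one_pos hr
    hf.aestronglyMeasurable (μ := ν)
  have h1 : ν Set.univ ^ (1 / (1 : ℝ) - 1 / r) ≤ 1 := by
    refine ENNReal.rpow_le_one hν ?_
    rw [sub_nonneg, div_one, div_le_one hr0]
    exact hr
  have h2 := h.trans (mul_le_of_le_one_right zero_le h1)
  simp only [eLpNorm', enorm_eq_self, ENNReal.rpow_one, div_one] at h2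
  calc (∫⁻ x, f x ∂ν) ^ r ≤ ((∫⁻ x, f x ^ r ∂ν) ^ (1 / r)) ^ r := by gcongr
    _ = _ := by
      rw [← ENNReal.rpow_mul, one_div, inv_mul_cancel₀ hr0.ne', ENNReal.rpow_one]

theorem tsum_mul_rpow_le {x c : ℕ → ℝ≥0∞} (hc : ∑' n, c n ≤ 1) {q : ℝ} (hq0 : 0 < q)
    (hq : q ≤ 1) : ∑' n, c n * x n ^ q ≤ (∑' n, c n * x n) ^ q := by
  set ν : Measure ℕ := Measure.count.withDensity c
  have hν : ∀ f : ℕ → ℝ≥0∞, ∫⁻ n, f n ∂ν = ∑' n, c n * f n := fun f => by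
    rw [lintegral_withDensity_eq_lintegral_mul _ Measurable.of_discrete Measurable.of_discrete,
      lintegral_count]
    rfl
  have hu : ν Set.univ ≤ 1 := by
    have := hν fun _ => 1
    rw [lintegral_one] at this
    simpa [this] using hc
  have h := lintegral_rpow_le_of_measure_univ_le_one hu (f := fun n => x n ^ q)
    Measurable.of_discrete (r := q⁻¹) ((one_le_inv₀ hq0).2 hq)
  simp only [hν, ← ENNReal.rpow_mul, mul_inv_cancel₀ hq0.ne', ENNReal.rpow_one] at h
  rwa [ENNReal.rpow_inv_le_iff hq0] at h

namespace FockSpace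

variable {α : ℝ} [hα : Fact (0 < α)]

theorem lintegral_fockDensity_of_norm_eq_one {f : FockSpace α} (hf : ‖f‖ = 1) :
    ENNReal.ofReal (α / Real.pi) * ∫⁻ z, ENNReal.ofReal (fockDensity α f z) = 1 := by
  rw [← ofReal_norm_sq, hf]
  simp

instance : TopologicalSpace.SeparableSpace (FockSpace α) := by
  set K : Submodule ℂ (FockSpace α) :=
    Submodule.span ℂ (Set.range fun n => kernel α (TopologicalSpace.denseSeq ℂ n)) with hK
  have h1 : Kᗮ = ⊥ := by
    rw [Submodule.eq_bot_iff]
    intro f hf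
    have h2 : ∀ n, f (TopologicalSpace.denseSeq ℂ n) = 0 := fun n => by
      have h3 := (Submodule.mem_orthogonal K f).1 hf _ (Submodule.subset_span ⟨n, rfl⟩)
      rw [inner_kernel] at h3
      exact (mul_eq_zero.1 h3).resolve_right (Complex.exp_ne_zero _)
    refine DFunLike.ext _ _ fun z => ?_
    have h4 : (f : ℂ → ℂ) = fun _ => 0 :=
      Continuous.ext_on (TopologicalSpace.denseRange_denseSeq ℂ) f.differentiable.continuous
        continuous_const (by rintro _ ⟨n, rfl⟩; exact h2 n)
    rw [h4]; rfl
  have h2 : K.topologicalClosure = ⊤ := Submodule.topologicalClosure_eq_top_iff.2 h1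
  have h3 : TopologicalSpace.IsSeparable (K : Set (FockSpace α)) :=
    (Set.countable_range _).isSeparable.span
  have h4 := h3.closure
  rw [← Submodule.topologicalClosure_coe, h2] at h4
  exact TopologicalSpace.isSeparable_univ_iff.1 h4

/-- Upper estimate of the singular values of an operator dominated by an embedding `f ↦ f'`. -/
theorem exists_tsum_rpow_le_berezinOf (α : ℝ) [Fact (0 < α)] {p : ℝ} (hp : 0 < p) :
    ∃ K : ℝ≥0, ∀ (μ : Measure ℂ) [SFinite μ] (T : FockSpace α →L[ℂ] FockSpace α) (D : ℝ≥0)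
      (e u : ℕ → FockSpace α) (s : ℕ → ℝ), IsSchmidtDecomposition T e u s →
      (∀ f : FockSpace α, ENNReal.ofReal (‖T f‖ ^ 2) ≤ D * derivForm μ f) →
      ∑' n, ENNReal.ofReal (s n ^ p) ≤
        K * (D : ℝ≥0∞) ^ (p / 2) * ∫⁻ w, berezinOf α μ w ^ (p / 2) := by
  have h0 : 0 < α := Fact.out
  have hq0 : 0 < p / 2 := by positivity
  have hsp : ∀ x : ℝ, 0 ≤ x → ENNReal.ofReal (x ^ p) = ENNReal.ofReal (x ^ 2) ^ (p / 2) := by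
    intro x hx
    rw [ENNReal.ofReal_rpow_of_nonneg (by positivity) hq0.le, ← Real.rpow_natCast,
      ← Real.rpow_mul hx]
    congr 2
    push_cast
    ring
  have hmd : ∀ f : FockSpace α, Measurable fun w => ENNReal.ofReal (fockDensity α f w) := fun f =>
    measurable_fockDensity f.differentiable.continuous
  rcases le_total (p / 2) 1 with hq | hq
  · -- `x ↦ x ^ (p / 2)` is concave: Jensen's inequality in the sum over the singular values
    refine ⟨(α / Real.pi).toNNReal * ((α ^ 2).toNNReal ^ (p / 2)),
      fun μ _ T D e u s hT hD => ?_⟩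
    have hpt : ∀ w : ℂ, ∑' n, ENNReal.ofReal (fockDensity α (e n) w) * ENNReal.ofReal (s n ^ p) ≤
        (D * (ENNReal.ofReal (α ^ 2) * berezinOf α μ w)) ^ (p / 2) := by
      intro w
      simp only [hsp _ (hT.nonneg _)]
      refine (tsum_mul_rpow_le (tsum_fockDensity_le hT.orthonormal_left w) hq0 hq).trans ?_
      gcongr
      have h1 := hT.hasSum_norm_sq (kernel α w)
      have h2 : ∑' n, ENNReal.ofReal (fockDensity α (e n) w) * ENNReal.ofReal (s n ^ 2)
          = ENNReal.ofReal (‖T (kernel α w)‖ ^ 2) := by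
        rw [← h1.tsum_eq, ENNReal.ofReal_tsum_of_nonneg (fun n => by positivity) h1.summable]
        refine tsum_congr fun n => ?_
        rw [← ENNReal.ofReal_mul (fockDensity_nonneg _ _ _), mul_comm, norm_inner_symm,
          norm_inner_kernel_sq]
      rw [h2]
      refine (hD _).trans ?_
      gcongr
      exact derivForm_normKernel_le α μ w
    calc ∑' n, ENNReal.ofReal (s n ^ p)
        = ∑' n, ENNReal.ofReal (α / Real.pi) *
            ∫⁻ w, ENNReal.ofReal (fockDensity α (e n) w) * ENNReal.ofReal (s n ^ p) := by
          refine tsum_congr fun n => ?_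
          rw [lintegral_mul_const' _ _ ENNReal.ofReal_ne_top, ← mul_assoc,
            lintegral_fockDensity_of_norm_eq_one (hT.orthonormal_left.1 n), one_mul]
      _ = ENNReal.ofReal (α / Real.pi) *
            ∫⁻ w, ∑' n, ENNReal.ofReal (fockDensity α (e n) w) * ENNReal.ofReal (s n ^ p) := by
          rw [ENNReal.tsum_mul_left, lintegral_tsum]
          exact fun n => ((hmd (e n)).mul_const _).aemeasurable
      _ ≤ ENNReal.ofReal (α / Real.pi) *
            ∫⁻ w, (D * (ENNReal.ofReal (α ^ 2) * berezinOf α μ w)) ^ (p / 2) :=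
          mul_le_mul_right (lintegral_mono hpt) _
      _ = _ := by
          simp only [ENNReal.mul_rpow_of_nonneg _ _ hq0.le]
          rw [lintegral_const_mul' _ _ (by finiteness), lintegral_const_mul' _ _ (by finiteness),
            ENNReal.coe_mul, ENNReal.coe_rpow_of_nonneg _ hq0.le]
          change _ = ENNReal.ofReal _ * ENNReal.ofReal _ ^ (p / 2) * _ * _
          ring
  · -- `x ↦ x ^ (p / 2)` is convex: Jensen's inequality for the measures
    -- `(α/π) |eₙ|² e^{-α|z|²} dm`
    obtain ⟨C, hC⟩ := exists_derivForm_le h0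
    refine ⟨(α / Real.pi).toNNReal * (C * (Real.pi / α).toNNReal) ^ (p / 2),
      fun μ _ T D e u s hT hD => ?_⟩
    have hB := measurable_berezinOf α μ
    have hpt : ∀ n, ENNReal.ofReal (s n ^ p) ≤ (D * (C * ENNReal.ofReal (Real.pi / α))) ^ (p / 2) *
        (ENNReal.ofReal (α / Real.pi) *
          ∫⁻ w, ENNReal.ofReal (fockDensity α (e n) w) * berezinOf α μ w ^ (p / 2)) := by
      intro n
      set c : ℂ → ℝ≥0∞ := fun w =>
        ENNReal.ofReal (α / Real.pi) * ENNReal.ofReal (fockDensity α (e n) w) with hc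
      have hcm : Measurable c := (hmd (e n)).const_mul _
      have hν : (volume.withDensity c) Set.univ ≤ 1 := by
        rw [withDensity_apply _ MeasurableSet.univ, setLIntegral_univ,
          lintegral_const_mul' _ _ ENNReal.ofReal_ne_top,
          lintegral_fockDensity_of_norm_eq_one (hT.orthonormal_left.1 n)]
      have hJ := lintegral_rpow_le_of_measure_univ_le_one hν hB hq
      rw [lintegral_withDensity_eq_lintegral_mul _ hcm hB,
        lintegral_withDensity_eq_lintegral_mul _ hcm (hB.pow_const _)] at hJ
      have h1 : ENNReal.ofReal (s n ^ 2) ≤ (D * (C * ENNReal.ofReal (Real.pi / α))) *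
          ∫⁻ w, (c * berezinOf α μ) w := by
        have h2 := hD (e n)
        rw [hT.norm_apply_left] at h2
        refine h2.trans ?_
        rw [mul_assoc]
        gcongr
        refine (hC μ (e n) (e n).differentiable).trans (le_of_eq ?_)
        rw [mul_assoc, ← lintegral_const_mul' _ _ ENNReal.ofReal_ne_top]
        congr 1
        refine lintegral_congr fun w => ?_
        have h3 : ENNReal.ofReal (Real.pi / α) * ENNReal.ofReal (α / Real.pi) = 1 := by
          rw [← ENNReal.ofReal_mul (by positivity)]
          have : Real.pi / α * (α / Real.pi) = 1 := by field_simp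
          rw [this, ENNReal.ofReal_one]
        rw [hc, Pi.mul_apply, ← mul_assoc, ← mul_assoc, h3, one_mul, mul_comm]
      rw [hsp _ (hT.nonneg n)]
      calc ENNReal.ofReal (s n ^ 2) ^ (p / 2)
          ≤ ((D * (C * ENNReal.ofReal (Real.pi / α))) * ∫⁻ w, (c * berezinOf α μ) w) ^ (p / 2) := by
            gcongr
        _ = (D * (C * ENNReal.ofReal (Real.pi / α))) ^ (p / 2) *
              (∫⁻ w, (c * berezinOf α μ) w) ^ (p / 2) := ENNReal.mul_rpow_of_nonneg _ _ hq0.le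
        _ ≤ (D * (C * ENNReal.ofReal (Real.pi / α))) ^ (p / 2) *
              ∫⁻ w, (c * fun w => berezinOf α μ w ^ (p / 2)) w := by gcongr
        _ = _ := by
            rw [← lintegral_const_mul' _ _ ENNReal.ofReal_ne_top]
            congr 1
            refine lintegral_congr fun w => ?_
            rw [hc, Pi.mul_apply, mul_assoc]
    calc ∑' n, ENNReal.ofReal (s n ^ p)
        ≤ ∑' n, (D * (C * ENNReal.ofReal (Real.pi / α))) ^ (p / 2) *
        (ENNReal.ofReal (α / Real.pi) *
          ∫⁻ w, ENNReal.ofReal (fockDensity α (e n) w) * berezinOf α μ w ^ (p / 2)) :=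
          ENNReal.tsum_le_tsum hpt
      _ = (D * (C * ENNReal.ofReal (Real.pi / α))) ^ (p / 2) * (ENNReal.ofReal (α / Real.pi) *
          ∫⁻ w, (∑' n, ENNReal.ofReal (fockDensity α (e n) w)) * berezinOf α μ w ^ (p / 2)) := by
          rw [ENNReal.tsum_mul_left, ENNReal.tsum_mul_left, ← lintegral_tsum]
          · simp only [ENNReal.tsum_mul_right]
          · exact fun n => ((hmd (e n)).mul (hB.pow_const _)).aemeasurable
      _ ≤ (D * (C * ENNReal.ofReal (Real.pi / α))) ^ (p / 2) * (ENNReal.ofReal (α / Real.pi) *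
          ∫⁻ w, berezinOf α μ w ^ (p / 2)) := by
          refine mul_le_mul_right (mul_le_mul_right (lintegral_mono fun w => ?_) _) _
          exact mul_le_of_le_one_left zero_le (tsum_fockDensity_le hT.orthonormal_left w)
      _ = _ := by
          rw [ENNReal.coe_mul, ENNReal.coe_rpow_of_nonneg _ hq0.le, ENNReal.coe_mul,
            ENNReal.mul_rpow_of_nonneg _ _ hq0.le]
          change _ = ENNReal.ofReal _ * (_ * ENNReal.ofReal _) ^ (p / 2) * _ * _
          ring

end FockSpace

/-! ### Carleson embeddings: boundedness and compactness -/

/-- An operator that is arbitrarily small on subspaces of finite codimension is compact. -/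
theorem isCompactOperator_of_small_on_finite_codim {H : Type*} [NormedAddCommGroup H]
    [InnerProductSpace ℂ H] [CompleteSpace H] {T : H →L[ℂ] H}
    (h : ∀ ε > 0, ∃ S : Set H, S.Finite ∧ ∀ f, (∀ x ∈ S, inner ℂ x f = 0) → ‖T f‖ ≤ ε * ‖f‖) :
    IsCompactOperator T := by
  choose S hS hST using fun n : ℕ => h (1 / ((n : ℝ) + 1)) (by positivity)
  have hfd : ∀ n, FiniteDimensional ℂ (Submodule.span ℂ (S n)) := fun n =>
    FiniteDimensional.span_of_finite ℂ (hS n)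
  set P : ℕ → H →L[ℂ] H := fun n => (Submodule.span ℂ (S n)).starProjection with hP
  refine isCompactOperator_of_tendsto (F := fun n => T ∘L P n) (l := Filter.atTop) ?_
    (Filter.Eventually.of_forall fun n => ?_)
  · rw [tendsto_iff_norm_sub_tendsto_zero]
    refine squeeze_zero (fun _ => norm_nonneg _) (fun n => ?_)
      (tendsto_one_div_add_atTop_nhds_zero_nat (𝕜 := ℝ))
    refine ContinuousLinearMap.opNorm_le_bound _ (by positivity) fun f => ?_
    have h1 : (T ∘L P n - T) f = -T (f - P n f) := by simp
    rw [h1, norm_neg]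
    have h2 : f - P n f ∈ (Submodule.span ℂ (S n))ᗮ :=
      Submodule.sub_starProjection_mem_orthogonal f
    refine (hST n _ fun x hx => (Submodule.mem_orthogonal _ _).1 h2 x
      (Submodule.subset_span hx)).trans ?_
    gcongr
    have h3 : f - P n f = (Submodule.span ℂ (S n))ᗮ.starProjection f := by
      rw [Submodule.starProjection_orthogonal]; rfl
    rw [h3]
    exact Submodule.norm_starProjection_apply_le _ f
  · have h1 : IsCompactOperator ((Submodule.span ℂ (S n)).orthogonalProjectionOnto) := by
      have : LocallyCompactSpace (Submodule.span ℂ (S n)) := by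
        have := FiniteDimensional.proper_rclike ℂ (Submodule.span ℂ (S n))
        infer_instance
      exact isCompactOperator_of_locallyCompactSpace_dom _
    exact h1.clm_comp (T ∘L (Submodule.span ℂ (S n)).subtypeL)

namespace FockSpace

variable {α : ℝ} [hα : Fact (0 < α)]

/-- A bounded Berezin transform gives a bounded embedding. -/
theorem exists_derivForm_le_norm_sq (α : ℝ) [Fact (0 < α)] :
    ∃ C : ℝ≥0, ∀ (μ : Measure ℂ) [SFinite μ] (M : ℝ≥0∞), (∀ w, berezinOf α μ w ≤ M) →
      ∀ f : FockSpace α, derivForm μ f ≤ C * M * ENNReal.ofReal (‖f‖ ^ 2) := by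
  obtain ⟨C, hC⟩ := exists_derivForm_le (Fact.out : 0 < α)
  refine ⟨C * (Real.pi / α).toNNReal, fun μ _ M hM f => (hC μ f f.differentiable).trans ?_⟩
  calc (C : ℝ≥0∞) * ∫⁻ w, berezinOf α μ w * ENNReal.ofReal (fockDensity α f w)
      ≤ C * ∫⁻ w, M * ENNReal.ofReal (fockDensity α f w) := by
        gcongr with w
        exact hM w
    _ = _ := by
        rw [lintegral_const_mul _ (measurable_fockDensity f.differentiable.continuous),
          lintegral_fockDensity, ENNReal.coe_mul]
        change _ = _ * ENNReal.ofReal _ * _ * _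
        ring

theorem exists_norm_sub_le (α : ℝ) [Fact (0 < α)] (R : ℝ) :
    ∃ C : ℝ, 0 < C ∧ ∀ (f : FockSpace α) (z w : ℂ), ‖z‖ ≤ R → ‖w‖ ≤ R →
      ‖f z - f w‖ ≤ C * ‖z - w‖ * ‖f‖ := by
  have h0 : 0 < α := Fact.out
  refine ⟨Real.exp (α / 2 * (R + 1) ^ 2), Real.exp_pos _, fun f z w hz hw => ?_⟩
  have hd : ∀ x ∈ Metric.closedBall (0 : ℂ) R,
      ‖deriv f x‖ ≤ Real.exp (α / 2 * (R + 1) ^ 2) * ‖f‖ := by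
    intro x hx
    have hx' : ‖x‖ ≤ R := by simpa using hx
    have h1 := Complex.norm_deriv_le_of_forall_mem_sphere_norm_le (f := f) (c := x)
      (C := Real.exp (α / 2 * (R + 1) ^ 2) * ‖f‖) one_pos
      f.differentiable.diffContOnCl (fun y hy => ?_)
    · simpa using h1
    · refine (norm_apply_le f y).trans ?_
      have hy' : ‖y - x‖ = 1 := by rw [← dist_eq_norm]; exact hy
      have : ‖y‖ ≤ R + 1 := by
        have := norm_le_insert' y x
        linarith
      gcongr
  have := (convex_closedBall (0 : ℂ) R).norm_image_sub_le_of_norm_deriv_le (f := f)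
    (fun x _ => f.differentiable x) hd (x := w) (y := z) (by simpa using hw) (by simpa using hz)
  linarith

/-- A bounded Berezin transform that vanishes at infinity gives a compact operator: a function
that vanishes on a fine net of a large disc has a small image. -/
theorem isCompactOperator_of_berezinOf_tendsto_zero {μ : Measure ℂ} [SFinite μ] {M : ℝ≥0}
    (hM : ∀ w, berezinOf α μ w ≤ M)
    (hvan : ∀ ε : ℝ≥0, 0 < ε → ∃ R : ℝ, ∀ w : ℂ, R < ‖w‖ → berezinOf α μ w ≤ ε)
    {T : FockSpace α →L[ℂ] FockSpace α} {D : ℝ≥0}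
    (hT : ∀ f : FockSpace α, ENNReal.ofReal (‖T f‖ ^ 2) ≤ D * derivForm μ f) :
    IsCompactOperator T := by
  have h0 : 0 < α := Fact.out
  obtain ⟨C, hC⟩ := exists_derivForm_le (Fact.out : 0 < α)
  refine isCompactOperator_of_small_on_finite_codim fun ε hε => ?_
  -- the two parts of the integral get the shares `ε₁ π/α` and `η²` times a constant
  set A : ℝ := D * C with hA
  have hA0 : 0 ≤ A := by positivity
  set ε₁ : ℝ≥0 := (ε ^ 2 / 2 / ((A + 1) * (Real.pi / α))).toNNReal with hε₁
  have hε₁0 : 0 < ε₁ := Real.toNNReal_pos.2 (by positivity)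
  obtain ⟨R, hR⟩ := hvan ε₁ hε₁0
  set V : ℝ := volume.real (Metric.closedBall (0 : ℂ) R) with hV
  obtain ⟨L, hL0, hL⟩ := exists_norm_sub_le α R
  set η : ℝ := Real.sqrt (ε ^ 2 / 2 / ((A + 1) * (M + 1) * (V + 1))) with hη
  have hV0 : 0 ≤ V := measureReal_nonneg
  have hη0 : 0 < η := Real.sqrt_pos.2 (by positivity)
  obtain ⟨t, ht, htf, htc⟩ := finite_cover_balls_of_compact
    (isCompact_closedBall (0 : ℂ) R) (e := η / L) (by positivity)
  refine ⟨kernel α '' t, htf.image _, fun f hf => ?_⟩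
  have hft : ∀ x ∈ t, f x = 0 := by
    intro x hx
    have h1 := hf _ ⟨x, hx, rfl⟩
    rw [inner_kernel] at h1
    exact (mul_eq_zero.1 h1).resolve_right (Complex.exp_ne_zero _)
  have hsmall : ∀ w ∈ Metric.closedBall (0 : ℂ) R, fockDensity α f w ≤ η ^ 2 * ‖f‖ ^ 2 := by
    intro w hw
    obtain ⟨x, hx, hwx⟩ := Set.mem_iUnion₂.1 (htc hw)
    have h1 := hL f w x (by simpa using hw) (by simpa using ht hx)
    rw [hft x hx, sub_zero] at h1
    have h2 : ‖w - x‖ < η / L := by rw [← dist_eq_norm]; exact hwx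
    have h3 : ‖f w‖ ≤ η * ‖f‖ := by
      refine h1.trans ?_
      gcongr
      rw [← le_div_iff₀' hL0]
      exact h2.le
    rw [← mul_pow, fockDensity]
    calc ‖f w‖ ^ 2 * Real.exp (-α * ‖w‖ ^ 2) ≤ ‖f w‖ ^ 2 := by
          refine mul_le_of_le_one_right (by positivity) (Real.exp_le_one_iff.2 ?_)
          nlinarith [sq_nonneg ‖w‖]
      _ ≤ _ := by gcongr
  have hm := measurable_fockDensity (α := α) f.differentiable.continuous
  have hint : ∫⁻ w, berezinOf α μ w * ENNReal.ofReal (fockDensity α f w) ≤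
      ENNReal.ofReal ((M * V * η ^ 2 + ε₁ * (Real.pi / α)) * ‖f‖ ^ 2) := by
    have hms : MeasurableSet (Metric.closedBall (0 : ℂ) R) := Metric.isClosed_closedBall.measurableSet
    rw [← lintegral_add_compl _ hms, add_mul, ENNReal.ofReal_add (by positivity) (by positivity)]
    refine add_le_add ?_ ?_
    · calc ∫⁻ w in Metric.closedBall (0 : ℂ) R,
            berezinOf α μ w * ENNReal.ofReal (fockDensity α f w)
          ≤ ∫⁻ w in Metric.closedBall (0 : ℂ) R, M * ENNReal.ofReal (η ^ 2 * ‖f‖ ^ 2) := by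
            refine setLIntegral_mono_ae' hms (Filter.Eventually.of_forall fun w hw => ?_)
            gcongr
            · exact hM w
            · exact hsmall w hw
        _ = _ := by
            rw [setLIntegral_const, mul_assoc (M * V : ℝ),
              ENNReal.ofReal_mul (p := (M * V : ℝ)) (by positivity),
              ENNReal.ofReal_mul (p := (M : ℝ)) (by positivity), hV, measureReal_def,
              ENNReal.ofReal_toReal (isCompact_closedBall (0 : ℂ) R).measure_lt_top.ne,
              ENNReal.ofReal_coe_nnreal]
            ring
    · calc ∫⁻ w in (Metric.closedBall (0 : ℂ) R)ᶜ,
            berezinOf α μ w * ENNReal.ofReal (fockDensity α f w)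
          ≤ ∫⁻ w in (Metric.closedBall (0 : ℂ) R)ᶜ, ε₁ * ENNReal.ofReal (fockDensity α f w) := by
            refine setLIntegral_mono_ae' hms.compl (Filter.Eventually.of_forall fun w hw => ?_)
            gcongr
            refine hR w ?_
            simpa using hw
        _ ≤ ∫⁻ w, ε₁ * ENNReal.ofReal (fockDensity α f w) := setLIntegral_le_lintegral _ _
        _ = _ := by
            rw [lintegral_const_mul _ hm, lintegral_fockDensity, mul_assoc (ε₁ : ℝ),
              ENNReal.ofReal_mul (by positivity), ENNReal.ofReal_mul (by positivity),
              ENNReal.ofReal_coe_nnreal]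
  have h1 : ENNReal.ofReal (‖T f‖ ^ 2) ≤
      ENNReal.ofReal (A * ((M * V * η ^ 2 + ε₁ * (Real.pi / α)) * ‖f‖ ^ 2)) := by
    refine (hT f).trans ?_
    rw [ENNReal.ofReal_mul hA0, hA, ENNReal.ofReal_mul (by positivity), ENNReal.ofReal_coe_nnreal,
      ENNReal.ofReal_coe_nnreal, mul_assoc]
    gcongr
    exact (hC μ f f.differentiable).trans (by gcongr)
  rw [ENNReal.ofReal_le_ofReal_iff (by positivity)] at h1
  refine le_of_sq_le_sq (h1.trans ?_) (by positivity)
  rw [mul_pow, ← mul_assoc]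
  gcongr
  have h2 : η ^ 2 = ε ^ 2 / 2 / ((A + 1) * (M + 1) * (V + 1)) := Real.sq_sqrt (by positivity)
  have h3 : (ε₁ : ℝ) = ε ^ 2 / 2 / ((A + 1) * (Real.pi / α)) :=
    Real.coe_toNNReal _ (by positivity)
  have h4 : A * (M * V * η ^ 2) ≤ ε ^ 2 / 2 := by
    rw [h2]
    have : A * (M * V * (ε ^ 2 / 2 / ((A + 1) * (M + 1) * (V + 1))))
        = (A / (A + 1)) * ((M : ℝ) / (M + 1)) * (V / (V + 1)) * (ε ^ 2 / 2) := by
      field_simp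
    rw [this]
    refine mul_le_of_le_one_left (by positivity) ?_
    have e1 : A / (A + 1) ≤ 1 := div_le_one_of_le₀ (by linarith) (by positivity)
    have e2 : (M : ℝ) / (M + 1) ≤ 1 := div_le_one_of_le₀ (by linarith) (by positivity)
    have e3 : V / (V + 1) ≤ 1 := div_le_one_of_le₀ (by linarith) (by positivity)
    exact mul_le_one₀ (mul_le_one₀ e1 (by positivity) e2) (by positivity) e3
  have h5 : A * (ε₁ * (Real.pi / α)) ≤ ε ^ 2 / 2 := by
    rw [h3]
    have : A * (ε ^ 2 / 2 / ((A + 1) * (Real.pi / α)) * (Real.pi / α))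
        = (A / (A + 1)) * (ε ^ 2 / 2) := by
      field_simp
    rw [this]
    exact mul_le_of_le_one_left (by positivity) (div_le_one_of_le₀ (by linarith) (by positivity))
  linarith

end FockSpace

/-! ### The unit lattice -/

/-- The centre of the unit cell with lower left corner `m + n i`. No centre is close to the origin,
where the derivative of the kernel function `k_0` vanishes. -/
noncomputable def cellCenter (l : ℤ × ℤ) : ℂ := ⟨l.1 + 1 / 2, l.2 + 1 / 2⟩

/-- The index of the unit cell that contains a point. -/
noncomputable def cellIndex (z : ℂ) : ℤ × ℤ := (⌊z.re⌋, ⌊z.im⌋)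

/-- The half-open unit cell with lower left corner `m + n i`. -/
def unitCell (l : ℤ × ℤ) : Set ℂ := cellIndex ⁻¹' {l}

theorem measurable_cellIndex : Measurable cellIndex :=
  (Int.measurable_floor.comp Complex.measurable_re).prodMk
    (Int.measurable_floor.comp Complex.measurable_im)

theorem measurableSet_unitCell (l : ℤ × ℤ) : MeasurableSet (unitCell l) :=
  measurable_cellIndex (measurableSet_singleton l)

theorem pairwise_disjoint_unitCell : Pairwise (Function.onFun Disjoint unitCell) :=
  fun _ _ hlk => Disjoint.preimage _ (Set.disjoint_singleton.2 hlk)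

theorem iUnion_unitCell : ⋃ l, unitCell l = Set.univ :=
  Set.eq_univ_of_forall fun z => Set.mem_iUnion.2 ⟨cellIndex z, rfl⟩

theorem lintegral_eq_tsum_unitCell (μ : Measure ℂ) (f : ℂ → ℝ≥0∞) :
    ∫⁻ z, f z ∂μ = ∑' l, ∫⁻ z in unitCell l, f z ∂μ := by
  rw [← lintegral_iUnion measurableSet_unitCell pairwise_disjoint_unitCell, iUnion_unitCell,
    setLIntegral_univ]

theorem norm_sub_cellCenter_le {l : ℤ × ℤ} {z : ℂ} (hz : z ∈ unitCell l) :
    ‖z - cellCenter l‖ ≤ 1 := by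
  have h : cellIndex z = l := hz
  have h1 : (l.1 : ℝ) ≤ z.re := by rw [← h]; exact Int.floor_le _
  have h2 : z.re < l.1 + 1 := by rw [← h]; exact Int.lt_floor_add_one _
  have h3 : (l.2 : ℝ) ≤ z.im := by rw [← h]; exact Int.floor_le _
  have h4 : z.im < l.2 + 1 := by rw [← h]; exact Int.lt_floor_add_one _
  refine (Complex.norm_le_abs_re_add_abs_im _).trans ?_
  have h5 : |(z - cellCenter l).re| ≤ 1 / 2 := by
    rw [Complex.sub_re, cellCenter, abs_le]; constructor <;> linarith
  have h6 : |(z - cellCenter l).im| ≤ 1 / 2 := by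
    rw [Complex.sub_im, cellCenter, abs_le]; constructor <;> linarith
  linarith

theorem ball_cellCenter_subset (l : ℤ × ℤ) : Metric.ball (cellCenter l) (1 / 2) ⊆ unitCell l := by
  intro z hz
  have h : ‖z - cellCenter l‖ < 1 / 2 := by rw [← dist_eq_norm]; exact hz
  have h1 := abs_lt.1 ((Complex.abs_re_le_norm _).trans_lt h)
  have h2 := abs_lt.1 ((Complex.abs_im_le_norm _).trans_lt h)
  rw [Complex.sub_re, cellCenter] at h1
  rw [Complex.sub_im, cellCenter] at h2
  change cellIndex z = l
  refine Prod.ext (Int.floor_eq_iff.2 ⟨?_, ?_⟩) (Int.floor_eq_iff.2 ⟨?_, ?_⟩) <;>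
    simp only at h1 h2 <;> linarith [h1.1, h1.2, h2.1, h2.2]

theorem half_le_norm_cellCenter (l : ℤ × ℤ) : 1 / 2 ≤ ‖cellCenter l‖ := by
  refine le_trans ?_ (Complex.abs_re_le_norm _)
  rw [cellCenter]
  rcases le_or_gt 0 l.1 with h | h
  · have : (0 : ℝ) ≤ l.1 := by exact_mod_cast h
    rw [abs_of_nonneg] <;> simp only <;> linarith
  · have : (l.1 : ℝ) + 1 ≤ 0 := by exact_mod_cast h
    rw [abs_of_nonpos] <;> simp only <;> linarith

/-- Cells with the same residues modulo `L` have distance at least `L`. -/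
theorem le_norm_sub_cellCenter {L : ℕ} {l k : ℤ × ℤ} (hlk : l ≠ k)
    (h1 : l.1 % L = k.1 % L) (h2 : l.2 % L = k.2 % L) : (L : ℝ) ≤ ‖cellCenter l - cellCenter k‖ := by
  have key : ∀ a b : ℤ, a ≠ b → a % L = b % L → (L : ℝ) ≤ |(a : ℝ) - b| := by
    intro a b hab h
    have h3 : (L : ℤ) ∣ a - b := Int.ModEq.dvd (n := L) h.symm
    have h4 := Int.le_of_dvd (abs_pos.2 (sub_ne_zero.2 hab)) ((dvd_abs _ _).2 h3)
    exact_mod_cast h4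
  by_cases h : l.1 = k.1
  · have h' : l.2 ≠ k.2 := fun h' => hlk (Prod.ext h h')
    refine (key _ _ h' h2).trans (le_trans (le_of_eq ?_) (Complex.abs_im_le_norm _))
    rw [Complex.sub_im, cellCenter, cellCenter]
    congr 1
    simp only
    ring
  · refine (key _ _ h h1).trans (le_trans (le_of_eq ?_) (Complex.abs_re_le_norm _))
    rw [Complex.sub_re, cellCenter, cellCenter]
    congr 1
    simp only
    ring

theorem lintegral_exp_neg_norm_lt_top {a : ℝ} (ha : 0 < a) :
    ∫⁻ z : ℂ, ENNReal.ofReal (Real.exp (-a * ‖z‖)) < ∞ := by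
  have h1 := Complex.integral_exp_neg_mul_rpow (p := 1) (b := a) le_rfl ha
  simp only [Real.rpow_one] at h1
  have h2 : Integrable fun z : ℂ => Real.exp (-a * ‖z‖) := by
    by_contra h
    rw [integral_undef h] at h1
    have : 0 < Real.pi * a ^ (-2 / (1 : ℝ)) * Real.Gamma (2 / 1 + 1) := by
      have := Real.Gamma_pos_of_pos (s := 2 / 1 + 1) (by norm_num)
      positivity
    linarith
  have h3 := h2.2
  rwa [hasFiniteIntegral_iff_ofReal (Filter.Eventually.of_forall fun z => (Real.exp_pos _).le)] at h3

theorem volume_unitCell_ge (l : ℤ × ℤ) :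
    volume (Metric.ball (0 : ℂ) (1 / 2)) ≤ volume (unitCell l) := by
  refine le_trans (le_of_eq ?_) (measure_mono (ball_cellCenter_subset l))
  exact (Measure.addHaar_ball_center volume (cellCenter l) _).symm

/-- Exponential sums over the lattice are bounded, by comparison with an integral. -/
theorem exists_tsum_exp_le {a : ℝ} (ha : 0 < a) :
    ∃ C : ℝ≥0, ∀ w : ℂ, ∑' l, ENNReal.ofReal (Real.exp (-a * ‖w - cellCenter l‖)) ≤ C := by
  set J := ∫⁻ z : ℂ, ENNReal.ofReal (Real.exp (-a * ‖z‖)) with hJ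
  have hJt : J ≠ ∞ := (lintegral_exp_neg_norm_lt_top ha).ne
  set v := volume (Metric.ball (0 : ℂ) (1 / 2)) with hv
  have hv0 : v ≠ 0 := (Metric.measure_ball_pos volume 0 (by norm_num)).ne'
  have hvt : v ≠ ∞ := measure_ball_lt_top.ne
  have hfin : v⁻¹ * (ENNReal.ofReal (Real.exp a) * J) ≠ ∞ :=
    ENNReal.mul_ne_top (ENNReal.inv_ne_top.2 hv0) (ENNReal.mul_ne_top ENNReal.ofReal_ne_top hJt)
  refine ⟨(v⁻¹ * (ENNReal.ofReal (Real.exp a) * J)).toNNReal, fun w => ?_⟩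
  rw [ENNReal.coe_toNNReal hfin, ← ENNReal.mul_le_iff_le_inv hv0 hvt, ← ENNReal.tsum_mul_left]
  have h1 : J = ∫⁻ z, ENNReal.ofReal (Real.exp (-a * ‖z - w‖)) :=
    (lintegral_sub_right_eq_self (fun z : ℂ => ENNReal.ofReal (Real.exp (-a * ‖z‖))) w).symm
  rw [h1, ← lintegral_const_mul' _ _ ENNReal.ofReal_ne_top, lintegral_eq_tsum_unitCell]
  refine ENNReal.tsum_le_tsum fun l => ?_
  calc v * ENNReal.ofReal (Real.exp (-a * ‖w - cellCenter l‖))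
      ≤ volume (unitCell l) * ENNReal.ofReal (Real.exp (-a * ‖w - cellCenter l‖)) := by
        gcongr; exact volume_unitCell_ge l
    _ = ∫⁻ z in unitCell l, ENNReal.ofReal (Real.exp (-a * ‖w - cellCenter l‖)) := by
        rw [setLIntegral_const, mul_comm]
    _ ≤ _ := by
        refine setLIntegral_mono_ae' (measurableSet_unitCell l)
          (Filter.Eventually.of_forall fun z hz => ?_)
        rw [← ENNReal.ofReal_mul (by positivity), ← Real.exp_add]
        refine ENNReal.ofReal_le_ofReal (Real.exp_le_exp.2 ?_)
        have h2 := norm_sub_cellCenter_le hz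
        have h3 : ‖z - w‖ ≤ ‖z - cellCenter l‖ + ‖w - cellCenter l‖ := by
          rw [norm_sub_rev w]
          exact norm_sub_le_norm_sub_add_norm_sub z (cellCenter l) w
        nlinarith

/-! ### Localization of the kernel functions on the cells -/

theorem norm_normKernel (α : ℝ) (w z : ℂ) :
    ‖normKernel α w z‖ = Real.exp (α / 2 * ‖z‖ ^ 2 - α / 2 * ‖z - w‖ ^ 2) := by
  rw [← Real.sqrt_sq (norm_nonneg (normKernel α w z)), norm_normKernel_sq, ← Real.exp_half]
  congr 1
  ring

theorem norm_deriv_normKernel {α : ℝ} (hα : 0 < α) (w z : ℂ) :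
    ‖deriv (normKernel α w) z‖ = α * ‖w‖ * ‖normKernel α w z‖ := by
  rw [deriv_normKernel, norm_mul, norm_mul, Complex.norm_real, RCLike.norm_conj,
    Real.norm_of_nonneg hα.le]

/-- On a cell, every kernel function is dominated by the kernel function at its centre, with
exponential decay in the distance. -/
theorem exists_normKernel_le_on_cell {α : ℝ} (hα : 0 < α) :
    ∃ C : ℝ, 0 < C ∧ ∀ (w : ℂ) (l : ℤ × ℤ), ∀ ζ ∈ unitCell l,
      (‖w‖ + 1) * ‖normKernel α w ζ‖ ≤
        C * Real.exp (-‖w - cellCenter l‖) * ‖deriv (normKernel α (cellCenter l)) ζ‖ := by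
  refine ⟨3 / α * Real.exp (2 + 2 / α + α / 2), by positivity, fun w l ζ hζ => ?_⟩
  set c := cellCenter l with hc
  have h1 : ‖ζ - c‖ ≤ 1 := norm_sub_cellCenter_le hζ
  have h2 : 1 / 2 ≤ ‖c‖ := half_le_norm_cellCenter l
  set d := ‖w - c‖ with hd
  set δ := ‖ζ - w‖ with hδ
  have hd0 : 0 ≤ d := norm_nonneg _
  have h3 : d ≤ δ + 1 := by
    have := norm_sub_le_norm_sub_add_norm_sub w ζ c
    rw [norm_sub_rev w ζ] at this
    linarith
  have h4 : ‖w‖ + 1 ≤ 3 * ‖c‖ * (1 + d) := by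
    have := norm_le_insert' w c
    nlinarith
  have h5 : 2 * δ - α / 2 * δ ^ 2 ≤ 2 / α := by
    have : 2 / α - (2 * δ - α / 2 * δ ^ 2) = (α * δ - 2) ^ 2 / (2 * α) := by field_simp; ring
    have h6 : 0 ≤ (α * δ - 2) ^ 2 / (2 * α) := by positivity
    linarith
  have h6 : ‖ζ - c‖ ^ 2 ≤ 1 := by nlinarith [norm_nonneg (ζ - c)]
  rw [norm_deriv_normKernel hα, norm_normKernel, norm_normKernel]
  calc (‖w‖ + 1) * Real.exp (α / 2 * ‖ζ‖ ^ 2 - α / 2 * δ ^ 2)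
      ≤ (3 * ‖c‖ * Real.exp d) * Real.exp (α / 2 * ‖ζ‖ ^ 2 - α / 2 * δ ^ 2) := by
        gcongr
        refine h4.trans ?_
        gcongr
        linarith [Real.add_one_le_exp d]
    _ = 3 * ‖c‖ * Real.exp (d + (α / 2 * ‖ζ‖ ^ 2 - α / 2 * δ ^ 2)) := by
        rw [Real.exp_add]; ring
    _ ≤ 3 * ‖c‖ * Real.exp ((2 + 2 / α + α / 2) + (-d) +
          (α / 2 * ‖ζ‖ ^ 2 - α / 2 * ‖ζ - c‖ ^ 2)) := by
        refine mul_le_mul_of_nonneg_left (Real.exp_le_exp.2 ?_) (by positivity)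
        have := mul_le_mul_of_nonneg_left h6 (by positivity : 0 ≤ α / 2)
        linarith
    _ = _ := by
        rw [Real.exp_add, Real.exp_add]
        field_simp

theorem deriv_normKernel_le_on_cell {α : ℝ} (hα : 0 < α) {l : ℤ × ℤ} {w ζ : ℂ}
    (hw : w ∈ unitCell l) (hζ : ζ ∈ unitCell l) :
    ‖deriv (normKernel α (cellCenter l)) ζ‖ ≤
      α * Real.exp (2 * α) * ((‖w‖ + 1) * ‖normKernel α w ζ‖) := by
  have h1 := norm_sub_cellCenter_le hw
  have h2 := norm_sub_cellCenter_le hζ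
  set c := cellCenter l
  have h3 : ‖ζ - w‖ ≤ 2 := by
    have := norm_sub_le_norm_sub_add_norm_sub ζ c w
    rw [norm_sub_rev c w] at this
    linarith
  have h4 : ‖c‖ ≤ ‖w‖ + 1 := by
    have := norm_le_insert w c
    linarith
  rw [norm_deriv_normKernel hα, norm_normKernel, norm_normKernel]
  calc α * ‖c‖ * Real.exp (α / 2 * ‖ζ‖ ^ 2 - α / 2 * ‖ζ - c‖ ^ 2)
      ≤ α * (‖w‖ + 1) * Real.exp (2 * α + (α / 2 * ‖ζ‖ ^ 2 - α / 2 * ‖ζ - w‖ ^ 2)) := by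
        gcongr
        have : ‖ζ - w‖ ^ 2 ≤ 4 := by nlinarith [norm_nonneg (ζ - w)]
        nlinarith [sq_nonneg ‖ζ - c‖]
    _ = _ := by rw [Real.exp_add]; ring

/-- The mass `∫_Q |k_c'|² dμ` of a cell `Q` with centre `c`, weighted by its kernel function. -/
noncomputable def cellMass (α : ℝ) (μ : Measure ℂ) (l : ℤ × ℤ) : ℝ≥0∞ :=
  ∫⁻ ζ in unitCell l, ENNReal.ofReal (‖deriv (normKernel α (cellCenter l)) ζ‖ ^ 2) ∂μ

theorem exists_berezinOf_le_tsum {α : ℝ} (hα : 0 < α) :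
    ∃ C : ℝ≥0, ∀ (μ : Measure ℂ) (w : ℂ), berezinOf α μ w ≤
      C * ∑' l, ENNReal.ofReal (Real.exp (-2 * ‖w - cellCenter l‖)) * cellMass α μ l := by
  obtain ⟨C, hC0, hC⟩ := exists_normKernel_le_on_cell hα
  refine ⟨(C ^ 2).toNNReal, fun μ w => ?_⟩
  rw [berezinOf, lintegral_eq_tsum_unitCell, ← ENNReal.tsum_mul_left]
  refine ENNReal.tsum_le_tsum fun l => ?_
  change _ ≤ ENNReal.ofReal _ * _
  rw [cellMass, ← mul_assoc, ← ENNReal.ofReal_mul (by positivity),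
    ← lintegral_const_mul' _ _ ENNReal.ofReal_ne_top]
  refine setLIntegral_mono_ae' (measurableSet_unitCell l)
    (Filter.Eventually.of_forall fun ζ hζ => ?_)
  rw [← ENNReal.ofReal_mul (by positivity)]
  refine ENNReal.ofReal_le_ofReal ?_
  rw [← mul_pow]
  refine (pow_le_pow_left₀ (by positivity) (hC w l ζ hζ) 2).trans (le_of_eq ?_)
  rw [mul_pow, mul_pow, ← Real.exp_nat_mul]
  congr 3
  push_cast
  ring

/-- Up to constants, the Berezin transform at `w` is the largest cell mass, discounted by the
distance to `w`. -/
theorem exists_berezinOf_le_iSup {α : ℝ} (hα : 0 < α) :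
    ∃ C : ℝ≥0, ∀ (μ : Measure ℂ) (w : ℂ), berezinOf α μ w ≤
      C * ⨆ l, ENNReal.ofReal (Real.exp (-‖w - cellCenter l‖)) * cellMass α μ l := by
  obtain ⟨C, hC⟩ := exists_berezinOf_le_tsum hα
  obtain ⟨C', hC'⟩ := exists_tsum_exp_le one_pos
  refine ⟨C * C', fun μ w => (hC μ w).trans ?_⟩
  rw [ENNReal.coe_mul, mul_assoc]
  gcongr
  set M := ⨆ l, ENNReal.ofReal (Real.exp (-‖w - cellCenter l‖)) * cellMass α μ l
  calc ∑' l, ENNReal.ofReal (Real.exp (-2 * ‖w - cellCenter l‖)) * cellMass α μ l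
      ≤ ∑' l, ENNReal.ofReal (Real.exp (-1 * ‖w - cellCenter l‖)) * M := by
        refine ENNReal.tsum_le_tsum fun l => ?_
        have h1 : Real.exp (-2 * ‖w - cellCenter l‖)
            = Real.exp (-1 * ‖w - cellCenter l‖) * Real.exp (-‖w - cellCenter l‖) := by
          rw [← Real.exp_add]; congr 1; ring
        rw [h1, ENNReal.ofReal_mul (by positivity), mul_assoc]
        gcongr
        exact le_iSup (fun l => ENNReal.ofReal (Real.exp (-‖w - cellCenter l‖)) * cellMass α μ l) l
    _ ≤ C' * M := by
        rw [ENNReal.tsum_mul_right]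
        gcongr
        exact hC' w

/-- One half of the discretization of `∫ B^q dm`. The supremum is bounded by an `ℓ^q` norm, so that
the argument covers all `q > 0`. -/
theorem exists_lintegral_berezinOf_rpow_le {α : ℝ} (hα : 0 < α) {q : ℝ} (hq : 0 < q) :
    ∃ C : ℝ≥0, ∀ μ : Measure ℂ,
      ∫⁻ w, berezinOf α μ w ^ q ≤ C * ∑' l, cellMass α μ l ^ q := by
  obtain ⟨C, hC⟩ := exists_berezinOf_le_iSup hα
  set J := ∫⁻ z : ℂ, ENNReal.ofReal (Real.exp (-q * ‖z‖)) with hJ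
  have hJt : J ≠ ∞ := (lintegral_exp_neg_norm_lt_top hq).ne
  refine ⟨C ^ q * J.toNNReal, fun μ => ?_⟩
  have hpt : ∀ w, berezinOf α μ w ^ q ≤ (C : ℝ≥0∞) ^ q *
      ∑' l, ENNReal.ofReal (Real.exp (-q * ‖w - cellCenter l‖)) * cellMass α μ l ^ q := by
    intro w
    have h1 : ∀ l, ENNReal.ofReal (Real.exp (-‖w - cellCenter l‖)) * cellMass α μ l ≤
        (∑' l, ENNReal.ofReal (Real.exp (-q * ‖w - cellCenter l‖)) * cellMass α μ l ^ q)
          ^ (1 / q) := by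
      intro l
      have h2 : (-‖w - cellCenter l‖) * q = -q * ‖w - cellCenter l‖ := by ring
      rw [one_div, ENNReal.le_rpow_inv_iff hq, ENNReal.mul_rpow_of_nonneg _ _ hq.le,
        ENNReal.ofReal_rpow_of_nonneg (by positivity) hq.le, ← Real.exp_mul, h2]
      exact ENNReal.le_tsum
        (f := fun l => ENNReal.ofReal (Real.exp (-q * ‖w - cellCenter l‖)) * cellMass α μ l ^ q) l
    calc berezinOf α μ w ^ q ≤ (C * (∑' l, ENNReal.ofReal (Real.exp (-q * ‖w - cellCenter l‖)) *
          cellMass α μ l ^ q) ^ (1 / q)) ^ q := by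
          gcongr
          refine (hC μ w).trans ?_
          gcongr
          exact iSup_le h1
      _ = _ := by
          rw [ENNReal.mul_rpow_of_nonneg _ _ hq.le, ← ENNReal.rpow_mul, one_div,
            inv_mul_cancel₀ hq.ne', ENNReal.rpow_one]
  calc ∫⁻ w, berezinOf α μ w ^ q
      ≤ ∫⁻ w, (C : ℝ≥0∞) ^ q *
        ∑' l, ENNReal.ofReal (Real.exp (-q * ‖w - cellCenter l‖)) * cellMass α μ l ^ q :=
        lintegral_mono hpt
    _ = (C : ℝ≥0∞) ^ q * ∑' l, J * cellMass α μ l ^ q := by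
        have hm : ∀ l, Measurable fun w => ENNReal.ofReal (Real.exp (-q * ‖w - cellCenter l‖)) :=
          fun l => by fun_prop
        rw [lintegral_const_mul _ (Measurable.tsum fun l => (hm l).mul_const _),
          lintegral_tsum fun l => ((hm l).mul_const _).aemeasurable]
        congr 2
        ext l
        rw [lintegral_mul_const _ (hm l),
          lintegral_sub_right_eq_self (fun z : ℂ => ENNReal.ofReal (Real.exp (-q * ‖z‖)))]
    _ = _ := by
        rw [ENNReal.tsum_mul_left, ENNReal.coe_mul, ENNReal.coe_toNNReal hJt,
          ENNReal.coe_rpow_of_nonneg _ hq.le, mul_assoc]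

/-- The other half of the discretization: a cell mass is bounded by the Berezin transform at every
point of the cell. -/
theorem exists_tsum_cellMass_rpow_le {α : ℝ} (hα : 0 < α) {q : ℝ} (hq : 0 < q) :
    ∃ C : ℝ≥0, ∀ μ : Measure ℂ,
      ∑' l, cellMass α μ l ^ q ≤ C * ∫⁻ w, berezinOf α μ w ^ q := by
  set v := volume (Metric.ball (0 : ℂ) (1 / 2)) with hv
  have hv0 : v ≠ 0 := (Metric.measure_ball_pos volume 0 (by norm_num)).ne'
  have hvt : v ≠ ∞ := measure_ball_lt_top.ne
  set A : ℝ≥0 := ((α * Real.exp (2 * α)) ^ 2).toNNReal with hA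
  refine ⟨v⁻¹.toNNReal * A ^ q, fun μ => ?_⟩
  rw [ENNReal.coe_mul, ENNReal.coe_toNNReal (ENNReal.inv_ne_top.2 hv0), mul_assoc,
    ← ENNReal.mul_le_iff_le_inv hv0 hvt, ← ENNReal.tsum_mul_left,
    ENNReal.coe_rpow_of_nonneg _ hq.le, ← lintegral_const_mul' _ _ (by finiteness),
    lintegral_eq_tsum_unitCell]
  refine ENNReal.tsum_le_tsum fun l => ?_
  calc v * cellMass α μ l ^ q ≤ volume (unitCell l) * cellMass α μ l ^ q := by
        gcongr; exact volume_unitCell_ge l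
    _ = ∫⁻ w in unitCell l, cellMass α μ l ^ q := by rw [setLIntegral_const, mul_comm]
    _ ≤ ∫⁻ w in unitCell l, (A : ℝ≥0∞) ^ q * berezinOf α μ w ^ q := by
        refine setLIntegral_mono_ae' (measurableSet_unitCell l)
          (Filter.Eventually.of_forall fun w hw => ?_)
        rw [← ENNReal.mul_rpow_of_nonneg _ _ hq.le]
        gcongr
        change _ ≤ ENNReal.ofReal _ * _
        rw [cellMass, berezinOf, ← lintegral_const_mul' _ _ ENNReal.ofReal_ne_top]
        refine (setLIntegral_mono_ae' (measurableSet_unitCell l)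
          (Filter.Eventually.of_forall fun ζ hζ => ?_)).trans (setLIntegral_le_lintegral _ _)
        rw [← ENNReal.ofReal_mul (by positivity), ← mul_pow, ← mul_pow]
        refine ENNReal.ofReal_le_ofReal (pow_le_pow_left₀ (norm_nonneg _) ?_ 2)
        exact deriv_normKernel_le_on_cell hα hw hζ

/-- If the Berezin transform has a finite `L^q` norm, it is bounded and vanishes at infinity. -/
theorem berezinOf_bounded_and_vanishing {α : ℝ} (hα : 0 < α) {q : ℝ} (hq : 0 < q) {μ : Measure ℂ}
    (h : ∫⁻ w, berezinOf α μ w ^ q ≠ ∞) :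
    (∃ M : ℝ≥0, ∀ w, berezinOf α μ w ≤ M) ∧
      ∀ ε : ℝ≥0, 0 < ε → ∃ R : ℝ, ∀ w : ℂ, R < ‖w‖ → berezinOf α μ w ≤ ε := by
  obtain ⟨C₁, hC₁⟩ := exists_tsum_cellMass_rpow_le hα hq
  obtain ⟨C, hC⟩ := exists_berezinOf_le_iSup hα
  have hsum : ∑' l, cellMass α μ l ^ q ≠ ∞ :=
    ne_top_of_le_ne_top (ENNReal.mul_ne_top ENNReal.coe_ne_top h) (hC₁ μ)
  have hexp : ∀ (w : ℂ) (l : ℤ × ℤ), ENNReal.ofReal (Real.exp (-‖w - cellCenter l‖)) ≤ 1 :=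
    fun w l => by
      rw [← ENNReal.ofReal_one]
      exact ENNReal.ofReal_le_ofReal (Real.exp_le_one_iff.2 (neg_nonpos.2 (norm_nonneg _)))
  set M₀ := (∑' l, cellMass α μ l ^ q) ^ (1 / q) with hM₀
  have hM₀t : M₀ ≠ ∞ := ENNReal.rpow_ne_top_of_nonneg (by positivity) hsum
  have hmass : ∀ l, cellMass α μ l ≤ M₀ := fun l => by
    rw [hM₀, one_div, ENNReal.le_rpow_inv_iff hq]
    exact ENNReal.le_tsum (f := fun l => cellMass α μ l ^ q) l
  refine ⟨⟨C * M₀.toNNReal, fun w => (hC μ w).trans ?_⟩, fun ε hε => ?_⟩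
  · rw [ENNReal.coe_mul, ENNReal.coe_toNNReal hM₀t]
    gcongr
    exact iSup_le fun l => (mul_le_of_le_one_left zero_le (hexp w l)).trans (hmass l)
  · set δ : ℝ≥0 := ε / (C + 1) with hδ
    have hδ0 : 0 < δ := by positivity
    have hfin : {l | (δ : ℝ≥0∞) ^ q ≤ cellMass α μ l ^ q}.Finite :=
      ENNReal.finite_const_le_of_tsum_ne_top hsum
        (ENNReal.rpow_pos (by exact_mod_cast hδ0) ENNReal.coe_ne_top).ne'
    obtain ⟨R₁, hR₁⟩ := (hfin.image cellCenter).isBounded.subset_closedBall (0 : ℂ)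
    -- outside a large disc the discount factor makes the finitely many large masses small
    obtain ⟨R₂, hR₂⟩ : ∃ R₂ : ℝ, ENNReal.ofReal (Real.exp (-R₂)) * M₀ ≤ δ := by
      refine ⟨Real.log ((M₀.toReal + 1) / δ), ?_⟩
      have hpos : 0 < (M₀.toReal + 1) / δ := by positivity
      rw [Real.exp_neg, Real.exp_log hpos, ← ENNReal.ofReal_toReal hM₀t,
        ← ENNReal.ofReal_mul (by positivity)]
      refine ENNReal.ofReal_le_of_le_toReal ?_
      rw [ENNReal.toReal_ofReal ENNReal.toReal_nonneg, ENNReal.coe_toReal, inv_div, div_mul_eq_mul_div,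
        div_le_iff₀ (by positivity)]
      nlinarith [NNReal.coe_pos.2 hδ0]
    refine ⟨R₁ + R₂, fun w hw => (hC μ w).trans ?_⟩
    have h2 : ⨆ l, ENNReal.ofReal (Real.exp (-‖w - cellCenter l‖)) * cellMass α μ l ≤ δ := by
      refine iSup_le fun l => ?_
      by_cases hl : (δ : ℝ≥0∞) ^ q ≤ cellMass α μ l ^ q
      · refine le_trans ?_ hR₂
        have h3 : ‖cellCenter l‖ ≤ R₁ := by simpa using hR₁ ⟨l, hl, rfl⟩
        have h4 := norm_le_insert' w (cellCenter l)
        gcongr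
        · linarith
        · exact hmass l
      · have h3 : cellMass α μ l ≤ δ := by
          rw [not_le, ENNReal.rpow_lt_rpow_iff hq] at hl
          exact hl.le
        exact (mul_le_of_le_one_left zero_le (hexp w l)).trans h3
    calc (C : ℝ≥0∞) * ⨆ l, ENNReal.ofReal (Real.exp (-‖w - cellCenter l‖)) * cellMass α μ l
        ≤ C * δ := by gcongr
      _ ≤ ε := by
        rw [← ENNReal.coe_mul, ENNReal.coe_le_coe, hδ, mul_div_assoc', div_le_iff₀ (by positivity)]
        nlinarith [hε.le, mul_comm C ε]

/-! ### Almost orthogonality on sparse families of cells -/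

section Schur

variable {ι : Type*} [Fintype ι] {E : ι → ι → ℝ} {ρ : ℝ}

/-- The Schur test for the quadratic form of a symmetric matrix. -/
theorem sum_mul_mul_le_of_row_sum_le (hE : ∀ i j, 0 ≤ E i j) (hs : ∀ i j, E i j = E j i)
    (hρ : ∀ i, ∑ j, E i j ≤ ρ) (x : ι → ℝ) :
    ∑ i, ∑ j, E i j * (x i * x j) ≤ ρ * ∑ i, x i ^ 2 := by
  have h1 : ∑ i, ∑ j, E i j * x i ^ 2 ≤ ρ * ∑ i, x i ^ 2 := by
    rw [Finset.mul_sum]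
    refine Finset.sum_le_sum fun i _ => ?_
    rw [← Finset.sum_mul]
    exact mul_le_mul_of_nonneg_right (hρ i) (sq_nonneg _)
  have h2 : ∑ i, ∑ j, E i j * x j ^ 2 = ∑ i, ∑ j, E i j * x i ^ 2 := by
    rw [Finset.sum_comm]
    simp_rw [fun i j => hs j i]
  calc ∑ i, ∑ j, E i j * (x i * x j)
      ≤ ∑ i, ∑ j, (E i j * x i ^ 2 / 2 + E i j * x j ^ 2 / 2) := by
        refine Finset.sum_le_sum fun i _ => Finset.sum_le_sum fun j _ => ?_
        nlinarith [mul_nonneg (hE i j) (sq_nonneg (x i - x j))]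
    _ = ∑ i, ∑ j, E i j * x i ^ 2 := by
        simp_rw [Finset.sum_add_distrib, ← Finset.sum_div]
        rw [h2]
        ring
    _ ≤ _ := h1

/-- The Schur test for the norm of a symmetric matrix. -/
theorem sum_sq_sum_mul_le_of_row_sum_le (hE : ∀ i j, 0 ≤ E i j) (hs : ∀ i j, E i j = E j i)
    (hρ : ∀ i, ∑ j, E i j ≤ ρ) (x : ι → ℝ) :
    ∑ i, (∑ j, E i j * x j) ^ 2 ≤ ρ ^ 2 * ∑ i, x i ^ 2 := by
  rcases isEmpty_or_nonempty ι with hι | ⟨⟨i₀⟩⟩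
  · simp
  have hρ0 : 0 ≤ ρ := (Finset.sum_nonneg fun j _ => hE i₀ j).trans (hρ i₀)
  have h1 : ∀ i, (∑ j, E i j * x j) ^ 2 ≤ ρ * ∑ j, E i j * x j ^ 2 := by
    intro i
    have h2 := Finset.sum_mul_sq_le_sq_mul_sq Finset.univ (fun j => √(E i j))
      (fun j => √(E i j) * x j)
    have h3 : ∀ j, √(E i j) * (√(E i j) * x j) = E i j * x j := fun j => by
      rw [← mul_assoc, Real.mul_self_sqrt (hE i j)]
    simp_rw [h3, mul_pow, Real.sq_sqrt (hE i _)] at h2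
    exact h2.trans (mul_le_mul_of_nonneg_right (hρ i)
      (Finset.sum_nonneg fun j _ => mul_nonneg (hE i j) (sq_nonneg _)))
  calc ∑ i, (∑ j, E i j * x j) ^ 2 ≤ ∑ i, ρ * ∑ j, E i j * x j ^ 2 :=
        Finset.sum_le_sum fun i _ => h1 i
    _ = ρ * ∑ j, (∑ i, E j i) * x j ^ 2 := by
        rw [← Finset.mul_sum, Finset.sum_comm]
        simp_rw [Finset.sum_mul, fun i j => hs j i]
    _ ≤ ρ * ∑ j, ρ * x j ^ 2 := by
        gcongr with j
        exact hρ j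
    _ = _ := by rw [← Finset.mul_sum]; ring

end Schur

/-- A uniform bound of the exponential sums over the lattice passes to finite families of cells. -/
theorem sum_exp_le_of_tsum_le {a : ℝ} {C : ℝ≥0}
    (hC : ∀ w : ℂ, ∑' l, ENNReal.ofReal (Real.exp (-a * ‖w - cellCenter l‖)) ≤ C)
    (S : Finset (ℤ × ℤ)) (w : ℂ) : ∑ l : S, Real.exp (-a * ‖w - cellCenter l‖) ≤ C := by
  rw [Finset.sum_coe_sort S fun l => Real.exp (-a * ‖w - cellCenter l‖)]
  have h := (ENNReal.sum_le_tsum S).trans (hC w)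
  rw [← ENNReal.ofReal_sum_of_nonneg fun l _ => (Real.exp_pos _).le] at h
  have := ENNReal.toReal_mono ENNReal.coe_ne_top h
  rwa [ENNReal.toReal_ofReal (Finset.sum_nonneg fun l _ => (Real.exp_pos _).le)] at this

namespace FockSpace

variable {α : ℝ} [hα : Fact (0 < α)]

variable (α) in
/-- Linear combinations of the kernel functions at the centres of finitely many cells. -/
noncomputable def synthesis (S : Finset (ℤ × ℤ)) : (S → ℂ) →ₗ[ℂ] FockSpace α :=
  Fintype.linearCombination ℂ fun l : S => kernel α (cellCenter l)

theorem synthesis_apply (S : Finset (ℤ × ℤ)) (a : S → ℂ) :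
    synthesis α S a = ∑ l, a l • kernel α (cellCenter l) := rfl

theorem coe_synthesis (S : Finset (ℤ × ℤ)) (a : S → ℂ) :
    ⇑(synthesis α S a) = fun z => ∑ l, a l * normKernel α (cellCenter l) z := by
  ext z
  rw [synthesis_apply, sum_apply]
  rfl

theorem deriv_synthesis (S : Finset (ℤ × ℤ)) (a : S → ℂ) (z : ℂ) :
    deriv (synthesis α S a) z = ∑ l, a l * deriv (normKernel α (cellCenter l)) z := by
  rw [coe_synthesis]
  have h : ∀ l : S, DifferentiableAt ℂ (normKernel α (cellCenter l)) z :=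
    fun l => differentiable_normKernel α _ z
  rw [deriv_fun_sum fun l _ => (h l).const_mul _]
  exact Finset.sum_congr rfl fun l _ => deriv_const_mul _ (h l)

variable (α) in
/-- The Gram matrix of the kernel functions has Gaussian decay off the diagonal. -/
theorem exists_norm_synthesis_sq_le : ∃ c : ℝ, 0 < c ∧ ∀ (S : Finset (ℤ × ℤ)) (a : S → ℂ),
    ‖synthesis α S a‖ ^ 2 ≤ c ^ 2 * ∑ l, ‖a l‖ ^ 2 := by
  have h0 : 0 < α := hα.out
  obtain ⟨C, hC⟩ := exists_tsum_exp_le one_pos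
  refine ⟨√(Real.exp (1 / (2 * α)) * (C + 1)), by positivity, fun S a => ?_⟩
  rw [Real.sq_sqrt (by positivity)]
  set k : S → FockSpace α := fun l => kernel α (cellCenter l) with hk
  set E : S → S → ℝ := fun i j =>
    Real.exp (1 / (2 * α)) * Real.exp (-1 * ‖cellCenter i - cellCenter j‖) with hE
  have hin : ∀ i j, ‖inner ℂ (k i) (k j)‖ ≤ E i j := by
    intro i j
    simp only [hk, hE]
    rw [norm_inner_kernel_kernel, ← Real.exp_add]
    refine Real.exp_le_exp.2 ?_
    set d := ‖cellCenter i - cellCenter j‖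
    have : 1 / (2 * α) + -1 * d - -(α / 2) * d ^ 2 = (α * d - 1) ^ 2 / (2 * α) := by
      field_simp; ring
    have h6 : 0 ≤ (α * d - 1) ^ 2 / (2 * α) := by positivity
    linarith
  have hrow : ∀ i, ∑ j, E i j ≤ Real.exp (1 / (2 * α)) * (C + 1) := by
    intro i
    rw [hE, ← Finset.mul_sum]
    gcongr
    exact (sum_exp_le_of_tsum_le hC S (cellCenter i)).trans (by linarith)
  have hsym : ∀ i j, E i j = E j i := fun i j => by simp only [hE]; rw [norm_sub_rev]
  refine le_trans ?_ (sum_mul_mul_le_of_row_sum_le (fun i j => by positivity) hsym hrow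
    fun l => ‖a l‖)
  have h1 : ‖synthesis α S a‖ ^ 2 = ‖inner ℂ (synthesis α S a) (synthesis α S a)‖ := by
    rw [inner_self_eq_norm_sq_to_K, norm_pow, RCLike.norm_ofReal, sq_abs]
  rw [h1, synthesis_apply, sum_inner]
  refine (norm_sum_le _ _).trans (Finset.sum_le_sum fun i _ => ?_)
  rw [inner_sum]
  refine (norm_sum_le _ _).trans (Finset.sum_le_sum fun j _ => ?_)
  rw [inner_smul_left, inner_smul_right, norm_mul, norm_mul, RCLike.norm_conj]
  nlinarith [hin i j, mul_nonneg (norm_nonneg (a i)) (norm_nonneg (a j)),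
    mul_le_mul_of_nonneg_left (hin i j) (mul_nonneg (norm_nonneg (a i)) (norm_nonneg (a j)))]

variable (α) in
/-- On a sufficiently sparse family of cells with large masses the embedding is bounded below on
linear combinations of the kernel functions: on each cell the kernel function of its own centre
dominates. -/
theorem exists_le_derivForm_synthesis : ∃ L : ℕ, 0 < L ∧ ∀ (μ : Measure ℂ) (S : Finset (ℤ × ℤ)),
    (∀ l ∈ S, ∀ k ∈ S, l.1 % L = k.1 % L ∧ l.2 % L = k.2 % L) → ∀ t : ℝ,
    (∀ l ∈ S, ENNReal.ofReal (t ^ 2) ≤ cellMass α μ l) → ∀ a : S → ℂ,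
    ENNReal.ofReal (t ^ 2 / 4 * ∑ l, ‖a l‖ ^ 2) ≤ derivForm μ (synthesis α S a) := by
  have h0 : 0 < α := hα.out
  obtain ⟨C, hC0, hC⟩ := exists_normKernel_le_on_cell h0
  obtain ⟨C', hC'⟩ := exists_tsum_exp_le (a := 1 / 2) (by norm_num)
  -- the spacing makes the interaction between different cells small
  obtain ⟨L, hL0, hL⟩ : ∃ L : ℕ, 0 < L ∧ α * C * C' * Real.exp (-(L : ℝ) / 2) ≤ 1 / 2 := by
    have h1 : Filter.Tendsto (fun L : ℕ => α * C * C' * Real.exp (-((L : ℝ) / 2))) Filter.atTop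
        (nhds (α * C * C' * 0)) :=
      (Real.tendsto_exp_neg_atTop_nhds_zero.comp
        (tendsto_natCast_atTop_atTop.atTop_div_const (by norm_num))).const_mul _
    rw [mul_zero] at h1
    obtain ⟨L, hL1, hL2⟩ := ((h1.eventually_le_const (by norm_num : (0 : ℝ) < 1 / 2)).and
      (Filter.eventually_gt_atTop 0)).exists
    exact ⟨L, hL2, by rwa [neg_div]⟩
  refine ⟨L, hL0, fun μ S hS t hm a => ?_⟩
  set c : S → ℂ := fun l => cellCenter l with hc
  set E : S → S → ℝ := fun i j =>
    if i = j then 0 else α * C * Real.exp (-‖c i - c j‖) with hE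
  have hE0 : ∀ i j, 0 ≤ E i j := fun i j => by simp only [hE]; split_ifs <;> positivity
  have hsym : ∀ i j, E i j = E j i := fun i j => by
    simp only [hE]; rw [norm_sub_rev]; simp only [eq_comm]
  have hrow : ∀ i, ∑ j, E i j ≤ 1 / 2 := by
    intro i
    refine le_trans ?_ hL
    calc ∑ j, E i j ≤ ∑ j, α * C * Real.exp (-(L : ℝ) / 2) * Real.exp (-(1 / 2) * ‖c i - c j‖) := by
          refine Finset.sum_le_sum fun j _ => ?_
          by_cases hij : i = j
          · simp only [hE, if_pos hij]
            positivity
          · simp only [hE, if_neg hij]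
            rw [mul_assoc (α * C), ← Real.exp_add]
            have h1 : (L : ℝ) ≤ ‖c i - c j‖ :=
              le_norm_sub_cellCenter (fun h => hij (Subtype.ext h)) (hS i i.2 j j.2).1
                (hS i i.2 j j.2).2
            gcongr
            linarith
      _ ≤ α * C * Real.exp (-(L : ℝ) / 2) * C' := by
          rw [← Finset.mul_sum]
          gcongr
          exact sum_exp_le_of_tsum_le hC' S (c i)
      _ = _ := by ring
  set b : S → ℝ := fun i => ∑ j, E i j * ‖a j‖ with hb
  have hbsum : ∑ i, b i ^ 2 ≤ (1 / 2) ^ 2 * ∑ l, ‖a l‖ ^ 2 :=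
    sum_sq_sum_mul_le_of_row_sum_le hE0 hsym hrow fun l => ‖a l‖
  have hpt : ∀ i : S, ∀ ζ ∈ unitCell i,
      max (‖a i‖ - b i) 0 ^ 2 * ‖deriv (normKernel α (c i)) ζ‖ ^ 2 ≤
        ‖deriv (synthesis α S a) ζ‖ ^ 2 := by
    intro i ζ hζ
    rw [← mul_pow]
    refine pow_le_pow_left₀ (by positivity) ?_ 2
    rw [max_mul_of_nonneg _ _ (norm_nonneg _), zero_mul]
    refine max_le ?_ (norm_nonneg _)
    rw [deriv_synthesis, ← Finset.add_sum_erase _ _ (Finset.mem_univ i)]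
    have h1 : ‖∑ j ∈ Finset.univ.erase i, a j * deriv (normKernel α (c j)) ζ‖ ≤
        b i * ‖deriv (normKernel α (c i)) ζ‖ := by
      refine (norm_sum_le _ _).trans ?_
      rw [hb, Finset.sum_mul]
      refine le_trans (Finset.sum_le_sum (fun j hj => ?_))
        (Finset.sum_le_sum_of_subset_of_nonneg (Finset.erase_subset i _) fun j _ _ =>
          mul_nonneg (mul_nonneg (hE0 i j) (norm_nonneg _)) (norm_nonneg _))
      have hij : i ≠ j := (Finset.ne_of_mem_erase hj).symm
      simp only [hE, if_neg hij]
      rw [norm_mul, norm_deriv_normKernel h0]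
      have h2 := hC (c j) i ζ hζ
      rw [norm_sub_rev] at h2
      have h3 : ‖c j‖ * ‖normKernel α (c j) ζ‖ ≤ (‖c j‖ + 1) * ‖normKernel α (c j) ζ‖ := by
        gcongr; linarith
      calc ‖a j‖ * (α * ‖c j‖ * ‖normKernel α (c j) ζ‖)
          = ‖a j‖ * α * (‖c j‖ * ‖normKernel α (c j) ζ‖) := by ring
        _ ≤ ‖a j‖ * α * (C * Real.exp (-‖c i - c j‖) * ‖deriv (normKernel α (c i)) ζ‖) := by
            exact mul_le_mul_of_nonneg_left (h3.trans h2) (by positivity)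
        _ = _ := by ring
    have h2 := norm_sub_le_norm_add (a i * deriv (normKernel α (c i)) ζ)
      (∑ j ∈ Finset.univ.erase i, a j * deriv (normKernel α (c j)) ζ)
    rw [norm_mul] at h2
    linarith
  have hnum : ∀ i : S, ‖a i‖ ^ 2 / 2 - b i ^ 2 ≤ max (‖a i‖ - b i) 0 ^ 2 := by
    intro i
    rcases le_total 0 (‖a i‖ - b i) with h | h
    · rw [max_eq_left h]
      nlinarith [sq_nonneg (‖a i‖ - 2 * b i)]
    · rw [max_eq_right h]
      nlinarith [norm_nonneg (a i)]
  have hdisj : Pairwise (Function.onFun Disjoint fun i : S => unitCell i) :=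
    fun i j hij => pairwise_disjoint_unitCell fun h => hij (Subtype.ext h)
  calc ENNReal.ofReal (t ^ 2 / 4 * ∑ l, ‖a l‖ ^ 2)
      ≤ ENNReal.ofReal (∑ i, max (‖a i‖ - b i) 0 ^ 2 * t ^ 2) := by
        refine ENNReal.ofReal_le_ofReal ?_
        have h1 := Finset.sum_le_sum fun i (_ : i ∈ Finset.univ) => hnum i
        rw [Finset.sum_sub_distrib, ← Finset.sum_div] at h1
        rw [← Finset.sum_mul]
        nlinarith [sq_nonneg t]
    _ = ∑ i, ENNReal.ofReal (max (‖a i‖ - b i) 0 ^ 2) * ENNReal.ofReal (t ^ 2) := by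
        rw [ENNReal.ofReal_sum_of_nonneg fun i _ => by positivity]
        exact Finset.sum_congr rfl fun i _ => ENNReal.ofReal_mul (by positivity)
    _ ≤ ∑ i : S, ENNReal.ofReal (max (‖a i‖ - b i) 0 ^ 2) * cellMass α μ i := by
        gcongr with i
        exact hm i i.2
    _ ≤ ∑ i : S, ∫⁻ ζ in unitCell i, ENNReal.ofReal (‖deriv (synthesis α S a) ζ‖ ^ 2) ∂μ := by
        refine Finset.sum_le_sum fun i _ => ?_
        rw [cellMass, ← lintegral_const_mul' _ _ ENNReal.ofReal_ne_top]
        refine setLIntegral_mono_ae' (measurableSet_unitCell i)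
          (Filter.Eventually.of_forall fun ζ hζ => ?_)
        rw [← ENNReal.ofReal_mul (by positivity)]
        exact ENNReal.ofReal_le_ofReal (hpt i ζ hζ)
    _ ≤ derivForm μ (synthesis α S a) := by
        rw [← tsum_fintype (L := SummationFilter.unconditional S),
          ← lintegral_iUnion (fun i : S => measurableSet_unitCell i) hdisj]
        exact setLIntegral_le_lintegral _ _

/-! ### The lower estimate for the singular values -/

variable (α) in
/-- If `T` dominates the embedding of the Fock space by `f ↦ f'` into `L²(μ)`, the singular values
of `T` dominate the Berezin transform of `μ`. -/
theorem exists_lintegral_berezinOf_le_tsum_rpow {p : ℝ} (hp : 0 < p) :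
    ∃ K : ℝ≥0, ∀ (μ : Measure ℂ) (T : FockSpace α →L[ℂ] FockSpace α) (D : ℝ≥0)
      (e u : ℕ → FockSpace α) (s : ℕ → ℝ), 0 < D → IsSchmidtDecomposition T e u s →
      (∀ f : FockSpace α, derivForm μ f ≤ D * ENNReal.ofReal (‖T f‖ ^ 2)) →
      ∫⁻ w, berezinOf α μ w ^ (p / 2) ≤
        K * (D : ℝ≥0∞) ^ (p / 2) * ∑' n, ENNReal.ofReal (s n ^ p) := by
  have h0 : 0 < α := hα.out
  have hq : 0 < p / 2 := by positivity
  obtain ⟨C, hC⟩ := exists_lintegral_berezinOf_rpow_le h0 hq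
  obtain ⟨c, hc0, hc⟩ := exists_norm_synthesis_sq_le α
  obtain ⟨L, hL0, hL⟩ := exists_le_derivForm_synthesis α
  refine ⟨C * (L * L * ((4 * c) ^ p).toNNReal), fun μ T D e u s hD hT hDT => (hC μ).trans ?_⟩
  have hcell : ∀ l, cellMass α μ l ≠ ∞ := by
    intro l
    refine ne_top_of_le_ne_top ?_ ((setLIntegral_le_lintegral _ _).trans
      (hDT (kernel α (cellCenter l))))
    exact ENNReal.mul_ne_top ENNReal.coe_ne_top ENNReal.ofReal_ne_top
  set m : ℤ × ℤ → ℝ := fun l => √((cellMass α μ l).toReal) with hm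
  have hD0 : (0 : ℝ) < D := hD
  have hmp : ∀ l, cellMass α μ l ^ (p / 2) = ENNReal.ofReal (m l ^ p) := by
    intro l
    simp only [hm]
    rw [Real.sqrt_eq_rpow, ← Real.rpow_mul ENNReal.toReal_nonneg, ← ENNReal.ofReal_rpow_of_nonneg
      ENNReal.toReal_nonneg (by positivity), ENNReal.ofReal_toReal (hcell l)]
    congr 1
    ring
  set Z₀ := ∑' n, ENNReal.ofReal (s n ^ p) with hZ₀
  -- the estimate on a sparse class of cells
  have hclass : ∀ F : Finset (ℤ × ℤ),
      (∀ l ∈ F, ∀ k ∈ F, l.1 % L = k.1 % L ∧ l.2 % L = k.2 % L) →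
      ∑ l ∈ F, cellMass α μ l ^ (p / 2) ≤
        ENNReal.ofReal ((4 * c) ^ p) * (D : ℝ≥0∞) ^ (p / 2) * Z₀ := by
    intro F hF
    have h1 : ∑ l ∈ F, ENNReal.ofReal (m l ^ p) ≤
        ∑' n, ENNReal.ofReal ((4 * c * √(D : ℝ) * s n) ^ p) := by
      refine sum_rpow_le_tsum_rpow F (fun l => Real.sqrt_nonneg _)
        (fun n => mul_nonneg (by positivity) (hT.nonneg n)) hp fun t ht => ?_
      set S := F.filter fun l => t < m l with hS
      have h2 := hT.card_le_encard (V := synthesis α S) (c := c) (t := t / (2 * √(D : ℝ))) hc0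
        (by positivity) (hc S) ?_
      · rw [Fintype.card_coe] at h2
        refine h2.trans (Set.encard_le_encard fun n hn => ?_)
        simp only [Set.mem_ofPred_eq] at hn ⊢
        rw [div_lt_iff₀ (by positivity)] at hn
        linarith
      · intro a
        have h3 := (hL μ S (fun l hl k hk => hF l (Finset.mem_filter.1 hl).1 k
          (Finset.mem_filter.1 hk).1) t (fun l hl => ?_) a).trans (hDT _)
        · have h4 : (D : ℝ≥0∞) = ENNReal.ofReal D := (ENNReal.ofReal_coe_nnreal).symm
          rw [h4, ← ENNReal.ofReal_mul hD0.le,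
            ENNReal.ofReal_le_ofReal_iff (by positivity)] at h3
          rw [div_pow, mul_pow, Real.sq_sqrt hD0.le, div_mul_eq_mul_div,
            div_le_iff₀ (by positivity)]
          linarith
        · have h4 : t < m l := (Finset.mem_filter.1 hl).2
          simp only [hm] at h4
          rw [Real.lt_sqrt ht.le] at h4
          exact ENNReal.ofReal_le_of_le_toReal h4.le
    simp_rw [hmp]
    refine h1.trans (le_of_eq ?_)
    rw [hZ₀, ← ENNReal.tsum_mul_left]
    congr 1
    ext n
    have h5 : (D : ℝ≥0∞) ^ (p / 2) = ENNReal.ofReal (√(D : ℝ) ^ p) := by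
      rw [Real.sqrt_eq_rpow, ← Real.rpow_mul hD0.le, ← ENNReal.ofReal_rpow_of_nonneg hD0.le
        (by positivity), ENNReal.ofReal_coe_nnreal]
      congr 1
      ring
    rw [h5, ← ENNReal.ofReal_mul (by positivity), ← ENNReal.ofReal_mul (by positivity),
      Real.mul_rpow (by positivity) (hT.nonneg n), Real.mul_rpow (by positivity) (by positivity)]
  rw [ENNReal.coe_mul, mul_assoc, mul_assoc]
  refine mul_le_mul_right ?_ _
  rw [ENNReal.tsum_eq_iSup_sum]
  refine iSup_le fun F => ?_
  set r : ℤ × ℤ → ℤ × ℤ := fun l => (l.1 % L, l.2 % L) with hr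
  set Z : Finset (ℤ × ℤ) := Finset.Ico 0 (L : ℤ) ×ˢ Finset.Ico 0 (L : ℤ) with hZ
  have hL' : (0 : ℤ) < L := by exact_mod_cast hL0
  have hmaps : ∀ l ∈ F, r l ∈ Z := fun l _ => by
    simp only [hZ, hr, Finset.mem_product, Finset.mem_Ico]
    exact ⟨⟨Int.emod_nonneg _ hL'.ne', Int.emod_lt_of_pos _ hL'⟩,
      ⟨Int.emod_nonneg _ hL'.ne', Int.emod_lt_of_pos _ hL'⟩⟩
  rw [← Finset.sum_fiberwise_of_maps_to hmaps]
  refine (Finset.sum_le_card_nsmul Z _ _ fun x _ => hclass _ fun l hl k hk => ?_).trans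
    (le_of_eq ?_)
  · have h1 : r l = r k := (Finset.mem_filter.1 hl).2.trans (Finset.mem_filter.1 hk).2.symm
    exact ⟨congrArg Prod.fst h1, congrArg Prod.snd h1⟩
  · rw [hZ, Finset.card_product, Int.card_Ico, sub_zero, Int.toNat_natCast, nsmul_eq_mul,
      ENNReal.coe_mul, ENNReal.coe_mul]
    push_cast
    change _ = _ * ENNReal.ofReal _ * _
    ring

end FockSpace

/-! ### The measures of the operators -/

/-- The image under `ψ` of the measure `Q_G² dm`. -/
noncomputable def symbolMeasure (α : ℝ) (G ψ : ℂ → ℂ) : Measure ℂ :=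
  (volume.withDensity fun z => ENNReal.ofReal (weightQ α G z ^ 2)).map ψ

instance (α : ℝ) (G ψ : ℂ → ℂ) : SFinite (symbolMeasure α G ψ) := by
  unfold symbolMeasure; infer_instance

theorem lintegral_symbolMeasure (α : ℝ) {G ψ : ℂ → ℂ} (hG : Continuous G) (hψ : Continuous ψ)
    {F : ℂ → ℝ≥0∞} (hF : Measurable F) :
    ∫⁻ ζ, F ζ ∂symbolMeasure α G ψ = ∫⁻ z, ENNReal.ofReal (weightQ α G z ^ 2) * F (ψ z) := by
  have hm : Measurable fun z => ENNReal.ofReal (weightQ α G z ^ 2) :=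
    ((continuous_weightQ α hG).measurable.pow_const 2).ennreal_ofReal
  rw [symbolMeasure, lintegral_map hF hψ.measurable]
  exact lintegral_withDensity_eq_lintegral_mul _ hm (hF.comp hψ.measurable)

theorem berezinI_eq_berezinOf (α : ℝ) {G ψ : ℂ → ℂ} (hG : Continuous G) (hψ : Continuous ψ) :
    berezinI α G ψ = berezinOf α (symbolMeasure α G ψ) := by
  ext w
  have hm : Measurable fun ζ => ENNReal.ofReal ((‖w‖ + 1) ^ 2 * ‖normKernel α w ζ‖ ^ 2) :=
    (((differentiable_normKernel α w).continuous.measurable.norm.pow_const 2).const_mul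
      _).ennreal_ofReal
  rw [berezinI, berezinOf, lintegral_symbolMeasure α hG hψ hm]
  refine lintegral_congr fun z => ?_
  rw [← ENNReal.ofReal_mul (by positivity), ← ofReal_norm,
    ← ENNReal.ofReal_pow (norm_nonneg _), norm_mul, norm_mul, Complex.norm_real,
    Complex.norm_real, mul_pow, mul_pow, Real.norm_eq_abs, Real.norm_eq_abs, sq_abs, sq_abs]
  congr 1
  ring

theorem berezinC_eq_berezinI (α : ℝ) (g ψ : ℂ → ℂ) :
    berezinC α g ψ = berezinI α (fun z => g (ψ z) * deriv ψ z) ψ := by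
  ext w
  rw [berezinC, berezinI]
  refine lintegral_congr fun z => ?_
  rw [← ofReal_norm, ← ofReal_norm]
  congr 2
  simp only [norm_mul, Complex.norm_real, weightQ, Function.comp_apply, norm_norm]
  ring

theorem derivForm_symbolMeasure (α : ℝ) {f G ψ : ℂ → ℂ} (hf : Differentiable ℂ f)
    (hG : Continuous G) (hψ : Continuous ψ) : derivForm (symbolMeasure α G ψ) f =
      ∫⁻ z, ENNReal.ofReal (weightQ α (fun z => deriv f (ψ z) * G z) z ^ 2) := by
  rw [derivForm, lintegral_symbolMeasure α hG hψ
    ((deriv_continuous hf).measurable.norm.pow_const 2).ennreal_ofReal]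
  refine lintegral_congr fun z => ?_
  rw [← ENNReal.ofReal_mul (by positivity)]
  congr 1
  simp only [weightQ, norm_mul]
  ring

/-! ### Schatten norms and Berezin norms -/

theorem HasSchattenNorm.exists_schmidt {H : Type*} [NormedAddCommGroup H] [InnerProductSpace ℂ H]
    {p : ℝ} (hp : 0 < p) {T : H →L[ℂ] H} {r : ℝ} (h : HasSchattenNorm p T r) :
    ∃ (e u : ℕ → H) (s : ℕ → ℝ), IsSchmidtDecomposition T e u s ∧
      ENNReal.ofReal r = (∑' n, ENNReal.ofReal (s n ^ p)) ^ (1 / p) := by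
  obtain ⟨e, u, s, hs, hsum, rfl⟩ := h
  have h0 : ∀ n, 0 ≤ s n ^ p := fun n => Real.rpow_nonneg (hs.nonneg n) p
  refine ⟨e, u, s, hs, ?_⟩
  rw [← ENNReal.ofReal_tsum_of_nonneg h0 hsum,
    ENNReal.ofReal_rpow_of_nonneg (tsum_nonneg h0) (by positivity)]

theorem rpow_one_div_le_of_le_mul {p : ℝ} (hp : 0 < p) {K : ℝ≥0} {x y : ℝ≥0∞} (h : x ≤ K * y) :
    x ^ (1 / p) ≤ (K ^ (1 / p) : ℝ≥0) * y ^ (1 / p) := by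
  rw [ENNReal.coe_rpow_of_nonneg _ (by positivity), ← ENNReal.mul_rpow_of_nonneg _ _ (by positivity)]
  exact ENNReal.rpow_le_rpow h (by positivity)

namespace FockSpace

variable {α : ℝ} [hα : Fact (0 < α)]

variable (α) in
theorem exists_derivForm_symbolMeasure_le : ∃ D : ℝ≥0, 0 < D ∧ ∀ (f h : FockSpace α) (G ψ : ℂ → ℂ),
    Continuous G → Continuous ψ → (∀ z, HasDerivAt h (deriv f (ψ z) * G z) z) →
    derivForm (symbolMeasure α G ψ) f ≤ D * ENNReal.ofReal (‖h‖ ^ 2) := by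
  have h0 : 0 < α := hα.out
  obtain ⟨C, hC⟩ := exists_lintegral_weightQ_deriv_le h0
  refine ⟨(C + 1) * (Real.pi / α).toNNReal, by positivity, fun f h G ψ hG hψ hd => ?_⟩
  have h1 : deriv h = fun z => deriv f (ψ z) * G z := funext fun z => (hd z).deriv
  rw [derivForm_symbolMeasure α f.differentiable hG hψ, ← h1]
  refine (hC h h.differentiable).trans ?_
  rw [lintegral_fockDensity, ENNReal.coe_mul, ← mul_assoc]
  change C * ENNReal.ofReal (Real.pi / α) * _ ≤ _ * ENNReal.ofReal (Real.pi / α) * _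
  gcongr
  exact le_self_add

variable (α) in
theorem exists_lintegral_fockDensity_le_derivForm : ∃ C : ℝ≥0, ∀ (f h G ψ : ℂ → ℂ),
    Differentiable ℂ f → Continuous G → Continuous ψ →
    (∀ z, HasDerivAt h (deriv f (ψ z) * G z) z) →
    ∫⁻ z, ENNReal.ofReal (fockDensity α h z) ≤
      C * (ENNReal.ofReal (‖h 0‖ ^ 2) + derivForm (symbolMeasure α G ψ) f) := by
  obtain ⟨C, hC⟩ := exists_lintegral_fockDensity_le (hα.out : 0 < α)
  refine ⟨C, fun f h G ψ hf hG hψ hd => ?_⟩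
  have h1 : deriv h = fun z => deriv f (ψ z) * G z := funext fun z => (hd z).deriv
  rw [derivForm_symbolMeasure α hf hG hψ, ← h1]
  exact hC h fun z => (hd z).differentiableAt

variable (α) in
theorem exists_norm_sq_le_derivForm (A : ℝ≥0) : ∃ D : ℝ≥0, ∀ (f h : FockSpace α) (G ψ : ℂ → ℂ),
    Continuous G → Continuous ψ → (∀ z, HasDerivAt h (deriv f (ψ z) * G z) z) →
    ENNReal.ofReal (‖h 0‖ ^ 2) ≤ A * derivForm (symbolMeasure α G ψ) f →
    ENNReal.ofReal (‖h‖ ^ 2) ≤ D * derivForm (symbolMeasure α G ψ) f := by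
  obtain ⟨C, hC⟩ := exists_lintegral_fockDensity_le_derivForm α
  refine ⟨(α / Real.pi).toNNReal * (C * (A + 1)), fun f h G ψ hG hψ hd hA => ?_⟩
  rw [ofReal_norm_sq, ENNReal.coe_mul, mul_assoc]
  refine mul_le_mul_right ((hC f h G ψ f.differentiable hG hψ hd).trans ?_) _
  rw [ENNReal.coe_mul, mul_assoc]
  refine mul_le_mul_right ?_ _
  push_cast
  rw [add_mul, one_mul]
  gcongr

variable (α) in
/-- The Schatten norm of an operator with `(T f)' = f'(ψ) G` dominates the Berezin norm. -/
theorem exists_berezinNorm_le {p : ℝ} (hp : 0 < p) : ∃ K : ℝ≥0, ∀ (G ψ : ℂ → ℂ), Continuous G →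
    Continuous ψ → ∀ (T : FockSpace α →L[ℂ] FockSpace α) (r : ℝ),
    (∀ (f : FockSpace α) z, HasDerivAt (T f) (deriv f (ψ z) * G z) z) → HasSchattenNorm p T r →
    berezinNorm p (berezinI α G ψ) ≤ K * ENNReal.ofReal r := by
  obtain ⟨D, hD0, hD⟩ := exists_derivForm_symbolMeasure_le α
  obtain ⟨K, hK⟩ := exists_lintegral_berezinOf_le_tsum_rpow α hp
  refine ⟨(K * D ^ (p / 2)) ^ (1 / p), fun G ψ hG hψ T r hT hr => ?_⟩
  obtain ⟨e, u, s, hs, hrs⟩ := hr.exists_schmidt hp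
  rw [hrs, berezinI_eq_berezinOf α hG hψ]
  refine rpow_one_div_le_of_le_mul hp ?_
  rw [ENNReal.coe_mul, ENNReal.coe_rpow_of_nonneg _ (by positivity)]
  exact hK _ T D e u s hD0 hs fun f => hD f (T f) G ψ hG hψ (hT f)

variable (α) in
/-- The Berezin norm dominates the Schatten norm of an operator with `(T f)' = f'(ψ) G`, as soon as
the value `T f 0` is controlled by the derivative. -/
theorem exists_schattenNorm_le {p : ℝ} (hp : 0 < p) (A : ℝ≥0) : ∃ K : ℝ≥0, ∀ (G ψ : ℂ → ℂ),
    Continuous G → Continuous ψ → ∀ (T : FockSpace α →L[ℂ] FockSpace α) (r : ℝ),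
    (∀ (f : FockSpace α) z, HasDerivAt (T f) (deriv f (ψ z) * G z) z) →
    (∀ f : FockSpace α,
      ENNReal.ofReal (‖T f 0‖ ^ 2) ≤ A * derivForm (symbolMeasure α G ψ) f) →
    HasSchattenNorm p T r → ENNReal.ofReal r ≤ K * berezinNorm p (berezinI α G ψ) := by
  obtain ⟨D, hD⟩ := exists_norm_sq_le_derivForm α A
  obtain ⟨K, hK⟩ := exists_tsum_rpow_le_berezinOf α hp
  refine ⟨(K * D ^ (p / 2)) ^ (1 / p), fun G ψ hG hψ T r hT hA hr => ?_⟩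
  obtain ⟨e, u, s, hs, hrs⟩ := hr.exists_schmidt hp
  rw [hrs, berezinI_eq_berezinOf α hG hψ]
  refine rpow_one_div_le_of_le_mul hp ?_
  rw [ENNReal.coe_mul, ENNReal.coe_rpow_of_nonneg _ (by positivity)]
  exact hK _ T D e u s hs fun f => hD f (T f) G ψ hG hψ (hT f) (hA f)

/-- A linear map into the entire functions, given by a formula, is a bounded operator on the Fock
space if it satisfies a norm estimate. -/
theorem exists_isGivenBy {A : (ℂ → ℂ) → ℂ → ℂ}
    (hadd : ∀ f h : ℂ → ℂ, Differentiable ℂ f → Differentiable ℂ h →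
      ∀ z, A (fun x => f x + h x) z = A f z + A h z)
    (hsmul : ∀ (c : ℂ) (f : ℂ → ℂ), Differentiable ℂ f → ∀ z, A (fun x => c * f x) z = c * A f z)
    (hdiff : ∀ f : ℂ → ℂ, Differentiable ℂ f → Differentiable ℂ (A f)) {C : ℝ≥0}
    (hC : ∀ f : FockSpace α, ∫⁻ z, ENNReal.ofReal (fockDensity α (A f) z) ≤
      C * ENNReal.ofReal (‖f‖ ^ 2)) :
    ∃ T : FockSpace α →L[ℂ] FockSpace α, IsGivenBy T A := by
  have h0 : 0 < α := hα.out
  have hfin : ∀ f : FockSpace α, ∫⁻ z, ENNReal.ofReal (fockDensity α (A f) z) ≠ ∞ := fun f =>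
    ne_top_of_le_ne_top (ENNReal.mul_ne_top ENNReal.coe_ne_top ENNReal.ofReal_ne_top) (hC f)
  let L : FockSpace α →ₗ[ℂ] FockSpace α :=
    { toFun := fun f => mk (A f) (hdiff f f.differentiable) (hfin f)
      map_add' := fun f h => DFunLike.ext _ _ fun z =>
        hadd f h f.differentiable h.differentiable z
      map_smul' := fun c f => DFunLike.ext _ _ fun z => hsmul c f f.differentiable z }
  refine ⟨L.mkContinuous √(α / Real.pi * C) fun f => ?_, fun f z => rfl⟩
  rw [← Real.sqrt_sq (norm_nonneg f), ← Real.sqrt_mul (by positivity)]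
  refine Real.le_sqrt_of_sq_le ?_
  rw [← ENNReal.ofReal_le_ofReal_iff (by positivity), ofReal_norm_sq, mul_assoc,
    ENNReal.ofReal_mul (by positivity), ENNReal.ofReal_mul (by positivity),
    ENNReal.ofReal_coe_nnreal]
  exact mul_le_mul_right (hC f) _

/-- An operator with `(T f)' = f'(ψ) G` belongs to the Schatten class if the Berezin norm is finite
and the value `T f 0` is controlled by the derivative. -/
theorem memSchatten_of_lintegral_berezinOf {p : ℝ} (hp : 0 < p) {G ψ : ℂ → ℂ} (hG : Continuous G)
    (hψ : Continuous ψ) {T : FockSpace α →L[ℂ] FockSpace α}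
    (hT : ∀ (f : FockSpace α) z, HasDerivAt (T f) (deriv f (ψ z) * G z) z) {A : ℝ≥0}
    (hA : ∀ f : FockSpace α,
      ENNReal.ofReal (‖T f 0‖ ^ 2) ≤ A * derivForm (symbolMeasure α G ψ) f)
    (hB : ∫⁻ w, berezinOf α (symbolMeasure α G ψ) w ^ (p / 2) ≠ ∞) : MemSchatten p T := by
  obtain ⟨D, hD⟩ := exists_norm_sq_le_derivForm α A
  obtain ⟨K, hK⟩ := exists_tsum_rpow_le_berezinOf α hp
  have hTD : ∀ f : FockSpace α,
      ENNReal.ofReal (‖T f‖ ^ 2) ≤ D * derivForm (symbolMeasure α G ψ) f :=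
    fun f => hD f (T f) G ψ hG hψ (hT f) (hA f)
  obtain ⟨⟨M, hM⟩, hvan⟩ := berezinOf_bounded_and_vanishing hα.out (by positivity : 0 < p / 2) hB
  obtain ⟨e, u, s, hs⟩ := exists_schmidt_of_isCompactOperator not_finiteDimensional
    (isCompactOperator_of_berezinOf_tendsto_zero hM hvan hTD)
  have hsum := hK _ T D e u s hs hTD
  refine ⟨_, e, u, s, hs, ?_, rfl⟩
  have h1 : ∑' n, ENNReal.ofReal (s n ^ p) ≠ ∞ := ne_top_of_le_ne_top
    (ENNReal.mul_ne_top (ENNReal.mul_ne_top ENNReal.coe_ne_top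
      (ENNReal.rpow_ne_top_of_nonneg (by positivity) ENNReal.coe_ne_top)) hB) hsum
  refine (ENNReal.summable_toReal h1).congr fun n => ?_
  exact ENNReal.toReal_ofReal (Real.rpow_nonneg (hs.nonneg n) p)

/-- If the Berezin norm is finite, the formula `A` with `(A f)' = f'(ψ) G` defines an operator in
the Schatten class, provided that the value `A f 0` is controlled by the derivative. -/
theorem exists_memSchatten {p : ℝ} (hp : 0 < p) {G ψ : ℂ → ℂ} (hG : Continuous G)
    (hψ : Continuous ψ) {A : (ℂ → ℂ) → ℂ → ℂ}
    (hadd : ∀ f h : ℂ → ℂ, Differentiable ℂ f → Differentiable ℂ h →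
      ∀ z, A (fun x => f x + h x) z = A f z + A h z)
    (hsmul : ∀ (c : ℂ) (f : ℂ → ℂ), Differentiable ℂ f → ∀ z, A (fun x => c * f x) z = c * A f z)
    (hd : ∀ f : ℂ → ℂ, Differentiable ℂ f → ∀ z, HasDerivAt (A f) (deriv f (ψ z) * G z) z)
    {B : ℝ≥0} (hA : ∀ f : ℂ → ℂ, Differentiable ℂ f →
      ENNReal.ofReal (‖A f 0‖ ^ 2) ≤ B * derivForm (symbolMeasure α G ψ) f)
    (hB : ∫⁻ w, berezinOf α (symbolMeasure α G ψ) w ^ (p / 2) ≠ ∞) :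
    ∃ T : FockSpace α →L[ℂ] FockSpace α, IsGivenBy T A ∧ MemSchatten p T := by
  obtain ⟨⟨M, hM⟩, -⟩ := berezinOf_bounded_and_vanishing hα.out (by positivity : 0 < p / 2) hB
  obtain ⟨C₁, hC₁⟩ := exists_derivForm_le_norm_sq α
  obtain ⟨C, hC⟩ := exists_lintegral_fockDensity_le_derivForm α
  obtain ⟨T, hT⟩ := exists_isGivenBy (α := α) hadd hsmul
    (fun f hf z => (hd f hf z).differentiableAt) (C := C * ((B + 1) * (C₁ * M))) fun f => by
      refine (hC f (A f) G ψ f.differentiable hG hψ (hd f f.differentiable)).trans ?_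
      rw [ENNReal.coe_mul, mul_assoc]
      refine mul_le_mul_right ?_ _
      calc _ ≤ B * derivForm (symbolMeasure α G ψ) f + derivForm (symbolMeasure α G ψ) f := by
            gcongr
            exact hA f f.differentiable
        _ = (B + 1) * derivForm (symbolMeasure α G ψ) f := by ring
        _ ≤ (B + 1) * (C₁ * M * ENNReal.ofReal (‖f‖ ^ 2)) := by
            gcongr
            exact hC₁ _ M hM f
        _ = _ := by push_cast; ring
  have hTA : ∀ f : FockSpace α, ⇑(T f) = A f := fun f => funext (hT f)
  refine ⟨T, hT, memSchatten_of_lintegral_berezinOf hp hG hψ (A := B) (fun f z => ?_)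
    (fun f => ?_) hB⟩
  · rw [hTA]; exact hd f f.differentiable z
  · rw [hTA]; exact hA f f.differentiable

end FockSpace

/-! ### The integral operators -/

theorem segmentIntegral_zero_right (h : ℂ → ℂ) : segmentIntegral h 0 = 0 := by
  simp [segmentIntegral]

theorem segmentIntegral_add {h k : ℂ → ℂ} (hh : Continuous h) (hk : Continuous k) (z : ℂ) :
    segmentIntegral (fun w => h w + k w) z = segmentIntegral h z + segmentIntegral k z := by
  unfold segmentIntegral
  rw [← intervalIntegral.integral_add (Continuous.intervalIntegrable (by fun_prop) _ _)
    (Continuous.intervalIntegrable (by fun_prop) _ _)]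
  simp_rw [add_mul]

theorem segmentIntegral_const_mul (c : ℂ) (h : ℂ → ℂ) (z : ℂ) :
    segmentIntegral (fun w => c * h w) z = c * segmentIntegral h z := by
  unfold segmentIntegral
  rw [← intervalIntegral.integral_const_mul]
  simp_rw [mul_assoc]

section Operators

variable {g ψ f h : ℂ → ℂ}

theorem opI_add (hg : Differentiable ℂ g) (hψ : Differentiable ℂ ψ) (hf : Differentiable ℂ f)
    (hh : Differentiable ℂ h) (z : ℂ) :
    opI g ψ (fun x => f x + h x) z = opI g ψ f z + opI g ψ h z := by
  have h1 := deriv_continuous hf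
  have h2 := deriv_continuous hh
  have h3 := hg.continuous
  have h4 := hψ.continuous
  unfold opI
  rw [← segmentIntegral_add (by fun_prop) (by fun_prop)]
  congr 1
  ext w
  rw [deriv_fun_add (hf _) (hh _)]
  ring

theorem opI_const_mul (c : ℂ) (hf : Differentiable ℂ f) (z : ℂ) :
    opI g ψ (fun x => c * f x) z = c * opI g ψ f z := by
  unfold opI
  rw [← segmentIntegral_const_mul]
  congr 1
  ext w
  rw [deriv_const_mul _ (hf _)]
  ring

theorem hasDerivAt_opI (hg : Differentiable ℂ g) (hψ : Differentiable ℂ ψ)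
    (hf : Differentiable ℂ f) (z : ℂ) : HasDerivAt (opI g ψ f) (deriv f (ψ z) * g z) z :=
  hasDerivAt_segmentIntegral (h := fun w => deriv f (ψ w) * g w) ((hf.deriv.comp hψ).mul hg) z

theorem opI_apply_zero : opI g ψ f 0 = 0 := segmentIntegral_zero_right _

/-- The values of `C_{(g,ψ)}` are those of `I_{(g,id)}` along `ψ`. -/
theorem opC_eq_opI_comp (g ψ f : ℂ → ℂ) (z : ℂ) : opC g ψ f z = opI g id f (ψ z) := rfl

theorem hasDerivAt_opC (hg : Differentiable ℂ g) (hψ : Differentiable ℂ ψ)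
    (hf : Differentiable ℂ f) (z : ℂ) :
    HasDerivAt (opC g ψ f) (deriv f (ψ z) * (g (ψ z) * deriv ψ z)) z := by
  rw [← mul_assoc]
  exact (hasDerivAt_opI hg differentiable_id hf (ψ z)).comp z (hψ z).hasDerivAt

end Operators

/-! ### The value at the origin of a composition with a non-constant function -/

theorem ofReal_norm_sq_le_of_deriv {Y : ℂ → ℂ} (hY : Differentiable ℂ Y) (hY0 : Y 0 = 0) {R : ℝ}
    (hR : 0 < R) {B : ℝ≥0∞} (hB : ∀ z, ‖z‖ ≤ R → ENNReal.ofReal (‖deriv Y z‖ ^ 2) ≤ B) {z : ℂ}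
    (hz : ‖z‖ ≤ R) : ENNReal.ofReal (‖Y z‖ ^ 2) ≤ ENNReal.ofReal (R ^ 2) * B := by
  rcases eq_or_ne B ∞ with rfl | hBt
  · rw [ENNReal.mul_top (by simpa using hR.ne')]
    exact le_top
  have h1 : ∀ z ∈ Metric.closedBall (0 : ℂ) R, ‖deriv Y z‖ ≤ √B.toReal := fun z hz => by
    refine Real.le_sqrt_of_sq_le ?_
    exact (ENNReal.ofReal_le_iff_le_toReal hBt).1 (hB z (by simpa using hz))
  have h2 := (convex_closedBall (0 : ℂ) R).norm_image_sub_le_of_norm_deriv_le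
    (fun z _ => hY z) h1 (Metric.mem_closedBall_self hR.le) (by simpa using hz : z ∈ _)
  rw [hY0, sub_zero, sub_zero] at h2
  rw [← ENNReal.ofReal_toReal hBt, ← ENNReal.ofReal_mul (by positivity)]
  refine ENNReal.ofReal_le_ofReal ?_
  calc ‖Y z‖ ^ 2 ≤ (√B.toReal * R) ^ 2 := by
        refine pow_le_pow_left₀ (norm_nonneg _) (h2.trans ?_) 2
        gcongr
    _ = _ := by rw [mul_pow, Real.sq_sqrt ENNReal.toReal_nonneg]; ring

theorem exists_ofReal_norm_sub_sq_le {α : ℝ} (hα : 0 < α) {R : ℝ} (hR : 0 < R) :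
    ∃ C : ℝ≥0, ∀ h : ℂ → ℂ, Differentiable ℂ h → ∀ z : ℂ, ‖z‖ ≤ R →
      ENNReal.ofReal (‖h z - h 0‖ ^ 2) ≤
        C * ∫⁻ w, ENNReal.ofReal (weightQ α (deriv h) w ^ 2) := by
  obtain ⟨C, hC⟩ := exists_norm_sq_le_lintegral_weightQ hα R
  refine ⟨(R ^ 2).toNNReal * C, fun h hh z hz => ?_⟩
  rw [ENNReal.coe_mul, mul_assoc]
  refine ofReal_norm_sq_le_of_deriv (Y := fun z => h z - h 0) (hh.sub_const _) (sub_self _) hR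
    (fun w hw => ?_) hz
  rw [deriv_sub_const]
  exact hC (deriv h) hh.deriv w hw

/-- A non-constant entire function has dense range, by Liouville's theorem. -/
theorem dense_range_of_entire {u : ℂ → ℂ} (hu : Differentiable ℂ u) (hne : ∃ z, u z ≠ u 0) :
    DenseRange u := by
  by_contra hd
  rw [DenseRange, Metric.dense_iff] at hd
  push Not at hd
  obtain ⟨c, r, hr, hdisj⟩ := hd
  have hfar : ∀ z, r ≤ ‖u z - c‖ := by
    intro z
    by_contra hz
    rw [not_le, ← dist_eq_norm] at hz
    have : u z ∈ Metric.ball c r ∩ Set.range u := ⟨hz, z, rfl⟩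
    rw [hdisj] at this
    exact this
  have hne0 : ∀ z, u z - c ≠ 0 := fun z => norm_pos_iff.1 (hr.trans_le (hfar z))
  have hd : Differentiable ℂ fun z => (u z - c)⁻¹ :=
    (hu.sub_const c).fun_inv hne0
  have hb : Bornology.IsBounded (Set.range fun z => (u z - c)⁻¹) := by
    refine (Metric.isBounded_closedBall (x := (0 : ℂ)) (r := r⁻¹)).subset ?_
    rintro _ ⟨z, rfl⟩
    rw [mem_closedBall_zero_iff, norm_inv]
    exact inv_anti₀ hr (hfar z)
  obtain ⟨z, hz⟩ := hne
  have h1 := hd.apply_eq_apply_of_bounded hb z 0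
  exact hz (sub_left_injective (inv_injective h1))

/-- A non-constant entire function takes two values that differ by a prescribed amount: its range
is open and dense. -/
theorem exists_sub_eq_of_entire {u : ℂ → ℂ} (hu : Differentiable ℂ u) (hne : ∃ z, u z ≠ u 0)
    (c : ℂ) : ∃ z₁ z₂, u z₁ - u z₂ = c := by
  have hopen : IsOpen (Set.range u) := by
    rcases (hu.differentiableOn.analyticOnNhd isOpen_univ).is_constant_or_isOpenMap with h | h
    · obtain ⟨w, hw⟩ := h
      obtain ⟨z, hz⟩ := hne
      exact absurd ((hw z).trans (hw 0).symm) hz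
    · exact h.isOpen_range
  have hopen' : IsOpen ((fun x => x - c) ⁻¹' Set.range u) := hopen.preimage (by fun_prop)
  obtain ⟨y, ⟨z₂, hz₂⟩, ⟨z₁, hz₁⟩⟩ :=
    (dense_range_of_entire hu hne).inter_open_nonempty _ hopen' ⟨u 0 + c, 0, by simp⟩
  exact ⟨z₁, z₂, by rw [hz₁, hz₂]; ring⟩

theorem exists_eq_exp_of_entire {ψ : ℂ → ℂ} (hψ : Differentiable ℂ ψ) (h0 : ∀ z, ψ z ≠ 0) :
    ∃ u : ℂ → ℂ, Differentiable ℂ u ∧ (∀ z, ψ z = Complex.exp (u z)) := by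
  obtain ⟨P, hP0, hP⟩ := exists_entire_primitive (h := fun z => deriv ψ z / ψ z)
    (hψ.deriv.fun_div hψ h0)
  have hd : ∀ z, HasDerivAt (fun z => ψ z * Complex.exp (-P z)) 0 z := fun z => by
    refine ((hψ z).hasDerivAt.mul (hP z).neg.cexp).congr_deriv ?_
    have := h0 z
    field_simp
    ring
  have hc := is_const_of_deriv_eq_zero (fun z => (hd z).differentiableAt) fun z => (hd z).deriv
  refine ⟨fun z => P z + Complex.log (ψ 0), fun z => ((hP z).add_const _).differentiableAt,
    fun z => ?_⟩
  have h1 := hc z 0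
  simp only [hP0, neg_zero, Complex.exp_zero, mul_one] at h1
  rw [Complex.exp_add, Complex.exp_log (h0 0), ← h1, mul_left_comm, ← Complex.exp_add]
  simp

/-- For non-constant `ψ`, the derivative of `F ∘ ψ` controls `F (ψ 0) - F 0`. If `ψ` has a zero
`z₀`, this difference is that of the values of `F ∘ ψ` at `0` and `z₀`. Otherwise `ψ = e^u`; the
residue of `(F(x) - F(ψ 0))/x` at the origin appears as the change of
`∫ (F ∘ ψ - F(ψ 0)) u'` between two points with the same value of `ψ`. -/
theorem exists_ofReal_norm_sq_le_of_nonconstant {α : ℝ} (hα : 0 < α) {ψ : ℂ → ℂ}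
    (hψ : Differentiable ℂ ψ) (hne : ∃ z, ψ z ≠ ψ 0) :
    ∃ C : ℝ≥0, ∀ F : ℂ → ℂ, Differentiable ℂ F → F 0 = 0 → ENNReal.ofReal (‖F (ψ 0)‖ ^ 2) ≤
      C * ∫⁻ w, ENNReal.ofReal (weightQ α (deriv (F ∘ ψ)) w ^ 2) := by
  by_cases hz : ∃ z₀, ψ z₀ = 0
  · obtain ⟨z₀, hz₀⟩ := hz
    obtain ⟨C, hC⟩ := exists_ofReal_norm_sub_sq_le hα (R := ‖z₀‖ + 1) (by positivity)
    refine ⟨C, fun F hF hF0 => ?_⟩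
    have := hC (F ∘ ψ) (hF.comp hψ) z₀ (by linarith)
    rwa [Function.comp_apply, hz₀, hF0, Function.comp_apply, zero_sub, norm_neg] at this
  · push Not at hz
    obtain ⟨u, hu, hexp⟩ := exists_eq_exp_of_entire hψ hz
    have hune : ∃ z, u z ≠ u 0 := by
      obtain ⟨z, hz⟩ := hne
      exact ⟨z, fun h => hz (by rw [hexp, hexp, h])⟩
    obtain ⟨z₁, z₂, h12⟩ := exists_sub_eq_of_entire hu hune (2 * Real.pi * Complex.I)
    set R := ‖z₁‖ + ‖z₂‖ + 1 with hR
    have hR0 : 0 < R := by positivity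
    have hz₁ : ‖z₁‖ ≤ R := by linarith [norm_nonneg z₂]
    have hz₂ : ‖z₂‖ ≤ R := by linarith [norm_nonneg z₁]
    obtain ⟨C, hC⟩ := exists_ofReal_norm_sub_sq_le hα hR0
    obtain ⟨x₀, hx₀m, hx₀⟩ := (isCompact_closedBall (0 : ℂ) R).exists_isMaxOn
      ⟨0, by simpa using hR0.le⟩ (deriv_continuous hu).norm.continuousOn
    set m := ‖deriv u x₀‖ with hm
    have hderiv : ∀ z, deriv ψ z = ψ z * deriv u z := fun z => by
      have h1 : HasDerivAt ψ (Complex.exp (u z) * deriv u z) z := by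
        have : ψ = fun z => Complex.exp (u z) := funext hexp
        rw [this]
        exact (hu z).hasDerivAt.cexp
      rw [h1.deriv, hexp]
    refine ⟨4 * ((R ^ 2).toNNReal * ((m ^ 2).toNNReal * C)), fun F hF hF0 => ?_⟩
    set W := ∫⁻ w, ENNReal.ofReal (weightQ α (deriv (F ∘ ψ)) w ^ 2) with hW
    have hh : Differentiable ℂ (F ∘ ψ) := hF.comp hψ
    obtain ⟨P, -, hP⟩ := exists_entire_primitive (h := dslope F 0) <| by
      rw [← differentiableOn_univ, Complex.differentiableOn_dslope Filter.univ_mem]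
      exact hF.differentiableOn
    obtain ⟨Y, hY0, hY⟩ := exists_entire_primitive
      (h := fun z => (F (ψ z) - F (ψ 0)) * deriv u z) ((hh.sub_const _).mul hu.deriv)
    have hYd : Differentiable ℂ Y := fun z => (hY z).differentiableAt
    have hds : ∀ x, dslope F 0 x * x = F x := fun x => by
      have := sub_smul_dslope F 0 x
      rw [sub_zero, hF0, sub_zero, smul_eq_mul, mul_comm] at this
      exact this
    have hd : ∀ z, HasDerivAt (fun z => P (ψ z) - Y z - F (ψ 0) * u z) 0 z := fun z => by
      refine ((((hP (ψ z)).comp z (hψ z).hasDerivAt).sub (hY z)).sub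
        ((hu z).hasDerivAt.const_mul _)).congr_deriv ?_
      rw [hderiv, ← mul_assoc, hds]
      ring
    have hc := is_const_of_deriv_eq_zero (fun z => (hd z).differentiableAt)
      (fun z => (hd z).deriv) z₁ z₂
    have hψ12 : ψ z₁ = ψ z₂ := by
      rw [hexp, hexp, ← sub_add_cancel (u z₁) (u z₂), h12, Complex.exp_add, Complex.exp_two_pi_mul_I,
        one_mul]
    have hval : F (ψ 0) * (2 * Real.pi * Complex.I) = Y z₂ - Y z₁ := by
      simp only [hψ12] at hc
      rw [← h12]
      linear_combination -hc
    have hYb : ∀ z, ‖z‖ ≤ R → ENNReal.ofReal (‖Y z‖ ^ 2) ≤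
        ENNReal.ofReal (R ^ 2) * (ENNReal.ofReal (m ^ 2) * (C * W)) := fun z hz =>
      ofReal_norm_sq_le_of_deriv hYd hY0 hR0 (fun w hw => by
        rw [(hY w).deriv, norm_mul, mul_pow, mul_comm, ENNReal.ofReal_mul (by positivity)]
        have h1 : ‖deriv u w‖ ≤ m := hx₀ (by simpa using hw)
        have h2 := hC (F ∘ ψ) hh w hw
        gcongr
        exact h2) hz
    have hnum : ‖F (ψ 0)‖ ^ 2 ≤ 2 * (‖Y z₁‖ ^ 2 + ‖Y z₂‖ ^ 2) := by
      have h1 : ‖F (ψ 0)‖ * (2 * Real.pi) = ‖Y z₂ - Y z₁‖ := by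
        rw [← hval]
        simp [abs_of_pos Real.pi_pos]
      have h2 := norm_sub_le (Y z₂) (Y z₁)
      have h3 : ‖F (ψ 0)‖ ≤ ‖Y z₂‖ + ‖Y z₁‖ := by
        nlinarith [Real.pi_gt_three, norm_nonneg (F (ψ 0))]
      nlinarith [norm_nonneg (F (ψ 0)), sq_nonneg (‖Y z₂‖ - ‖Y z₁‖)]
    calc ENNReal.ofReal (‖F (ψ 0)‖ ^ 2) ≤ ENNReal.ofReal (2 * (‖Y z₁‖ ^ 2 + ‖Y z₂‖ ^ 2)) :=
          ENNReal.ofReal_le_ofReal hnum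
      _ = 2 * (ENNReal.ofReal (‖Y z₁‖ ^ 2) + ENNReal.ofReal (‖Y z₂‖ ^ 2)) := by
          rw [ENNReal.ofReal_mul (by norm_num), ENNReal.ofReal_add (by positivity) (by positivity)]
          simp
      _ ≤ 2 * (ENNReal.ofReal (R ^ 2) * (ENNReal.ofReal (m ^ 2) * (C * W)) +
            ENNReal.ofReal (R ^ 2) * (ENNReal.ofReal (m ^ 2) * (C * W))) := by
          gcongr
          · exact hYb z₁ hz₁
          · exact hYb z₂ hz₂
      _ = _ := by
          push_cast
          change _ = 4 * (ENNReal.ofReal (R ^ 2) * (ENNReal.ofReal (m ^ 2) * C)) * W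
          ring

theorem exists_opC_zero_sq_le_derivForm {α : ℝ} (hα : 0 < α) {ψ : ℂ → ℂ} (hψ : Differentiable ℂ ψ)
    (hne : ∃ z, ψ z ≠ ψ 0) : ∃ A : ℝ≥0, ∀ g f : ℂ → ℂ, Differentiable ℂ g → Differentiable ℂ f →
      ENNReal.ofReal (‖opC g ψ f 0‖ ^ 2) ≤
        A * derivForm (symbolMeasure α (fun z => g (ψ z) * deriv ψ z) ψ) f := by
  obtain ⟨A, hA⟩ := exists_ofReal_norm_sq_le_of_nonconstant hα hψ hne
  refine ⟨A, fun g f hg hf => ?_⟩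
  have hG : Continuous fun z => g (ψ z) * deriv ψ z :=
    (hg.continuous.comp hψ.continuous).mul (deriv_continuous hψ)
  have h1 := hA (opI g id f)
    (fun z => (hasDerivAt_opI hg differentiable_id hf z).differentiableAt) opI_apply_zero
  have h2 : deriv (opI g id f ∘ ψ) = fun z => deriv f (ψ z) * (g (ψ z) * deriv ψ z) :=
    funext fun z => (hasDerivAt_opC hg hψ hf z).deriv
  rwa [h2, ← derivForm_symbolMeasure α hf hG hψ.continuous] at h1

/-! ### Constant symbols -/

namespace FockSpace

variable {α : ℝ} [hα : Fact (0 < α)]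

theorem exists_opI_id_sq_le {g : ℂ → ℂ} (hg : Differentiable ℂ g) (a : ℂ) :
    ∃ B : ℝ≥0, ∀ f : FockSpace α,
      ENNReal.ofReal (‖opI g id f a‖ ^ 2) ≤ B * ENNReal.ofReal (‖f‖ ^ 2) := by
  have h0 : 0 < α := hα.out
  set R := ‖a‖ + 1 with hR
  have hR0 : 0 < R := by positivity
  obtain ⟨C₁, hC₁⟩ := exists_norm_sq_le_lintegral_weightQ h0 R
  obtain ⟨C₂, hC₂⟩ := exists_lintegral_weightQ_deriv_le h0
  obtain ⟨x₀, -, hx₀⟩ := (isCompact_closedBall (0 : ℂ) R).exists_isMaxOn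
    ⟨0, by simpa using hR0.le⟩ hg.continuous.norm.continuousOn
  set m := ‖g x₀‖
  refine ⟨(R ^ 2).toNNReal * ((m ^ 2).toNNReal * (C₁ * (C₂ * (Real.pi / α).toNNReal))),
    fun f => ?_⟩
  have hd := hasDerivAt_opI hg differentiable_id f.differentiable
  refine (ofReal_norm_sq_le_of_deriv (Y := opI g id f) (fun z => (hd z).differentiableAt)
    opI_apply_zero hR0 (B := ENNReal.ofReal (m ^ 2) *
      (C₁ * (C₂ * (ENNReal.ofReal (Real.pi / α) * ENNReal.ofReal (‖f‖ ^ 2)))))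
    (fun w hw => ?_) (by linarith : ‖a‖ ≤ R)).trans (le_of_eq ?_)
  · rw [(hd w).deriv, norm_mul, mul_pow, mul_comm, ENNReal.ofReal_mul (by positivity)]
    have h1 : ‖g w‖ ≤ m := hx₀ (by simpa using hw)
    have h2 := hC₁ (deriv f) f.differentiable.deriv w hw
    have h3 := hC₂ f f.differentiable
    rw [lintegral_fockDensity] at h3
    gcongr
    refine h2.trans ?_
    gcongr
  · push_cast
    change ENNReal.ofReal (R ^ 2) * (ENNReal.ofReal (m ^ 2) *
      (C₁ * (C₂ * (ENNReal.ofReal (Real.pi / α) * _)))) = ENNReal.ofReal (R ^ 2) *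
      (ENNReal.ofReal (m ^ 2) * (C₁ * (C₂ * ENNReal.ofReal (Real.pi / α)))) * _
    ring

/-- An operator whose values are constant functions has rank at most one, so that it belongs to
every Schatten class. -/
theorem memSchatten_of_const {T : FockSpace α →L[ℂ] FockSpace α}
    (hT : ∀ (f : FockSpace α) z, T f z = T f 0) {p : ℝ} (hp : 0 < p) : MemSchatten p T := by
  -- `k_0` is the constant function `1`
  set k : FockSpace α := kernel α 0 with hk
  have hk1 : ‖k‖ = 1 := norm_kernel 0
  have hkz : ∀ z, k z = 1 := fun z => by
    rw [hk, coe_kernel]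
    simp [normKernel]
  have hTk : ∀ f, T f = (T f 0) • k := fun f => DFunLike.ext _ _ fun z => by
    rw [smul_apply, hkz, mul_one, hT]
  set v := T.adjoint k with hv
  have hval : ∀ f, T f 0 = inner ℂ v f := fun f => by
    rw [hv, ContinuousLinearMap.adjoint_inner_left]
    conv_rhs => rw [hTk f]
    have h1 : inner ℂ k k = (1 : ℂ) := by
      rw [inner_self_eq_norm_sq_to_K, hk1]
      simp
    rw [inner_smul_right, h1, mul_one]
  obtain ⟨e, he1, he⟩ : ∃ e : FockSpace α, ‖e‖ = 1 ∧ v = (‖v‖ : ℂ) • e := by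
    rcases eq_or_ne v 0 with h | h
    · exact ⟨k, hk1, by simp [h]⟩
    · have h2 : (‖v‖ : ℂ) ≠ 0 := by exact_mod_cast norm_ne_zero_iff.2 h
      refine ⟨(‖v‖ : ℂ)⁻¹ • v, ?_, by rw [smul_smul, mul_inv_cancel₀ h2, one_smul]⟩
      rw [norm_smul, norm_inv, Complex.norm_real, norm_norm,
        inv_mul_cancel₀ (norm_ne_zero_iff.2 h)]
  have hortho : ∀ x : FockSpace α, ‖x‖ = 1 → Orthonormal ℂ fun _ : Unit => x := fun x hx =>
    ⟨fun _ => hx, fun i j hij => absurd (Subsingleton.elim i j) hij⟩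
  obtain ⟨e', u', s', h, hs⟩ := exists_schmidt_of_countable not_finiteDimensional (T := T)
    (s := fun _ => ‖v‖) (hortho e he1) (hortho k hk1) (fun _ => norm_nonneg v) fun f => by
      have h3 : T f = ((‖v‖ : ℂ) * inner ℂ e f) • k := by
        rw [hTk f, hval]
        conv_lhs => rw [he]
        rw [inner_smul_left, Complex.conj_ofReal]
      rw [h3]
      exact hasSum_unique (fun _ : Unit => ((‖v‖ : ℂ) * inner ℂ e f) • k)
  exact ⟨_, e', u', s', h, hs p hp (hasSum_fintype _).summable, rfl⟩

theorem exists_opC_memSchatten_of_const {p : ℝ} (hp : 0 < p) {g ψ : ℂ → ℂ}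
    (hg : Differentiable ℂ g) (hψ : ∀ z, ψ z = ψ 0) :
    ∃ T : FockSpace α →L[ℂ] FockSpace α, IsGivenBy T (opC g ψ) ∧ MemSchatten p T := by
  obtain ⟨B, hB⟩ := exists_opI_id_sq_le (α := α) hg (ψ 0)
  obtain ⟨C, hC⟩ := exists_lintegral_fockDensity_le (hα.out : 0 < α)
  have hconst : ∀ f z, opC g ψ f z = opI g id f (ψ 0) := fun f z => by
    rw [opC_eq_opI_comp, hψ z]
  have hdiff : ∀ f, opC g ψ f = fun _ => opI g id f (ψ 0) := fun f => funext (hconst f)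
  obtain ⟨T, hT⟩ := exists_isGivenBy (α := α) (A := opC g ψ) (C := C * B)
    (fun f h hf hh z => opI_add hg differentiable_id hf hh _)
    (fun c f hf z => opI_const_mul c hf _)
    (fun f _ => by rw [hdiff]; exact differentiable_const _) fun f => by
      refine (hC _ (by rw [hdiff]; exact differentiable_const _)).trans ?_
      rw [hdiff, ENNReal.coe_mul, mul_assoc]
      refine mul_le_mul_right ?_ _
      simpa [weightQ] using hB f
  exact ⟨T, hT, memSchatten_of_const (fun f z => by rw [hT, hT, hconst, hconst]) hp⟩

end FockSpace

/-! ### Membership in the Schatten classes -/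

theorem memLp_iff_lintegral_rpow_ne_top {B : ℂ → ℝ≥0∞} (hB : Measurable B) {q : ℝ} (hq : 0 < q) :
    MemLp B (ENNReal.ofReal q) volume ↔ ∫⁻ w, B w ^ q ≠ ∞ := by
  have h1 : ENNReal.ofReal q ≠ 0 := by simpa using hq
  rw [MemLp, eLpNorm_lt_top_iff_lintegral_rpow_enorm_lt_top h1 ENNReal.ofReal_ne_top,
    ENNReal.toReal_ofReal hq.le, lt_top_iff_ne_top]
  simp only [enorm_eq_self]
  exact and_iff_right hB.aestronglyMeasurable

theorem lintegral_rpow_ne_top_of_berezinNorm_le {B : ℂ → ℝ≥0∞} {p : ℝ} (hp : 0 < p) {K : ℝ≥0}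
    {r : ℝ} (h : berezinNorm p B ≤ K * ENNReal.ofReal r) : ∫⁻ w, B w ^ (p / 2) ≠ ∞ := by
  intro ht
  rw [berezinNorm, ht, ENNReal.top_rpow_of_pos (by positivity), top_le_iff] at h
  exact ENNReal.mul_ne_top ENNReal.coe_ne_top ENNReal.ofReal_ne_top h

theorem theorem1 (α : ℝ) [Fact (0 < α)] (p : ℝ) (hp : 0 < p) :
    (∃ K : ℝ≥0, ∀ g ψ : ℂ → ℂ, Differentiable ℂ g → Differentiable ℂ ψ →
      -- the operator `I_{(g,ψ)}`
      (((∃ T : FockSpace α →L[ℂ] FockSpace α, IsGivenBy T (opI g ψ) ∧ MemSchatten p T) ↔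
          MemLp (berezinI α g ψ) (ENNReal.ofReal (p / 2)) volume) ∧
        (∀ (T : FockSpace α →L[ℂ] FockSpace α) (r : ℝ),
          IsGivenBy T (opI g ψ) → HasSchattenNorm p T r →
            ENNReal.ofReal r ≤ K * berezinNorm p (berezinI α g ψ) ∧
            berezinNorm p (berezinI α g ψ) ≤ K * ENNReal.ofReal r)) ∧
      -- the operator `C_{(g,ψ)}`
      (((∃ T : FockSpace α →L[ℂ] FockSpace α, IsGivenBy T (opC g ψ) ∧ MemSchatten p T) ↔
          MemLp (berezinC α g ψ) (ENNReal.ofReal (p / 2)) volume) ∧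
        (∀ (T : FockSpace α →L[ℂ] FockSpace α) (r : ℝ),
          IsGivenBy T (opC g ψ) → HasSchattenNorm p T r →
            (ψ 0 = 0 → ENNReal.ofReal r ≤ K * berezinNorm p (berezinC α g ψ)) ∧
            berezinNorm p (berezinC α g ψ) ≤ K * ENNReal.ofReal r))) ∧
    -- the upper estimate for `C_{(g,ψ)}` when `ψ(0) ≠ 0`
    (∀ ψ : ℂ → ℂ, Differentiable ℂ ψ → (∃ z, ψ z ≠ ψ 0) →
      ∃ L : ℝ≥0, ∀ g : ℂ → ℂ, Differentiable ℂ g →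
        ∀ (T : FockSpace α →L[ℂ] FockSpace α) (r : ℝ),
          IsGivenBy T (opC g ψ) → HasSchattenNorm p T r →
            ENNReal.ofReal r ≤ L * berezinNorm p (berezinC α g ψ)) := by
  have h0 : 0 < α := Fact.out
  have hq : 0 < p / 2 := by positivity
  obtain ⟨K₁, hK₁⟩ := FockSpace.exists_berezinNorm_le α hp
  obtain ⟨K₂, hK₂⟩ := FockSpace.exists_schattenNorm_le α hp 0
  have hTI : ∀ {g ψ : ℂ → ℂ}, Differentiable ℂ g → Differentiable ℂ ψ →
      ∀ {T : FockSpace α →L[ℂ] FockSpace α}, IsGivenBy T (opI g ψ) →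
      ∀ (f : FockSpace α) z, HasDerivAt (T f) (deriv f (ψ z) * g z) z := fun hg hψ T hT f z => by
    rw [show ⇑(T f) = _ from funext (hT f)]
    exact hasDerivAt_opI hg hψ f.differentiable z
  have hTC : ∀ {g ψ : ℂ → ℂ}, Differentiable ℂ g → Differentiable ℂ ψ →
      ∀ {T : FockSpace α →L[ℂ] FockSpace α}, IsGivenBy T (opC g ψ) →
      ∀ (f : FockSpace α) z, HasDerivAt (T f) (deriv f (ψ z) * (g (ψ z) * deriv ψ z)) z :=
    fun hg hψ T hT f z => by
      rw [show ⇑(T f) = _ from funext (hT f)]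
      exact hasDerivAt_opC hg hψ f.differentiable z
  have hG : ∀ {g ψ : ℂ → ℂ}, Differentiable ℂ g → Differentiable ℂ ψ →
      Continuous fun z => g (ψ z) * deriv ψ z := fun hg hψ =>
    (hg.continuous.comp hψ.continuous).mul (deriv_continuous hψ)
  refine ⟨⟨K₁ + K₂, fun g ψ hg hψ => ⟨⟨?_, fun T r hT hr => ⟨?_, ?_⟩⟩,
    ⟨?_, fun T r hT hr => ⟨fun hψ0 => ?_, ?_⟩⟩⟩⟩, fun ψ hψ hne => ?_⟩
  · rw [berezinI_eq_berezinOf α hg.continuous hψ.continuous,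
      memLp_iff_lintegral_rpow_ne_top (measurable_berezinOf α _) hq]
    refine ⟨fun ⟨T, hT, r, hr⟩ => ?_, fun hB => ?_⟩
    · rw [← berezinI_eq_berezinOf α hg.continuous hψ.continuous]
      exact lintegral_rpow_ne_top_of_berezinNorm_le hp
        (hK₁ g ψ hg.continuous hψ.continuous T r (hTI hg hψ hT) hr)
    · exact FockSpace.exists_memSchatten hp hg.continuous hψ.continuous
        (fun f h hf hh => opI_add hg hψ hf hh) (fun c f hf => opI_const_mul c hf)
        (fun f hf => hasDerivAt_opI hg hψ hf) (B := 0) (fun f _ => by simp [opI_apply_zero]) hB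
  · refine (hK₂ g ψ hg.continuous hψ.continuous T r (hTI hg hψ hT)
      (fun f => by simp [hT f 0, opI_apply_zero]) hr).trans ?_
    gcongr
    exact le_add_self
  · refine (hK₁ g ψ hg.continuous hψ.continuous T r (hTI hg hψ hT) hr).trans ?_
    gcongr
    exact le_self_add
  · rw [berezinC_eq_berezinI, berezinI_eq_berezinOf α (hG hg hψ) hψ.continuous,
      memLp_iff_lintegral_rpow_ne_top (measurable_berezinOf α _) hq]
    refine ⟨fun ⟨T, hT, r, hr⟩ => ?_, fun hB => ?_⟩
    · rw [← berezinI_eq_berezinOf α (hG hg hψ) hψ.continuous]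
      exact lintegral_rpow_ne_top_of_berezinNorm_le hp
        (hK₁ _ ψ (hG hg hψ) hψ.continuous T r (hTC hg hψ hT) hr)
    · by_cases hne : ∃ z, ψ z ≠ ψ 0
      · obtain ⟨A, hA⟩ := exists_opC_zero_sq_le_derivForm h0 hψ hne
        exact FockSpace.exists_memSchatten hp (hG hg hψ) hψ.continuous
          (fun f h hf hh z => opI_add hg differentiable_id hf hh _)
          (fun c f hf z => opI_const_mul c hf _)
          (fun f hf => hasDerivAt_opC hg hψ hf) (fun f hf => hA g f hg hf) hB
      · push Not at hne
        exact FockSpace.exists_opC_memSchatten_of_const hp hg hne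
  · rw [berezinC_eq_berezinI]
    refine (hK₂ _ ψ (hG hg hψ) hψ.continuous T r (hTC hg hψ hT)
      (fun f => by simp [hT f 0, opC_eq_opI_comp, hψ0, opI_apply_zero]) hr).trans ?_
    gcongr
    exact le_add_self
  · rw [berezinC_eq_berezinI]
    refine (hK₁ _ ψ (hG hg hψ) hψ.continuous T r (hTC hg hψ hT) hr).trans ?_
    gcongr
    exact le_self_add
  · obtain ⟨A, hA⟩ := exists_opC_zero_sq_le_derivForm h0 hψ hne
    obtain ⟨L, hL⟩ := FockSpace.exists_schattenNorm_le α hp A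
    refine ⟨L, fun g hg T r hT hr => ?_⟩
    rw [berezinC_eq_berezinI]
    exact hL _ ψ (hG hg hψ) hψ.continuous T r (hTC hg hψ hT)
      (fun f => by rw [hT f 0]; exact hA g f hg f.differentiable) hr
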